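/- **Setting.** Graphs are finite and may have parallel edges. A *two-terminal series-parallel graph* is either a single edge $(s,t)$ or arises from $p\ge 2$ such graphs by a series composition (identify the sink of each with the source of the next) or a parallel composition (identify all sources and identify all sinks). Let $G$ be a biconnected graph of maximum degree at most four, and let $e$ be an edge of $G$ such that $G$ is the parallel composition of $e$ and another series-parallel graph. An *SPQ\*-tree* $T$ of $G$ with respect to $e$ is a decomposition tree whose leaves (Q\*-nodes) are single edges or series of edges, whose root is the parallel composition of the Q\*-node of the single edge $e$ with the rest of $G$, in which no non-root P-node has a P-node child and no S-node has an S-node child. For a node $\nu$ of $T$ with poles $u$ (source) and $v$ (sink), $G_\nu$ is the subgraph formed by the edges of the subtree of $\nu$. For $w\in\{u,v\}$ let $\mathrm{indeg}_\nu(w)$ and $\mathrm{outdeg}_\nu(w)$ be the numbers of edges at $w$ inside and outside $G_\nu$. An *orthogonal representation* $H$ of $G$ is a planar embedding of $G$ with a chosen external face and an angle labeling: an angle in $\{90^\circ,180^\circ,270^\circ,360^\circ\}$ between any two consecutive edges around a vertex, and along each edge an ordered sequence of bends, each with an angle of $90^\circ$ on one side and $270^\circ$ on the other, such that (H1) the angles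 at each vertex sum to $360^\circ$, and (H2) for each face $f$, if $N_a(f)$ is the number of angles of $a^\circ$ in $f$ (at vertices and bends), then $N_{90}(f)-N_{270}(f)-2N_{360}(f)$ is $4$ if $f$ is internal and $-4$ if $f$ is external. *Spirality.* Let $H_\nu$ be the restriction of $H$ to $G_\nu$. A pole $w$ with $\mathrm{indeg}_\nu(w)=1$ has itself as its only alias vertex; otherwise each edge at $w$ outside $G_\nu$ carries one alias vertex of $w$, a dummy vertex on its segment incident to $w$ (so there are one or two of them). For a simple path $P$ from $u$ to $v$ in $G_\nu$ and alias vertices $u'$ of $u$ and $v'$ of $v$, let $n(S^{u'v'})$ be the number of right turns minus the number of left turns (at vertices and bends) when moving from $u'$ via $u$, $P$, $v$ to $v'$. The spirality $\sigma(H_\nu)$ is $n(S^{u'v'})$ if both poles have one alias vertex; the mean of the two values $n$ if exactly one pole has two alias vertices; and $\tfrac12\big(n(S^{u'v'})+n(S^{u''v''})\big)$ if both have two, where $u'$ precedes $u''$ counterclockwise around $u$ and $v'$ precedes $v''$ clockwise around $v$. Any simple path $P$ may be used. *Substitution.* Let $H,H'$ be two orthogonal representations of $G$ (possibly with different planar embeddings),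 both with $e$ on the external face, and let $\nu$ be a non-root node of $T$. The embedded labeled graph $H''=\mathrm{Sub}(H_\nu,H'_\nu)$ has the same vertices and edges as $G$. Its cyclic order of edges around each vertex is that of $H'$ among edges of $G_\nu$ and that of $H$ among the other edges, the edges of $G_\nu$ being consecutive at each pole and taking the place of the block they form in $H$; hence the faces $f_l,f_r$ of $H$ to the left and to the right of $H_\nu$ become faces $f''_l,f''_r$ in which the left and right boundary paths of $H_\nu$ are replaced by those of $H'_\nu$. The external face of $H''$ is the one that lies on the same side of $e$ as in $H$. All angles along edges of $G_\nu$, at vertices of $G_\nu$ other than the poles, and at the poles inside $G_\nu$ are those of $H'$; all angles along other edges, at vertices outside $G_\nu$, and at the poles outside $G_\nu$ but not in $f''_l,f''_r$ are those of $H$; the angles at a pole $w$ in $f''_l$ and $f''_r$ are those in $f_l$ and $f_r$ in $H$ if $\mathrm{indeg}_\nu(w)=1$, and those in the corresponding faces $f'_l,f'_r$ of $H'$ if $\mathrm{indeg}_\nu(w)>1$. **Theorem.** Let $G$, $e$, $T$, $\nu$, $H$, $H'$ be as above, with $\nu$ a non-root node of $T$. If $\sigma(H_\nu)=\sigma(H'_\nu)$,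 then $H''=\mathrm{Sub}(H_\nu,H'_\nu)$ is an orthogonal representation of $G$ (again with $e$ on the external face), regardless of the angles at the poles of $\nu$ in $H$ and in $H'$. -/

import Mathlib

namespace SPOrtho

variable {V E : Type*}

/-! ### Darts, walks, degrees in a (multi)graph -/

/-- A dart of `G`: an edge together with a direction, from `fst` to `snd`. -/
@[ext]
structure Dart (G : Graph V E) where
  edge : E
  fst : V
  snd : V
  isLink : G.IsLink edge fst snd

/-- The same edge, traversed in the opposite direction. -/
def Dart.rev {G : Graph V E} (d : Dart G) : Dart G := ⟨d.edge, d.snd, d.fst, d.isLink.symm⟩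

/-- The darts leaving `v`. -/
def dartsAt (G : Graph V E) (v : V) : Set (Dart G) := {d | d.fst = v}

/-- Every vertex has degree at most four. -/
def MaxDegreeFour (G : Graph V E) : Prop := ∀ v, (dartsAt G v).ncard ≤ 4

/-- `p` is the sequence of darts of a walk from `u` to `v`. -/
def IsWalk {G : Graph V E} : V → List (Dart G) → V → Prop
  | u, [], v => u = v
  | u, d :: p, v => d.fst = u ∧ IsWalk d.snd p v

/-- A simple path from `u` to `v`: a walk without repeated vertices. -/
def IsPath {G : Graph V E} (u : V) (p : List (Dart G)) (v : V) : Prop :=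
  IsWalk u p v ∧ (u :: p.map Dart.snd).Nodup

/-- `G` is connected, and stays connected when any one vertex is deleted. -/
def Biconnected (G : Graph V E) : Prop :=
  (∀ x ∈ G.vertexSet, ∀ y ∈ G.vertexSet, ∃ p : List (Dart G), IsWalk x p y) ∧
  ∀ z ∈ G.vertexSet, ∀ x ∈ G.vertexSet, ∀ y ∈ G.vertexSet, x ≠ z → y ≠ z →
    ∃ p : List (Dart G), IsWalk x p y ∧ ∀ d ∈ p, d.fst ≠ z ∧ d.snd ≠ z

/-! ### SPQ*-trees -/

/-- Ordered trees whose leaves are Q*-nodes (an edge, or a series of edges, listed from the source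
to the sink) and whose inner nodes are S-nodes and P-nodes; each node carries its poles
(source `s` and sink `t`). -/
inductive SPQTree (G : Graph V E) where
  | chain (s t : V) (p : List (Dart G))
  | series (s t : V) (k : ℕ) (c : Fin k → SPQTree G)
  | parallel (s t : V) (k : ℕ) (c : Fin k → SPQTree G)

namespace SPQTree

variable {G : Graph V E}

def source : SPQTree G → V
  | chain s _ _ => s
  | series s _ _ _ => s
  | parallel s _ _ _ => s

def sink : SPQTree G → V
  | chain _ t _ => t
  | series _ t _ _ => t
  | parallel _ t _ _ => t

/-- The edges of the pertinent graph. -/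
def edgeSet : SPQTree G → Set E
  | chain _ _ p => {e | ∃ d ∈ p, d.edge = e}
  | series _ _ _ c => ⋃ i, (c i).edgeSet
  | parallel _ _ _ c => ⋃ i, (c i).edgeSet

/-- The vertices of the pertinent graph: the ends of its edges. -/
def vertexSet (T : SPQTree G) : Set V := {x | ∃ e ∈ T.edgeSet, G.Inc e x}

def IsChainNode : SPQTree G → Prop
  | chain _ _ _ => True
  | _ => False

def IsSeriesNode : SPQTree G → Prop
  | series _ _ _ _ => True
  | _ => False

def IsParallelNode : SPQTree G → Prop
  | parallel _ _ _ _ => True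
  | _ => False

/-- The pertinent graphs of the `c i` compose in series, in this order, to a graph with source `s`
and sink `t`: each sink is the next source, and nothing else is shared. -/
def SeriesComposition (s t : V) {k : ℕ} (c : Fin k → SPQTree G) : Prop :=
  2 ≤ k ∧
  (∀ i : Fin k, (i : ℕ) = 0 → (c i).source = s) ∧
  (∀ i : Fin k, (i : ℕ) + 1 = k → (c i).sink = t) ∧
  (∀ i j : Fin k, (i : ℕ) + 1 = j → (c i).sink = (c j).source) ∧
  (∀ i j : Fin k, i ≠ j → Disjoint (c i).edgeSet (c j).edgeSet) ∧
  (∀ i j : Fin k, (i : ℕ) + 1 = j → (c i).vertexSet ∩ (c j).vertexSet = {(c i).sink}) ∧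
  (∀ i j : Fin k, (i : ℕ) + 1 < j → Disjoint (c i).vertexSet (c j).vertexSet)

/-- The pertinent graphs of the `c i` compose in parallel to a graph with source `s` and sink `t`:
they all have these poles and share nothing else. -/
def ParallelComposition (s t : V) {k : ℕ} (c : Fin k → SPQTree G) : Prop :=
  2 ≤ k ∧
  (∀ i : Fin k, (c i).source = s ∧ (c i).sink = t) ∧
  (∀ i j : Fin k, i ≠ j → Disjoint (c i).edgeSet (c j).edgeSet) ∧
  (∀ i j : Fin k, i ≠ j → (c i).vertexSet ∩ (c j).vertexSet = {s, t})

/-- A decomposition tree of its pertinent graph, in reduced form: an S-node has no S-node child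
(and not only Q*-node children, otherwise it would be a Q*-node), a P-node has no P-node child. -/
def IsReduced : SPQTree G → Prop
  | chain s t p => p ≠ [] ∧ IsPath s p t
  | series s t _ c => SeriesComposition s t c ∧ (∀ i, (c i).IsReduced) ∧
      (∀ i, ¬ (c i).IsSeriesNode) ∧ (∃ i, ¬ (c i).IsChainNode)
  | parallel s t _ c => ParallelComposition s t c ∧ (∀ i, (c i).IsReduced) ∧
      (∀ i, ¬ (c i).IsParallelNode)

/-- `T` is an SPQ*-tree of `G` with respect to the reference edge `e`: it decomposes all of `G`, and
its root is a parallel composition of two children, one of which is the Q*-node of the single edge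
`e`. The root, unlike the other P-nodes, may have a P-node child. -/
def IsSPQTree (G : Graph V E) (e : E) (T : SPQTree G) : Prop :=
  T.edgeSet = G.edgeSet ∧ T.vertexSet = G.vertexSet ∧
  ∃ (s t : V) (c : Fin 2 → SPQTree G), T = parallel s t 2 c ∧
    ParallelComposition s t c ∧ (∀ i, (c i).IsReduced) ∧
    ∃ (i : Fin 2) (d : Dart G), d.edge = e ∧ c i = chain s t [d]

/-- `T.IsNode ν`: `ν` is (the subtree rooted at) a node of `T`. -/
inductive IsNode (T : SPQTree G) : SPQTree G → Prop
  | root : IsNode T T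
  | series {s t : V} {k : ℕ} {c : Fin k → SPQTree G} (i : Fin k) :
      IsNode T (.series s t k c) → IsNode T (c i)
  | parallel {s t : V} {k : ℕ} {c : Fin k → SPQTree G} (i : Fin k) :
      IsNode T (.parallel s t k c) → IsNode T (c i)

/-- The darts whose edge belongs to the pertinent graph. -/
def darts (ν : SPQTree G) : Set (Dart G) := {d | d.edge ∈ ν.edgeSet}

/-- The degree of `w` inside the pertinent graph. -/
noncomputable def indeg (ν : SPQTree G) (w : V) : ℕ := (dartsAt G w ∩ ν.darts).ncard

end SPQTree

/-! ### Embedded graphs with an angle labeling, orthogonal representations -/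

/-- A graph embedding, given by its rotation system, with an angle labeling. Angles are measured in
multiples of 90 degrees.
* `cw d` is the dart that follows `d` clockwise around the origin of `d`;
* `angle d` is the angle swept when turning clockwise from `d` to `cw d`;
* `bends d` lists the angles, in the face to the left of `d`, at the bends met along `d`. -/
structure LabeledMap (G : Graph V E) where
  cw : Dart G → Dart G
  angle : Dart G → ℕ
  bends : Dart G → List ℕ

namespace LabeledMap

variable {G : Graph V E}

/-- The dart after `d` on the boundary of the face to the left of `d`, walking with the face on the
left. The angle of this face at the common vertex of the two darts is `angle d.rev`. -/
def faceNext (M : LabeledMap G) (d : Dart G) : Dart G := M.cw d.rev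

/-- The face to the left of `d`, as the set of the darts that have this face on their left. -/
def face (M : LabeledMap G) (d : Dart G) : Set (Dart G) := {x | ∃ n : ℕ, M.faceNext^[n] d = x}

open Classical in
/-- The number of angles equal to `a` (times 90 degrees) in the face to the left of `d`, at vertices
and at bends. -/
noncomputable def faceAngles (M : LabeledMap G) (d : Dart G) (a : ℕ) : ℕ :=
  ∑ᶠ x ∈ M.face d, ((if M.angle x.rev = a then 1 else 0) + (M.bends x).count a)

open Classical in
/-- `M` is an orthogonal representation of the connected graph `G` whose external face is the face
to the left of the dart `o`. -/
structure IsOrthogonalRep (M : LabeledMap G) (o : Dart G) : Prop where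
  /-- `cw` permutes the darts at each vertex cyclically. -/
  cw_fst : ∀ d, (M.cw d).fst = d.fst
  cw_trans : ∀ d d' : Dart G, d.fst = d'.fst → ∃ n : ℕ, M.cw^[n] d = d'
  /-- The embedding is planar, by Euler's formula. -/
  planar : G.vertexSet.ncard + (Set.range M.face).ncard = G.edgeSet.ncard + 2
  angle_mem : ∀ d, M.angle d ∈ ({1, 2, 3, 4} : Set ℕ)
  bends_mem : ∀ d, ∀ a ∈ M.bends d, a = 1 ∨ a = 3
  bends_rev : ∀ d, M.bends d.rev = ((M.bends d).map (4 - ·)).reverse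
  /-- The angles at each vertex sum up to 360 degrees. -/
  vertex_sum : ∀ v ∈ G.vertexSet, ∑ᶠ d ∈ dartsAt G v, M.angle d = 4
  /-- In each face, the number of 90 degree angles minus the number of 270 degree angles minus twice
  the number of 360 degree angles is 4, or -4 for the external face. -/
  face_sum : ∀ d, (M.faceAngles d 1 : ℤ) - M.faceAngles d 3 - 2 * M.faceAngles d 4 =
    if d ∈ M.face o then -4 else 4

/-! ### Spirality -/

/-- The angle swept when turning clockwise from `a` to `b`, two darts with the same origin. -/
noncomputable def sweep (M : LabeledMap G) (a b : Dart G) : ℕ :=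
  ∑ i ∈ Finset.range (sInf {k : ℕ | 0 < k ∧ M.cw^[k] a = b}), M.angle (M.cw^[i] a)

/-- The turn when entering a vertex along `d` and leaving it along `d'`: the angle on the left-hand
side is `sweep d.rev d'`, so this is 1 for a right turn, -1 for a left turn, 0 for no turn. -/
noncomputable def turn (M : LabeledMap G) (d d' : Dart G) : ℤ := (M.sweep d.rev d' : ℤ) - 2

/-- Right turns minus left turns at the inner vertices of a walk. -/
noncomputable def vertexTurns (M : LabeledMap G) : List (Dart G) → ℤ
  | d :: d' :: p => M.turn d d' + vertexTurns M (d' :: p)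
  | _ => 0

/-- Right turns minus left turns at the bends of a walk. -/
def bendTurns (M : LabeledMap G) (p : List (Dart G)) : ℤ :=
  (p.map fun d => ((M.bends d).count 3 : ℤ) - (M.bends d).count 1).sum

open Classical in
/-- The alias vertices of a pole `w` of `ν`: `none` is `w` itself, and `some a` is a dummy vertex on
the segment incident to `w` of the edge of `a`, where `a` is a dart that leaves `w` outside the
component. -/
noncomputable def aliases (ν : SPQTree G) (w : V) : Set (Option (Dart G)) :=
  if ν.indeg w = 1 then {none} else some '' (dartsAt G w \ ν.darts)

/-- Right turns minus left turns along the spine from the alias vertex `a` of the first pole through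
the path `p` to the alias vertex `b` of the second pole. Bends on the edges that carry a dummy vertex
are not on the spine. -/
noncomputable def spineTurns (M : LabeledMap G) (a : Option (Dart G)) (p : List (Dart G))
    (b : Option (Dart G)) : ℤ :=
  M.vertexTurns (a.toList.map Dart.rev ++ p ++ b.toList) + M.bendTurns p

/-- The component of `ν` has spirality `σ` in `M`, as computed along some simple path `p` between
the poles inside the component. The alias vertices of the source are `a, a'`, those of the sink are
`b, b'`, where `a = a'` (`b = b'`) if there is only one. If both poles have two alias vertices, `a`
precedes `a'` counterclockwise around the source and `b` precedes `b'` clockwise around the sink. -/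
def HasSpirality (M : LabeledMap G) (ν : SPQTree G) (σ : ℚ) : Prop :=
  ∃ p : List (Dart G), IsPath ν.source p ν.sink ∧ (∀ d ∈ p, d ∈ ν.darts) ∧
  ∃ a a' b b' : Option (Dart G),
    aliases ν ν.source = {a, a'} ∧ aliases ν ν.sink = {b, b'} ∧
    (a ≠ a' → b ≠ b' → a'.map M.cw = a ∧ b.map M.cw = b') ∧
    σ = ((M.spineTurns a p b : ℚ) + M.spineTurns a' p b') / 2

/-! ### Substitution of a component -/

/-- Iterating `f` from `x`, the last element before the first one (after `x`) that lies in `S`. -/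
noncomputable def lastBefore {α : Type*} (f : α → α) (S : Set α) (x : α) : α :=
  f^[sInf {k : ℕ | f^[k + 1] x ∈ S}] x

open Classical in
/-- The substitution, in `M`, of the component of `ν` by the one of `M'`.

Around each pole the darts of the component form a block, and so do the others. The cyclic order
inside the component is the one of `M'`, outside it is the one of `M`; after the last dart of one
block comes the first dart of the other block. There are two angles at a pole `w` between the blocks,
one in the face to the left of the component and one in the face to its right: one is the angle
clockwise from the component to the outside, the other from the outside to the component. Both are
as in `M` if `w` has degree 1 inside the component, and as in `M'` otherwise. All other angles and all
bends are as in `M'` inside the component and as in `M` outside. -/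
noncomputable def sub (M M' : LabeledMap G) (ν : SPQTree G) : LabeledMap G where
  cw d :=
    if d ∈ ν.darts then
      if M'.cw d ∈ ν.darts then M'.cw d else M.cw (lastBefore M.cw ν.dartsᶜ d)
    else
      if M.cw d ∈ ν.darts then M'.cw (lastBefore M'.cw ν.darts d) else M.cw d
  angle d :=
    if d ∈ ν.darts then
      if M'.cw d ∈ ν.darts then M'.angle d
      else if ν.indeg d.fst = 1 then M.angle (lastBefore M.cw ν.dartsᶜ d)
      else M'.angle d
    else
      if M.cw d ∈ ν.darts then
        if ν.indeg d.fst = 1 then M.angle d else M'.angle (lastBefore M'.cw ν.darts d)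
      else M.angle d
  bends d := if d ∈ ν.darts then M'.bends d else M.bends d

end LabeledMap

end SPOrtho

/-! Give each dart the weight "angle on its left at its end, minus 2, plus right turns minus left
turns at its bends". Then (H2) says that the weights around a face add up to -4, or to 4 around the
external face, and (H1) says that the angles around a vertex add up to 4. Faces of H'' that run only
inside or only outside the component are faces of H' or of H with unchanged weights, so everything
rests on the two faces that pass between the component and the rest.

The core is a discrete Gauss-Bonnet argument (`LabeledMap.IsPlanar.spineTurns_eq`). A path between
the poles and the left boundary of the component enclose a region. Its inner vertices contribute 4
each, its inner faces -4 each, and Euler's formula for the region cancels all of this. Hence the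
turns along a spine equal the turns along the left boundary, up to the angle at one pole. Averaging
over the alias vertices (`LabeledMap.IsDrawing.boundary_eq`) shows that the left boundary, together
with exactly those pole angles that the substitution moves with it, has a total fixed by the
spirality and the degrees at the poles. Components of equal spirality therefore contribute equally
to the left face (`sub_face_left`). The right boundary becomes a left boundary when the poles are
exchanged, which negates the spirality (`LabeledMap.HasTurning.swap`).

The topology is done with permutations: vertices are the cycles of the clockwise order, faces the
cycles of its product with the reversal of darts. Contracting or cutting multiplies by
transpositions, and Euler's inequality `euler_le` is the one topological input. Counting cycles
yields the Jordan curve theorem (`LabeledMap.IsPlanar.jordan`), that a component is a block around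
each vertex (`LabeledMap.IsPlanar.isBlock`), and that its two corners at a pole lie in different
faces.

The tree enters through `Sep`: a component meets the rest only in its poles, and its darts, or those
of its complement, are linked without passing through the poles. This last condition prevents the
two from interleaving around a pole. In addition, a non-root node either avoids `e` or is the single
edge `e`.

Planarity of H'' needs no topology: once the sums at vertices and faces are right, double counting
gives Euler's formula (`isOrthogonalRep_of_sums`). The sums at the vertices hold because the angles
at each vertex all come from H or all from H' (`sub_angle_at`). -/

namespace SPOrtho

/-! ### Counting the cycles of permutations -/

section Permutations

open Equiv Equiv.Perm

variable {α : Type*}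

/-- The number of classes of an equivalence relation. -/
noncomputable def numClasses (s : Setoid α) : ℕ := Nat.card (Quotient s)

theorem numClasses_ker {β : Type*} (f : α → β) :
    numClasses (Setoid.ker f) = (Set.range f).ncard :=
  Nat.card_congr (Setoid.quotientKerEquivRange f)

theorem setoid_le_iff (a : Perm α) (t : Setoid α) :
    SameCycle.setoid a ≤ t ↔ ∀ x, t x (a x) := by
  constructor
  · intro h x
    exact h (show SameCycle a x (a x) from ⟨1, by simp⟩)
  · rintro h x y ⟨i, rfl⟩
    induction i using Int.induction_on with
    | zero => exact t.refl' x
    | succ n ih =>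
      refine t.trans' ih ?_
      have := h ((a ^ (n : ℤ)) x)
      rwa [← Perm.mul_apply, ← zpow_one_add, add_comm] at this
    | pred n ih =>
      refine t.trans' ih (t.symm' ?_)
      have := h ((a ^ (-(n : ℤ) - 1)) x)
      rwa [← Perm.mul_apply, ← zpow_one_add, show (1 : ℤ) + (-(n : ℤ) - 1) = -n by ring] at this

theorem setoid_apply_self (a : Perm α) (x : α) : SameCycle.setoid a x (a x) :=
  (setoid_le_iff a _).1 le_rfl x

theorem setoid_one : SameCycle.setoid (1 : Perm α) = ⊥ := by
  ext x y
  exact sameCycle_one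

/-- A relation invariant under a family of maps is constant on the classes they generate. -/
theorem mem_iff_of_sup {a r : Perm α} {Y : Set α} (ha : ∀ x, x ∈ Y ↔ a x ∈ Y)
    (hr : ∀ x, x ∈ Y ↔ r x ∈ Y) {x y : α}
    (h : (SameCycle.setoid a ⊔ SameCycle.setoid r) x y) : x ∈ Y ↔ y ∈ Y := by
  have : SameCycle.setoid a ⊔ SameCycle.setoid r ≤ Setoid.ker (fun x => x ∈ Y) :=
    sup_le ((setoid_le_iff _ _).2 fun x => propext (ha x))
      ((setoid_le_iff _ _).2 fun x => propext (hr x))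
  exact iff_of_eq (this h)

variable [DecidableEq α]

open Classical in
-- Joining `x` and `y` only identifies two classes, so redirecting the class of `y` to that of `x`
-- describes the join as the fibres of an explicit map. Both the count of classes and the case
-- distinction in `sup_swap_iff` are read off from it.
theorem sup_swap_eq_ker (s : Setoid α) (x y : α) :
    s ⊔ SameCycle.setoid (swap x y) =
      Setoid.ker (fun p => if s p y then Quotient.mk s x else Quotient.mk s p) := by
  set F : α → Quotient s := fun p => if s p y then Quotient.mk s x else Quotient.mk s p with hF
  apply le_antisymm
  · refine sup_le ?_ ((setoid_le_iff _ _).2 ?_)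
    · intro p q hpq
      change F p = F q
      have h1 : s p y ↔ s q y := ⟨fun h => s.trans' (s.symm' hpq) h, fun h => s.trans' hpq h⟩
      simp only [hF, h1]
      split_ifs
      · rfl
      · exact Quotient.sound hpq
    · intro p
      change F p = F (swap x y p)
      have hy : F y = Quotient.mk s x := by simp [hF]
      have hx : F x = Quotient.mk s x := by simp [hF]
      rcases eq_or_ne p x with rfl | h1
      · rw [swap_apply_left, hx, hy]
      · rcases eq_or_ne p y with rfl | h2
        · rw [swap_apply_right, hx, hy]
        · rw [swap_apply_of_ne_of_ne h1 h2]
  · set t := s ⊔ SameCycle.setoid (swap x y) with ht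
    have hst : s ≤ t := le_sup_left
    have hxy : t x y := by
      have := (le_sup_right : SameCycle.setoid (swap x y) ≤ t) (setoid_apply_self (swap x y) x)
      rwa [swap_apply_left] at this
    have key : ∀ p, ∃ z, F p = Quotient.mk s z ∧ t p z := by
      intro p
      by_cases h : s p y
      · exact ⟨x, by simp [hF, h], t.trans' (hst h) (t.symm' hxy)⟩
      · exact ⟨p, by simp [hF, h], t.refl' p⟩
    intro p q hpq
    change F p = F q at hpq
    obtain ⟨z, hz, hpz⟩ := key p
    obtain ⟨z', hz', hqz⟩ := key q
    rw [hz, hz'] at hpq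
    exact t.trans' hpz (t.trans' (hst (Quotient.exact hpq)) (t.symm' hqz))

open Classical in
theorem sup_swap_iff (s : Setoid α) (x y p q : α) :
    (s ⊔ SameCycle.setoid (swap x y)) p q ↔ s p q ∨ (s p x ∧ s y q) ∨ (s p y ∧ s x q) := by
  have hst : s ≤ s ⊔ SameCycle.setoid (swap x y) := le_sup_left
  constructor
  · intro h
    rw [sup_swap_eq_ker] at h
    change (if s p y then Quotient.mk s x else Quotient.mk s p) =
      (if s q y then Quotient.mk s x else Quotient.mk s q) at h
    split_ifs at h with h1 h2 h2
    · exact Or.inl (s.trans' h1 (s.symm' h2))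
    · exact Or.inr (Or.inr ⟨h1, Quotient.exact h⟩)
    · exact Or.inr (Or.inl ⟨Quotient.exact h, s.symm' h2⟩)
    · exact Or.inl (Quotient.exact h)
  · have hxy : (s ⊔ SameCycle.setoid (swap x y)) x y := by
      have := (le_sup_right : SameCycle.setoid (swap x y) ≤ s ⊔ SameCycle.setoid (swap x y))
        (setoid_apply_self (swap x y) x)
      rwa [swap_apply_left] at this
    rintro (h | ⟨h1, h2⟩ | ⟨h1, h2⟩)
    · exact hst h
    · exact Setoid.trans' _ (hst h1) (Setoid.trans' _ hxy (hst h2))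
    · exact Setoid.trans' _ (hst h1) (Setoid.trans' _ (Setoid.symm' _ hxy) (hst h2))

theorem sup_swap_of_rel {s : Setoid α} {x y : α} (h : s x y) :
    s ⊔ SameCycle.setoid (swap x y) = s := by
  refine sup_eq_left.2 ((setoid_le_iff _ _).2 fun p => ?_)
  rcases eq_or_ne p x with rfl | h1
  · rwa [swap_apply_left]
  · rcases eq_or_ne p y with rfl | h2
    · rw [swap_apply_right]; exact s.symm' h
    · rw [swap_apply_of_ne_of_ne h1 h2]

theorem numClasses_sup_swap [Finite α] {s : Setoid α} {x y : α} (h : ¬ s x y) :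
    numClasses (s ⊔ SameCycle.setoid (swap x y)) + 1 = numClasses s := by
  classical
  rw [sup_swap_eq_ker, numClasses_ker]
  have : Set.range (fun p => if s p y then Quotient.mk s x else Quotient.mk s p) =
      Set.univ \ {Quotient.mk s y} := by
    ext q
    induction q using Quotient.inductionOn with
    | h q =>
    simp only [Set.mem_range, Set.mem_sdiff, Set.mem_univ, true_and, Set.mem_singleton_iff]
    constructor
    · rintro ⟨p, hp⟩ hq
      rw [hq] at hp
      split_ifs at hp with h1
      · exact h (Quotient.exact hp)
      · exact h1 (Quotient.exact hp)
    · intro hq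
      have : ¬ s q y := fun h => hq (Quotient.sound h)
      exact ⟨q, by simp [this]⟩
  rw [this, Set.ncard_sdiff (by simp), Set.ncard_univ, Set.ncard_singleton, numClasses]
  have : 0 < Nat.card (Quotient s) := Nat.card_pos_iff.2 ⟨⟨Quotient.mk s x⟩, inferInstance⟩
  omega

/-- Each of `a` and `a * swap x y` is a product of the other with the transposition, so nothing
changes once `x` and `y` are glued. This is the bookkeeping rule behind every contraction and cut
below. -/
theorem setoid_mul_swap_sup (a : Perm α) (x y : α) :
    SameCycle.setoid (a * swap x y) ⊔ SameCycle.setoid (swap x y) =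
      SameCycle.setoid a ⊔ SameCycle.setoid (swap x y) := by
  have key : ∀ b : Perm α, SameCycle.setoid (b * swap x y) ≤
      SameCycle.setoid b ⊔ SameCycle.setoid (swap x y) := by
    intro b
    refine (setoid_le_iff _ _).2 fun p => ?_
    refine Setoid.trans' _ (y := swap x y p) ?_ ?_
    · exact (le_sup_right : _ ≤ SameCycle.setoid b ⊔ SameCycle.setoid (swap x y))
        (setoid_apply_self _ _)
    · exact (le_sup_left : _ ≤ SameCycle.setoid b ⊔ SameCycle.setoid (swap x y))
        (setoid_apply_self _ _)
  refine le_antisymm (sup_le (key a) le_sup_right) (sup_le ?_ le_sup_right)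
  have := key (a * swap x y)
  rwa [mul_assoc, swap_mul_self, mul_one] at this

/-- The product sends `y` to `a x` and then follows `a` along the cycle of `x`, which does not meet
`y`, until it arrives at `x`. -/
theorem sameCycle_mul_swap_of_not [Finite α] {a : Perm α} {x y : α} (h : ¬ SameCycle a x y) :
    SameCycle (a * swap x y) x y := by
  have hxy : x ≠ y := fun e => h (e ▸ SameCycle.refl a x)
  have hay : (a * swap x y) y = a x := by simp
  have key : ∀ j : ℕ, SameCycle (a * swap x y) y ((a ^ (j + 1)) x) := by
    intro j
    induction j with
    | zero => rw [zero_add, pow_one, ← hay]; exact ⟨1, by simp⟩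
    | succ n ih =>
      rcases eq_or_ne ((a ^ (n + 1)) x) x with e | e
      · rw [pow_succ', Perm.mul_apply, e, ← hay]; exact ⟨1, by simp⟩
      · have e2 : (a ^ (n + 1)) x ≠ y := fun e => h ⟨(n + 1 : ℕ), by rw [zpow_natCast]; exact e⟩
        refine ih.trans ⟨1, ?_⟩
        rw [zpow_one, Perm.mul_apply, swap_apply_of_ne_of_ne e e2, pow_succ' a (n + 1)]
        rfl
  -- With this exponent the power in `key` is `a ^ orderOf a`, which fixes `x`.
  have := key (orderOf a - 1)
  rw [Nat.sub_add_cancel (orderOf_pos a), pow_orderOf_eq_one] at this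
  exact this.symm

/-- The arc of `a` that starts just after `y` and ends at `x` is closed under the product, since `x`
is now sent to `a y`. It contains `x` but not `y`. -/
theorem not_sameCycle_mul_swap [Finite α] {a : Perm α} {x y : α} (hxy : x ≠ y)
    (h : SameCycle a x y) : ¬ SameCycle (a * swap x y) x y := by
  obtain ⟨n, hn⟩ := h.symm.exists_nat_pow_eq
  have hex : ∃ n, (a ^ n) y = x := ⟨n, hn⟩
  classical
  set j := Nat.find hex with hj
  have hjx : (a ^ j) y = x := Nat.find_spec hex
  have hmin : ∀ m < j, (a ^ m) y ≠ x := fun m hm => Nat.find_min hex hm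
  have hj0 : 0 < j := by
    rcases Nat.eq_zero_or_pos j with h0 | h0
    · rw [h0] at hjx; exact absurd hjx.symm hxy
    · exact h0
  have hny : ∀ m, 0 < m → m ≤ j → (a ^ m) y ≠ y := by
    intro m hm0 hmj e
    have : (a ^ (j - m)) y = x := by
      rw [← hjx]
      conv_rhs => rw [← Nat.sub_add_cancel hmj, pow_add, Perm.mul_apply, e]
    exact hmin _ (by omega) this
  set Y : Set α := {z | ∃ m, 0 < m ∧ m ≤ j ∧ (a ^ m) y = z} with hY
  have hclosed : ∀ z ∈ Y, (a * swap x y) z ∈ Y := by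
    rintro z ⟨m, hm0, hmj, rfl⟩
    rcases hmj.lt_or_eq with hlt | rfl
    · refine ⟨m + 1, by omega, hlt, ?_⟩
      rw [Perm.mul_apply, swap_apply_of_ne_of_ne (hmin m hlt) (hny m hm0 hmj), pow_succ']
      rfl
    · exact ⟨1, one_pos, hj0, by rw [hjx]; simp⟩
  intro hc
  obtain ⟨i, hi⟩ := hc.exists_nat_pow_eq
  have hall : ∀ i : ℕ, ((a * swap x y) ^ i) x ∈ Y := by
    intro i
    induction i with
    | zero => exact ⟨j, hj0, le_rfl, by simpa using hjx⟩
    | succ n ih => rw [pow_succ', Perm.mul_apply]; exact hclosed _ ih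
  obtain ⟨m, hm0, hmj, e⟩ := hall i
  exact hny m hm0 hmj (e.trans hi)

theorem numClasses_mul_swap_of_not [Finite α] {a : Perm α} {x y : α} (h : ¬ SameCycle a x y) :
    numClasses (SameCycle.setoid (a * swap x y)) + 1 = numClasses (SameCycle.setoid a) := by
  rw [← numClasses_sup_swap (s := SameCycle.setoid a) h, ← setoid_mul_swap_sup,
    sup_swap_of_rel (s := SameCycle.setoid (a * swap x y)) (sameCycle_mul_swap_of_not h)]

theorem numClasses_mul_swap_of_sameCycle [Finite α] {a : Perm α} {x y : α} (hxy : x ≠ y)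
    (h : SameCycle a x y) :
    numClasses (SameCycle.setoid (a * swap x y)) = numClasses (SameCycle.setoid a) + 1 := by
  have := numClasses_mul_swap_of_not (not_sameCycle_mul_swap hxy h)
  rw [mul_assoc, swap_mul_self, mul_one] at this
  exact this.symm

theorem numClasses_mul_swap_le [Finite α] (a : Perm α) (x y : α) :
    numClasses (SameCycle.setoid (a * swap x y)) ≤ numClasses (SameCycle.setoid a) + 1 := by
  rcases eq_or_ne x y with rfl | hxy
  · rw [swap_self]; simp [← Perm.one_def]
  · by_cases h : SameCycle a x y
    · exact (numClasses_mul_swap_of_sameCycle hxy h).le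
    · have := numClasses_mul_swap_of_not h; omega

/-- Away from `x` and `y`, multiplication by the transposition of `x` and `y` preserves cycles. -/
theorem sameCycle_mul_swap_iff {a : Perm α} {x y d : α}
    (hx : ¬ SameCycle (a * swap x y) d x)
    (hy : ¬ SameCycle (a * swap x y) d y) (z : α) :
    SameCycle (a * swap x y) d z ↔ SameCycle a d z := by
  have e := setoid_mul_swap_sup a x y
  have key : ∀ w, SameCycle a d w → SameCycle (a * swap x y) d w := by
    intro w hw
    have : (SameCycle.setoid (a * swap x y) ⊔ SameCycle.setoid (swap x y)) d w := by
      rw [e, sup_swap_iff]; exact Or.inl hw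
    rw [sup_swap_iff] at this
    rcases this with h | ⟨h, -⟩ | ⟨h, -⟩
    · exact h
    · exact absurd h hx
    · exact absurd h hy
  refine ⟨fun hz => ?_, key z⟩
  have : (SameCycle.setoid a ⊔ SameCycle.setoid (swap x y)) d z := by
    rw [← e, sup_swap_iff]; exact Or.inl hz
  rw [sup_swap_iff] at this
  rcases this with h | ⟨h, -⟩ | ⟨h, -⟩
  · exact h
  · exact absurd (key _ h) hx
  · exact absurd (key _ h) hy

/-- A fixed point can only be merged by a transposition, never split off. It is used to put a
2-cycle back into an involution. -/
theorem setoid_mul_swap_of_fixed {r : Perm α} {x y : α} (hy : r y = y) :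
    SameCycle.setoid (r * swap x y) = SameCycle.setoid r ⊔ SameCycle.setoid (swap x y) := by
  rcases eq_or_ne x y with rfl | hxy
  · rw [swap_self, ← Perm.one_def, setoid_one, mul_one, sup_bot_eq]
  rw [← setoid_mul_swap_sup, eq_comm]
  refine sup_swap_of_rel (s := SameCycle.setoid (r * swap x y)) ?_
  exact ⟨1, by simp [hy]⟩

/-- Euler's inequality for a combinatorial map. -/
theorem euler_le [Fintype α] (a r : Perm α) (hr : ∀ x, r (r x) = x) :
    2 * numClasses (SameCycle.setoid a) + 2 * numClasses (SameCycle.setoid (a * r)) ≤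
      r.support.card + 4 * numClasses (SameCycle.setoid a ⊔ SameCycle.setoid r) := by
  -- Remove one 2-cycle `(x y)` of the involution, that is, one edge. For `r = 1` both sides equal
  -- four times the number of cycles of `a`.
  induction hn : r.support.card using Nat.strong_induction_on generalizing r with
  | _ n ih =>
  rcases Finset.eq_empty_or_nonempty r.support with h0 | ⟨x, hx⟩
  · rw [support_eq_empty_iff] at h0
    subst h0
    rw [mul_one, setoid_one, sup_bot_eq]
    omega
  have hxr : r x ≠ x := mem_support.1 hx
  set y := r x with hy
  have hry : r y = x := hr x
  set r' := r * swap x y with hr'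
  have hrr : r = r' * swap x y := by rw [hr', mul_assoc, swap_mul_self, mul_one]
  have hx' : r' x = x := by simp [hr', hry]
  have hy' : r' y = y := by simp [hr', hy]
  have hne : ∀ z, z ≠ x → z ≠ y → r' z = r z := fun z h1 h2 => by
    simp [hr', swap_apply_of_ne_of_ne h1 h2]
  have hsupp : r.support = insert x (insert y r'.support) := by
    ext z
    simp only [mem_support, Finset.mem_insert]
    by_cases h1 : z = x
    · rw [h1]; simpa using hxr
    by_cases h2 : z = y
    · rw [h2, hry]; simp [hxr.symm]
    simp [h1, h2, hne z h1 h2]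
  have hcard : r.support.card = r'.support.card + 2 := by
    rw [hsupp, Finset.card_insert_of_notMem, Finset.card_insert_of_notMem]
    · simp [hy']
    · simp [hx', hxr.symm]
  have hinv : ∀ z, r' (r' z) = z := by
    intro z
    rcases eq_or_ne z x with rfl | h1
    · rw [hx', hx']
    rcases eq_or_ne z y with rfl | h2
    · rw [hy', hy']
    rw [hne z h1 h2, hne, hr]
    · intro e; apply h2; rw [← hr z, e]
    · intro e; apply h1; rw [← hr z, e, hry]
  have IH := ih r'.support.card (by omega) r' hinv rfl
  have hsup : SameCycle.setoid a ⊔ SameCycle.setoid r =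
      (SameCycle.setoid a ⊔ SameCycle.setoid r') ⊔ SameCycle.setoid (swap x y) := by
    rw [sup_assoc, ← setoid_mul_swap_of_fixed hy', ← hrr]
  have hmul : a * r = a * r' * swap x y := by rw [mul_assoc, ← hrr]
  rw [hsup, hmul]
  -- Putting the edge back adds 2 to the support. Inside a component it creates at most one new
  -- face. Between two components it merges them and also merges two faces, so both sides drop by 2.
  by_cases hc : (SameCycle.setoid a ⊔ SameCycle.setoid r') x y
  · rw [sup_swap_of_rel hc]
    have := numClasses_mul_swap_le (a * r') x y
    omega
  · have h1 := numClasses_sup_swap hc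
    have h2 : ¬ SameCycle (a * r') x y := by
      intro h
      apply hc
      have : SameCycle.setoid (a * r') ≤ SameCycle.setoid a ⊔ SameCycle.setoid r' := by
        refine (setoid_le_iff _ _).2 fun p => Setoid.trans' _ (y := r' p) ?_ ?_
        · exact (le_sup_right : _ ≤ SameCycle.setoid a ⊔ SameCycle.setoid r')
            (setoid_apply_self _ _)
        · exact (le_sup_left : _ ≤ SameCycle.setoid a ⊔ SameCycle.setoid r')
            (setoid_apply_self _ _)
      exact this h
    have h3 := numClasses_mul_swap_of_not h2
    omega

end Permutations

/-! ### Euler's formula on a union of components, and sums over orbits -/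

section Permutations

open Equiv Equiv.Perm

variable {α : Type*}

/-- The number of classes of `s` that meet `X`. -/
noncomputable def numClassesIn (s : Setoid α) (X : Set α) : ℕ :=
  numClasses (s.comap (Subtype.val : X → α))

theorem numClassesIn_add_compl [Finite α] {s : Setoid α} {X : Set α}
    (hX : ∀ x y, s x y → (x ∈ X ↔ y ∈ X)) :
    numClassesIn s X + numClassesIn s Xᶜ = numClasses s := by
  have h1 : ∀ Y : Set α, numClassesIn s Y = (Quotient.mk s '' Y).ncard := by
    intro Y
    have : s.comap (Subtype.val : Y → α) =
        Setoid.ker (fun y : Y => Quotient.mk s (y : α)) := by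
      ext x y
      exact ⟨fun h => Quotient.sound h, fun h => Quotient.exact (s := s) (a := (x : α)) (b := y) h⟩
    rw [numClassesIn, this, numClasses_ker]
    congr 1
    ext q
    simp
  rw [h1, h1, ← Set.ncard_union_eq, ← Set.image_union, Set.union_compl_self, Set.image_univ,
    Set.range_quotient_mk, Set.ncard_univ, numClasses]
  rw [Set.disjoint_left]
  rintro q ⟨x, hx, rfl⟩ ⟨y, hy, hxy⟩
  exact hy ((hX y x (Quotient.exact hxy)).2 hx)

open Classical in
-- Summing class by class, with the class of `x₀` as the only exception. It is applied to angles,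
-- where the classes are vertices and `κ = 4`, and to weights, where the classes are faces and `κ =
-- -4`.
theorem sum_eq_of_classes [Fintype α] (s : Setoid α) (g : α → ℤ) (x₀ : α) (κ θ : ℤ)
    (h₀ : ∑ y with s x₀ y, g y = θ) (h : ∀ x, ¬ s x₀ x → ∑ y with s x y, g y = κ) :
    ∑ y, g y = κ * (numClasses s - 1) + θ := by
  have h1 : ∑ y, g y = ∑ q : Quotient s, ∑ y with Quotient.mk s y = q, g y :=
    (Finset.sum_fiberwise _ _ _).symm
  have h2 : ∀ x, ∑ y with Quotient.mk s y = Quotient.mk s x, g y = ∑ y with s x y, g y := by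
    intro x
    congr 1
    ext y
    simp only [Finset.mem_filter, Finset.mem_univ, true_and]
    exact ⟨fun e => s.symm' (Quotient.exact e), fun e => Quotient.sound (s.symm' e)⟩
  rw [h1, ← Finset.add_sum_erase _ _ (Finset.mem_univ (Quotient.mk s x₀)), h2, h₀,
    Finset.sum_congr rfl (g := fun _ => κ)]
  · rw [Finset.sum_const, Finset.card_erase_of_mem (Finset.mem_univ _), numClasses,
      Nat.card_eq_fintype_card, Finset.card_univ, nsmul_eq_mul, Nat.cast_sub]
    · push_cast; ring
    · exact Fintype.card_pos_iff.2 ⟨Quotient.mk s x₀⟩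
  · intro q hq
    induction q using Quotient.inductionOn with
    | h q =>
    rw [h2, h]
    intro e
    exact (Finset.ne_of_mem_erase hq) (Quotient.sound (s.symm' e))

open Classical in
theorem sum_eq_of_classesIn [Fintype α] (s : Setoid α) (X : Set α)
    (hX : ∀ x y, s x y → (x ∈ X ↔ y ∈ X)) (g : α → ℤ) (x₀ : α) (hx₀ : x₀ ∈ X) (κ θ : ℤ)
    (h₀ : ∑ y with s x₀ y, g y = θ) (h : ∀ x ∈ X, ¬ s x₀ x → ∑ y with s x y, g y = κ) :
    ∑ y with y ∈ X, g y = κ * (numClassesIn s X - 1) + θ := by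
  have h1 : ∀ x : X, ∑ y : X with s.comap Subtype.val x y, g y = ∑ y with s x y, g y := by
    intro x
    refine Finset.sum_bij (fun y _ => (y : α)) ?_ ?_ ?_ ?_
    · intro y hy
      exact Finset.mem_filter.2 ⟨Finset.mem_univ _, (Finset.mem_filter.1 hy).2⟩
    · intro y _ z _ e
      exact Subtype.ext e
    · intro y hy
      have hy : s x y := (Finset.mem_filter.1 hy).2
      exact ⟨⟨y, (hX _ _ hy).1 x.2⟩, Finset.mem_filter.2 ⟨Finset.mem_univ _, hy⟩, rfl⟩
    · intro y _
      rfl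
  have := sum_eq_of_classes (s.comap (Subtype.val : X → α)) (fun y => g y) ⟨x₀, hx₀⟩ κ θ
    (by rw [h1]; exact h₀) (fun x hx => by rw [h1]; exact h x x.2 hx)
  rw [numClassesIn, ← this]
  exact Finset.sum_subtype _ (by simp) _

/-- `euler_le` for the permutations restricted to the invariant set `X`. By `hconn` there is only
one component on `X`, which turns the last term into the constant 4. -/
theorem euler_le_on [Fintype α] [DecidableEq α] (a r : Perm α) (hr : ∀ x, r (r x) = x) (X : Set α)
    (ha : ∀ x, x ∈ X ↔ a x ∈ X) (hrX : ∀ x, x ∈ X ↔ r x ∈ X) (x₀ : α) (hx₀ : x₀ ∈ X)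
    (hconn : ∀ x ∈ X, (SameCycle.setoid a ⊔ SameCycle.setoid r) x₀ x) :
    2 * numClassesIn (SameCycle.setoid a) X + 2 * numClassesIn (SameCycle.setoid (a * r)) X ≤
      {x | x ∈ X ∧ r x ≠ x}.ncard + 4 := by
  have : Fintype X := Fintype.ofFinite X
  set aX : Perm X := a.subtypePerm (p := (· ∈ X)) (fun x => (ha x).symm) with haX
  set rX : Perm X := r.subtypePerm (p := (· ∈ X)) (fun x => (hrX x).symm) with hrX'
  have hco : ∀ (b : Perm α) (hb : ∀ x, b x ∈ X ↔ x ∈ X),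
      SameCycle.setoid (b.subtypePerm (p := (· ∈ X)) hb) = (SameCycle.setoid b).comap Subtype.val := by
    intro b hb
    ext x y
    exact sameCycle_subtypePerm
  have hmulX : ∀ x, (a * r) x ∈ X ↔ x ∈ X := fun x => ((hrX x).trans (ha (r x))).symm
  have hmul : aX * rX = (a * r).subtypePerm (p := (· ∈ X)) hmulX := rfl
  have htop : SameCycle.setoid aX ⊔ SameCycle.setoid rX = ⊤ := by
    set t := SameCycle.setoid aX ⊔ SameCycle.setoid rX with ht
    have key : ∀ x (hx : x ∈ X), t ⟨x₀, hx₀⟩ ⟨x, hx⟩ := by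
      intro x hx
      have hta : ∀ z, t z (aX z) := (setoid_le_iff _ _).1 le_sup_left
      have htr : ∀ z, t z (rX z) := (setoid_le_iff _ _).1 le_sup_right
      -- Being related to `x₀` inside the subtype is an invariant subset of the ambient type, so the
      -- ambient relation `hconn` cannot leave it.
      have := (mem_iff_of_sup (Y := {z | ∃ h : z ∈ X, t ⟨x₀, hx₀⟩ ⟨z, h⟩}) (a := a) (r := r)
        ?_ ?_ (hconn x hx)).1 ⟨hx₀, t.refl' _⟩
      · exact this.2
      · intro z
        constructor
        · rintro ⟨h, h'⟩
          exact ⟨(ha z).1 h, t.trans' h' (hta ⟨z, h⟩)⟩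
        · rintro ⟨h, h'⟩
          exact ⟨(ha z).2 h, t.trans' h' (t.symm' (hta ⟨z, (ha z).2 h⟩))⟩
      · intro z
        constructor
        · rintro ⟨h, h'⟩
          exact ⟨(hrX z).1 h, t.trans' h' (htr ⟨z, h⟩)⟩
        · rintro ⟨h, h'⟩
          exact ⟨(hrX z).2 h, t.trans' h' (t.symm' (htr ⟨z, (hrX z).2 h⟩))⟩
    rw [eq_top_iff]
    rintro ⟨x, hx⟩ ⟨y, hy⟩ -
    exact t.trans' (t.symm' (key x hx)) (key y hy)
  have hone : numClasses (⊤ : Setoid X) ≤ 1 := by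
    have : Subsingleton (Quotient (⊤ : Setoid X)) :=
      ⟨fun p q => Quotient.inductionOn₂ p q fun x y => Quotient.sound trivial⟩
    exact Finite.card_le_one_iff_subsingleton.2 this
  have E := euler_le aX rX (fun x => Subtype.ext (hr x))
  rw [htop, hmul, hco, hco] at E
  have hsupp : rX.support.card = {x | x ∈ X ∧ r x ≠ x}.ncard := by
    rw [← Set.ncard_coe_finset, ← Set.ncard_image_of_injective _ Subtype.val_injective]
    congr 1
    ext x
    constructor
    · rintro ⟨y, hy, rfl⟩
      exact ⟨y.2, fun e => mem_support.1 (Finset.mem_coe.1 hy) (Subtype.ext e)⟩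
    · rintro ⟨h1, h2⟩
      exact ⟨⟨x, h1⟩, Finset.mem_coe.2 (mem_support.2 fun e => h2 (congrArg Subtype.val e)), rfl⟩
  rw [hsupp] at E
  simp only [numClassesIn]
  omega

/-- If a combinatorial map with two components satisfies Euler's formula, so does each component. -/
theorem euler_eq_on [Fintype α] [DecidableEq α] (a r : Perm α) (hr : ∀ x, r (r x) = x) (X : Set α)
    (ha : ∀ x, x ∈ X ↔ a x ∈ X) (hrX : ∀ x, x ∈ X ↔ r x ∈ X) (x₀ x₁ : α) (hx₀ : x₀ ∈ X)
    (hx₁ : x₁ ∉ X) (h₀ : ∀ x ∈ X, (SameCycle.setoid a ⊔ SameCycle.setoid r) x₀ x)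
    (h₁ : ∀ x ∉ X, (SameCycle.setoid a ⊔ SameCycle.setoid r) x₁ x)
    (hE : r.support.card + 8 ≤
      2 * numClasses (SameCycle.setoid a) + 2 * numClasses (SameCycle.setoid (a * r))) :
    2 * numClassesIn (SameCycle.setoid a) X + 2 * numClassesIn (SameCycle.setoid (a * r)) X =
      {x | x ∈ X ∧ r x ≠ x}.ncard + 4 := by
  -- The two inequalities, for `X` and for its complement, add up to the reverse of `hE` because `8
  -- = 4 + 4`. Hence both are equalities.
  have E₀ := euler_le_on a r hr X ha hrX x₀ hx₀ h₀
  have E₁ := euler_le_on a r hr Xᶜ (fun x => not_congr (ha x)) (fun x => not_congr (hrX x))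
    x₁ hx₁ h₁
  have hs : ∀ b : Perm α, (∀ x, x ∈ X ↔ b x ∈ X) → ∀ x y, SameCycle.setoid b x y →
      (x ∈ X ↔ y ∈ X) := by
    intro b hb x y h
    exact mem_iff_of_sup (a := b) (r := b) hb hb
      ((le_sup_left : SameCycle.setoid b ≤ SameCycle.setoid b ⊔ SameCycle.setoid b) h)
  have s₁ := numClassesIn_add_compl (hs a ha)
  have s₂ := numClassesIn_add_compl (hs (a * r) fun x => (hrX x).trans (ha (r x)))
  have hc : r.support.card = {x | x ∈ X ∧ r x ≠ x}.ncard +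
      {x | x ∈ Xᶜ ∧ r x ≠ x}.ncard := by
    rw [← Set.ncard_union_eq, ← Set.ncard_coe_finset]
    · congr 1
      ext x
      simp only [coe_support_eq_set_support, Set.mem_compl_iff, Set.mem_union, Set.mem_ofPred_eq]
      tauto
    · rw [Set.disjoint_left]
      rintro x ⟨hx, -⟩ ⟨hx', -⟩
      exact hx' hx
  omega

/-! ### Sums over orbits -/

theorem sameCycle_iff_iterate [Finite α] (a : Perm α) (x y : α) :
    SameCycle a x y ↔ ∃ n : ℕ, a^[n] x = y := by
  constructor
  · intro h
    obtain ⟨n, hn⟩ := h.exists_nat_pow_eq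
    exact ⟨n, by rwa [Perm.iterate_eq_pow]⟩
  · rintro ⟨n, hn⟩
    exact ⟨n, by rwa [zpow_natCast, ← Perm.iterate_eq_pow]⟩

/-- The orbit of `x`, when `N` is the first positive time of return to `x`. -/
theorem orbit_eq_image {f : α → α} {x : α} {N : ℕ} (hN : 0 < N) (hx : f^[N] x = x)
    (hne : ∀ i, 0 < i → i < N → f^[i] x ≠ x) :
    Set.InjOn (fun i => f^[i] x) (Finset.range N) ∧
      {y | ∃ n : ℕ, f^[n] x = y} = (fun i => f^[i] x) '' (Finset.range N) := by
  constructor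
  · have key : ∀ i j, i < j → j < N → f^[i] x ≠ f^[j] x := by
      intro i j hij hj e
      have : f^[N - j] (f^[i] x) = f^[N - j] (f^[j] x) := by rw [e]
      rw [← Function.iterate_add_apply, ← Function.iterate_add_apply, Nat.sub_add_cancel hj.le,
        hx] at this
      exact hne (N - j + i) (by omega) (by omega) this
    intro i hi j hj e
    simp only [Finset.coe_range, Set.mem_Iio] at hi hj
    rcases lt_trichotomy i j with h | h | h
    · exact absurd e (key i j h hj)
    · exact h
    · exact absurd e.symm (key j i h hi)
  · ext y
    constructor
    · rintro ⟨n, rfl⟩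
      refine ⟨n % N, by simpa using Nat.mod_lt _ hN, ?_⟩
      have h : (fun i => f^[i] x) (n % N) = f^[n] x := by
        conv_rhs => rw [← Nat.mod_add_div n N, Function.iterate_add_apply, Function.iterate_mul]
        rw [Function.iterate_fixed hx]
      exact h
    · rintro ⟨i, -, rfl⟩
      exact ⟨i, rfl⟩

theorem finsum_orbit_eq {f : α → α} {x : α} {N : ℕ} (hN : 0 < N) (hx : f^[N] x = x)
    (hne : ∀ i, 0 < i → i < N → f^[i] x ≠ x) {M : Type*} [AddCommMonoid M] (g : α → M) :
    ∑ᶠ y ∈ {y | ∃ n : ℕ, f^[n] x = y}, g y = ∑ i ∈ Finset.range N, g (f^[i] x) := by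
  obtain ⟨h1, h2⟩ := orbit_eq_image hN hx hne
  rw [h2, finsum_mem_image h1, finsum_mem_coe_finset]

open Classical in
theorem sum_sameCycle_eq [Fintype α] {a : Perm α} {x : α} {N : ℕ} (hN : 0 < N)
    (hx : a^[N] x = x) (hne : ∀ i, 0 < i → i < N → a^[i] x ≠ x) (g : α → ℤ) :
    ∑ y with SameCycle.setoid a x y, g y = ∑ i ∈ Finset.range N, g (a^[i] x) := by
  rw [← finsum_orbit_eq hN hx hne, ← finsum_mem_coe_finset]
  refine finsum_mem_congr ?_ fun _ _ => rfl
  ext y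
  rw [Finset.mem_coe, Finset.mem_filter]
  exact ⟨fun h => (sameCycle_iff_iterate a x y).1 h.2,
    fun h => ⟨Finset.mem_univ _, (sameCycle_iff_iterate a x y).2 h⟩⟩

end Permutations

end SPOrtho

namespace SPOrtho

/-! ### Walks and separation in graphs -/

section Graphs

variable {V E : Type*} {G : Graph V E}

@[simp] theorem Dart.rev_rev (d : Dart G) : d.rev.rev = d := rfl
@[simp] theorem Dart.rev_fst (d : Dart G) : d.rev.fst = d.snd := rfl
@[simp] theorem Dart.rev_snd (d : Dart G) : d.rev.snd = d.fst := rfl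

theorem Dart.eq_or_eq_rev {d d' : Dart G} (h : d.edge = d'.edge) : d = d' ∨ d = d'.rev := by
  have h1 := d.isLink
  rw [h] at h1
  rcases h1.eq_and_eq_or_eq_and_eq d'.isLink with ⟨h2, h3⟩ | ⟨h2, h3⟩
  · exact Or.inl (Dart.ext h h2 h3)
  · exact Or.inr (Dart.ext h h2 h3)

theorem Dart.fst_mem (d : Dart G) : d.fst ∈ G.vertexSet := d.isLink.left_mem

theorem IsWalk.fst_mem {u v : V} {p : List (Dart G)} (h : IsWalk u p v) {d : Dart G}
    (hd : d ∈ p) : d.fst ∈ u :: p.map Dart.snd := by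
  induction p generalizing u with
  | nil => simp at hd
  | cons a p ih =>
    rcases List.mem_cons.1 hd with rfl | hd
    · simp [h.1]
    · exact List.mem_cons_of_mem _ (ih h.2 hd)

theorem IsWalk.target_mem {u v : V} {p : List (Dart G)} (h : IsWalk u p v) :
    v ∈ u :: p.map Dart.snd := by
  induction p generalizing u with
  | nil => rw [show u = v from h]; simp
  | cons a p ih => exact List.mem_cons_of_mem _ (ih h.2)

theorem IsWalk.append {u v w : V} {p q : List (Dart G)} (hp : IsWalk u p v) (hq : IsWalk v q w) :
    IsWalk u (p ++ q) w := by
  induction p generalizing u with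
  | nil => rw [show u = v from hp]; exact hq
  | cons a p ih => exact ⟨hp.1, ih hp.2⟩

theorem IsPath.tail {u v : V} {d : Dart G} {p : List (Dart G)} (h : IsPath u (d :: p) v) :
    IsPath d.snd p v := ⟨h.1.2, (List.nodup_cons.1 h.2).2⟩

theorem IsPath.fst_ne_snd {u v : V} {p : List (Dart G)} (h : IsPath u p v) {d : Dart G}
    (hd : d ∈ p) : d.fst ≠ d.snd := by
  induction p generalizing u with
  | nil => simp at hd
  | cons a p ih =>
    rcases List.mem_cons.1 hd with rfl | hd
    · intro e
      have := (List.nodup_cons.1 h.2).1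
      rw [← h.1.1, e] at this
      simp at this
    · exact ih h.tail hd

theorem IsPath.source_ne_of_mem_tail {u v : V} {a : Dart G} {p : List (Dart G)}
    (h : IsPath u (a :: p) v) {d : Dart G} (hd : d ∈ p) : d.fst ≠ u ∧ d.snd ≠ u := by
  have h1 := (List.nodup_cons.1 h.2).1
  have h2 := h.1.2.fst_mem hd
  refine ⟨fun e => h1 (e ▸ h2), fun e => h1 (e ▸ ?_)⟩
  exact List.mem_cons_of_mem _ (List.mem_map_of_mem hd)

/-- A vertex of a simple path starts a final segment of the path. -/
theorem IsPath.exists_suffix {x y z : V} {p : List (Dart G)} (h : IsPath x p y)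
    (hz : z ∈ x :: p.map Dart.snd) : ∃ q, IsPath z q y ∧ ∀ d ∈ q, d ∈ p := by
  induction p generalizing x with
  | nil =>
    obtain rfl : z = x := by simpa using hz
    exact ⟨[], h, fun d hd => hd⟩
  | cons a p ih =>
    rcases List.mem_cons.1 hz with rfl | hz
    · exact ⟨_, h, fun d hd => hd⟩
    · obtain ⟨q, hq, hqp⟩ := ih h.tail (by simpa using hz)
      exact ⟨q, hq, fun d hd => List.mem_cons_of_mem _ (hqp d hd)⟩

/-- `y` can be reached from `x` along darts of `X`, through vertices not in `A`. -/
def Reach (X : Set (Dart G)) (A : Set V) : V → V → Prop :=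
  Relation.ReflTransGen fun x y => ∃ d ∈ X, d.fst = x ∧ d.snd = y ∧ x ∉ A ∧ y ∉ A

theorem Reach.symm {X : Set (Dart G)} {A : Set V} (hX : ∀ d ∈ X, d.rev ∈ X) {x y : V}
    (h : Reach X A x y) : Reach X A y x := by
  induction h with
  | refl => exact .refl
  | tail _ h ih =>
    obtain ⟨d, hd, h1, h2, h3, h4⟩ := h
    exact .head ⟨d.rev, hX d hd, h2, h1, h4, h3⟩ ih

theorem Reach.exists_path {X : Set (Dart G)} {A : Set V} {x y : V} (h : Reach X A x y) :
    ∃ p, IsPath x p y ∧ ∀ d ∈ p, d ∈ X ∧ d.fst ∉ A ∧ d.snd ∉ A := by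
  induction h using Relation.ReflTransGen.head_induction_on with
  | refl => exact ⟨[], ⟨rfl, by simp⟩, by simp⟩
  | @head a b h _ ih =>
    obtain ⟨d, hd, rfl, rfl, h3, h4⟩ := h
    obtain ⟨p, hp, hpX⟩ := ih
    by_cases hm : d.fst ∈ d.snd :: p.map Dart.snd
    · obtain ⟨q, hq, hqp⟩ := hp.exists_suffix hm
      exact ⟨q, hq, fun d hd => hpX d (hqp d hd)⟩
    · refine ⟨d :: p, ⟨⟨rfl, hp.1⟩, List.nodup_cons.2 ⟨hm, hp.2⟩⟩, ?_⟩
      rintro d' hd'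
      rcases List.mem_cons.1 hd' with rfl | hd'
      · exact ⟨hd, h3, h4⟩
      · exact hpX d' hd'

theorem Reach.exists_dart {X : Set (Dart G)} {A : Set V} (hX : ∀ d ∈ X, d.rev ∈ X) {x y : V}
    (h : Reach X A x y) (hx : ∃ d ∈ X, d.fst = x) : ∃ d ∈ X, d.fst = y := by
  induction h with
  | refl => exact hx
  | tail _ h _ =>
    obtain ⟨d, hd, h1, h2, -⟩ := h
    exact ⟨d.rev, hX d hd, h2⟩

/-- The darts of `X` are connected in `X` through vertices not in `A`. -/
def ConnAvoid (X : Set (Dart G)) (A : Set V) : Prop :=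
  ∀ d ∈ X, ∀ d' ∈ X, Relation.EqvGen
    (fun d d' => d ∈ X ∧ d' ∈ X ∧ (d' = d.rev ∨ (d.fst = d'.fst ∧ d.fst ∉ A))) d d'

/-- The vertex `w` serves as a hub: each dart has an end outside `A` from which `w` is reached, so
it is linked to a dart leaving `w`, and the darts leaving `w` are linked to one another. -/
theorem connAvoid_of_reach {X : Set (Dart G)} {A : Set V} (hX : ∀ d ∈ X, d.rev ∈ X) {w : V}
    (hw : w ∉ A)
    (h : ∀ d ∈ X, ∃ x, (d.fst = x ∨ d.snd = x) ∧ x ∉ A ∧ Reach X A x w) : ConnAvoid X A := by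
  set R : Dart G → Dart G → Prop :=
    fun d d' => d ∈ X ∧ d' ∈ X ∧ (d' = d.rev ∨ (d.fst = d'.fst ∧ d.fst ∉ A)) with hR
  have key : ∀ x, Reach X A x w → ∀ d ∈ X, d.fst = x → x ∉ A →
      ∃ d' ∈ X, d'.fst = w ∧ Relation.EqvGen R d d' := by
    intro x hx
    induction hx using Relation.ReflTransGen.head_induction_on with
    | refl => exact fun d hd h1 _ => ⟨d, hd, h1, .refl _⟩
    | head hs _ ih =>
      obtain ⟨d₁, hd₁, rfl, rfl, h3, h4⟩ := hs
      intro d hd h1 _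
      obtain ⟨d', hd', h5, h6⟩ := ih d₁.rev (hX _ hd₁) rfl h4
      refine ⟨d', hd', h5, .trans _ _ _ (.rel _ d₁ ⟨hd, hd₁, Or.inr ⟨h1, h1 ▸ h3⟩⟩)
        (.trans _ _ _ (.rel _ d₁.rev ⟨hd₁, hX _ hd₁, Or.inl rfl⟩) h6)⟩
  have key2 : ∀ d ∈ X, ∃ d' ∈ X, d'.fst = w ∧ Relation.EqvGen R d d' := by
    intro d hd
    obtain ⟨x, h1 | h1, h2, h3⟩ := h d hd
    · exact key x h3 d hd h1 h2
    · obtain ⟨d', hd', h4, h5⟩ := key x h3 d.rev (hX d hd) h1 h2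
      exact ⟨d', hd', h4, .trans _ _ _ (.rel _ d.rev ⟨hd, hX d hd, Or.inl rfl⟩) h5⟩
  intro d hd d' hd'
  obtain ⟨a, ha, h1, h2⟩ := key2 d hd
  obtain ⟨b, hb, h3, h4⟩ := key2 d' hd'
  exact .trans _ _ _ h2 (.trans _ _ _
    (.rel _ _ ⟨ha, hb, Or.inr ⟨h1.trans h3.symm, h1 ▸ hw⟩⟩) (.symm _ _ h4))

/-- In a biconnected graph, a set of darts attached to the rest at `z` and `w` only is connected
to `w` after the deletion of `z`. -/
theorem reach_of_biconnected (hbi : Biconnected G) {Y : Set (Dart G)} (hY : ∀ d ∈ Y, d.rev ∈ Y)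
    {z w : V} (hzw : w ≠ z) (hz : z ∈ G.vertexSet) (hw : w ∈ G.vertexSet)
    (hs : ∀ d ∈ Y, ∀ d' ∉ Y, d.fst = d'.fst → d.fst = z ∨ d.fst = w) {d : Dart G} (hd : d ∈ Y)
    (hdz : d.fst ≠ z) : Reach Y {z} d.fst w := by
  obtain ⟨p, hp, hpz⟩ := hbi.2 z hz d.fst d.fst_mem w hw hdz hzw
  -- A walk to `w` that avoids `z` can leave `Y` only at `z` or at `w`. So it stays in `Y` until it
  -- first meets `w`, where it may be stopped.
  have key : ∀ (p : List (Dart G)) (x : V), IsWalk x p w → (∀ d ∈ p, d.fst ≠ z ∧ d.snd ≠ z) →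
      (∃ d ∈ Y, d.fst = x) → Reach Y {z} x w := by
    intro p
    induction p with
    | nil => intro x h _ _; rw [show x = w from h]; exact .refl
    | cons a p ih =>
      rintro x ⟨h1, h2⟩ h3 ⟨d, hd, rfl⟩
      by_cases hx : d.fst = w
      · rw [hx]; exact .refl
      have ha := h3 a (by simp)
      have haY : a ∈ Y := by
        by_contra haY
        rcases hs d hd a haY h1.symm with e | e
        · exact ha.1 (h1.trans e)
        · exact hx e
      exact .head ⟨a, haY, h1, rfl, by rw [← h1]; exact ha.1, ha.2⟩
        (ih a.snd h2 (fun d hd => h3 d (by simp [hd])) ⟨a.rev, hY a haY, rfl⟩)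
  exact key p d.fst hp hpz ⟨d, hd, rfl⟩

theorem Reach.mono {X Y : Set (Dart G)} {A B : Set V} (hXY : X ⊆ Y)
    (hAB : ∀ d ∈ X, d.fst ∉ A → d.fst ∉ B) (hX : ∀ d ∈ X, d.rev ∈ X) {x y : V}
    (h : Reach X A x y) : Reach Y B x y := by
  induction h with
  | refl => exact .refl
  | tail _ h ih =>
    obtain ⟨d, hd, rfl, rfl, h3, h4⟩ := h
    exact ih.tail ⟨d, hXY hd, rfl, rfl, hAB d hd h3, hAB d.rev (hX d hd) h4⟩

/-- Two sets of darts composed in series at `w`, with outer poles `a₁` and `a₂`. -/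
theorem connAvoid_of_series (hbi : Biconnected G) (hl : ∀ d : Dart G, d.fst ≠ d.snd)
    {Y₁ Y₂ : Set (Dart G)} (h₁ : ∀ d ∈ Y₁, d.rev ∈ Y₁) (h₂ : ∀ d ∈ Y₂, d.rev ∈ Y₂) {a₁ a₂ w : V}
    (hw₁ : w ≠ a₁) (hw₂ : w ≠ a₂) (hw : w ∈ G.vertexSet) (ha₁ : a₁ ∈ G.vertexSet)
    (ha₂ : a₂ ∈ G.vertexSet)
    (hs₁ : ∀ d ∈ Y₁, ∀ d' ∉ Y₁, d.fst = d'.fst → d.fst = a₁ ∨ d.fst = w)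
    (hs₂ : ∀ d ∈ Y₂, ∀ d' ∉ Y₂, d.fst = d'.fst → d.fst = a₂ ∨ d.fst = w)
    (hn₁ : ∀ d ∈ Y₁, d.fst ≠ a₂) (hn₂ : ∀ d ∈ Y₂, d.fst ≠ a₁) :
    ConnAvoid (Y₁ ∪ Y₂) {a₁, a₂} := by
  refine connAvoid_of_reach (w := w) ?_ ?_ ?_
  · rintro d (hd | hd)
    · exact Or.inl (h₁ d hd)
    · exact Or.inr (h₂ d hd)
  · simp [hw₁, hw₂]
  -- The junction `w` is the hub. Biconnectivity gives a connection inside `Y₁` that avoids `a₁`,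
  -- and the other outer pole `a₂` does not occur in `Y₁` at all.
  have k₁ : ∀ d ∈ Y₁, d.fst ≠ a₁ → d.fst ∉ ({a₁, a₂} : Set V) ∧
      Reach (Y₁ ∪ Y₂) {a₁, a₂} d.fst w := by
    intro d hd hda
    refine ⟨by simp [hda, hn₁ d hd], (reach_of_biconnected hbi h₁ hw₁ ha₁ hw hs₁ hd hda).mono
      Set.subset_union_left ?_ h₁⟩
    intro d hd h
    simp only [Set.mem_singleton_iff] at h
    simp [h, hn₁ d hd]
  have k₂ : ∀ d ∈ Y₂, d.fst ≠ a₂ → d.fst ∉ ({a₁, a₂} : Set V) ∧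
      Reach (Y₁ ∪ Y₂) {a₁, a₂} d.fst w := by
    intro d hd hda
    refine ⟨by simp [hda, hn₂ d hd], (reach_of_biconnected hbi h₂ hw₂ ha₂ hw hs₂ hd hda).mono
      Set.subset_union_right ?_ h₂⟩
    intro d hd h
    simp only [Set.mem_singleton_iff] at h
    simp [h, hn₂ d hd]
  rintro d (hd | hd)
  · by_cases hda : d.fst = a₁
    · exact ⟨d.snd, Or.inr rfl, k₁ d.rev (h₁ d hd) fun e => hl d (hda.trans e.symm)⟩
    · exact ⟨d.fst, Or.inl rfl, k₁ d hd hda⟩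
  · by_cases hda : d.fst = a₂
    · exact ⟨d.snd, Or.inr rfl, k₂ d.rev (h₂ d hd) fun e => hl d (hda.trans e.symm)⟩
    · exact ⟨d.fst, Or.inl rfl, k₂ d hd hda⟩

theorem connAvoid_pair (d : Dart G) (A : Set V) {X : Set (Dart G)}
    (hX : ∀ x, x ∈ X ↔ x = d ∨ x = d.rev) : ConnAvoid X A := by
  have h1 : d ∈ X := (hX d).2 (Or.inl rfl)
  have h2 : d.rev ∈ X := (hX _).2 (Or.inr rfl)
  intro x hx y hy
  rcases (hX x).1 hx with rfl | rfl <;> rcases (hX y).1 hy with rfl | rfl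
  · exact .refl _
  · exact .rel _ _ ⟨h1, h2, Or.inl rfl⟩
  · exact .symm _ _ (.rel _ _ ⟨h1, h2, Or.inl rfl⟩)
  · exact .refl _

/-- The darts of `X` form a component with poles `u` and `v`. -/
structure Sep (X : Set (Dart G)) (u v : V) : Prop where
  rev_mem : ∀ d ∈ X, d.rev ∈ X
  ne : u ≠ v
  mixed : ∀ d ∈ X, ∀ d' ∉ X, d.fst = d'.fst → d.fst = u ∨ d.fst = v
  left_in : ∃ d ∈ X, d.fst = u
  left_out : ∃ d ∉ X, d.fst = u
  right_in : ∃ d ∈ X, d.fst = v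
  right_out : ∃ d ∉ X, d.fst = v
  conn : ConnAvoid X {u, v} ∨ ConnAvoid Xᶜ {u, v}

theorem rev_mem_compl {X : Set (Dart G)} (hX : ∀ d ∈ X, d.rev ∈ X) : ∀ d ∈ Xᶜ, d.rev ∈ Xᶜ :=
  fun d hd h => hd (hX d.rev h)

theorem Sep.compl {X : Set (Dart G)} {u v : V} (h : Sep X u v) : Sep Xᶜ u v where
  rev_mem := rev_mem_compl h.rev_mem
  ne := h.ne
  mixed d hd d' hd' e := by
    have := h.mixed d' (not_not.1 hd') d hd e.symm
    rwa [← e] at this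
  left_in := h.left_out
  left_out := by obtain ⟨d, h1, h2⟩ := h.left_in; exact ⟨d, not_not.2 h1, h2⟩
  right_in := h.right_out
  right_out := by obtain ⟨d, h1, h2⟩ := h.right_in; exact ⟨d, not_not.2 h1, h2⟩
  conn := by rw [compl_compl]; exact h.conn.symm

theorem Sep.swap {X : Set (Dart G)} {u v : V} (h : Sep X u v) : Sep X v u where
  rev_mem := h.rev_mem
  ne := h.ne.symm
  mixed d hd d' hd' e := (h.mixed d hd d' hd' e).symm
  left_in := h.right_in
  left_out := h.right_out
  right_in := h.left_in
  right_out := h.left_out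
  conn := by rw [Set.pair_comm]; exact h.conn

theorem Sep.rev_mem_iff {X : Set (Dart G)} {u v : V} (h : Sep X u v) (d : Dart G) :
    d.rev ∈ X ↔ d ∈ X := ⟨fun hd => h.rev_mem _ hd, h.rev_mem d⟩

/-- That both poles also carry darts outside `X` need not be assumed: delete one pole, start at an
outside dart whose origin is another vertex, and biconnectivity leads to the other pole along
outside darts. -/
theorem sep_of_mixed (hbi : Biconnected G) (hl : ∀ d : Dart G, d.fst ≠ d.snd) {X : Set (Dart G)}
    {u v : V} (hX : ∀ d ∈ X, d.rev ∈ X) (huv : u ≠ v)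
    (hm : ∀ d ∈ X, ∀ d' ∉ X, d.fst = d'.fst → d.fst = u ∨ d.fst = v)
    (hu : ∃ d ∈ X, d.fst = u) (hv : ∃ d ∈ X, d.fst = v) (ho : ∃ d, d ∉ X)
    (hc : ConnAvoid X {u, v} ∨ ConnAvoid Xᶜ {u, v}) : Sep X u v := by
  obtain ⟨d₀, hd₀⟩ := ho
  have hXc := rev_mem_compl hX
  have hmc : ∀ d ∈ Xᶜ, ∀ d' ∉ Xᶜ, d.fst = d'.fst → d.fst = u ∨ d.fst = v := by
    intro d hd d' hd' e
    have := hm d' (not_not.1 hd') d hd e.symm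
    rwa [← e] at this
  have huV : u ∈ G.vertexSet := by obtain ⟨d, -, rfl⟩ := hu; exact d.fst_mem
  have hvV : v ∈ G.vertexSet := by obtain ⟨d, -, rfl⟩ := hv; exact d.fst_mem
  have hor : ∀ z, ∃ d ∈ Xᶜ, d.fst ≠ z := by
    intro z
    by_cases h : d₀.fst = z
    · exact ⟨d₀.rev, hXc _ hd₀, fun e => hl d₀ (h.trans e.symm)⟩
    · exact ⟨d₀, hd₀, h⟩
  refine ⟨hX, huv, hm, hu, ?_, hv, ?_, hc⟩
  · obtain ⟨d, hd, hdv⟩ := hor v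
    exact (reach_of_biconnected hbi hXc huv hvV huV
      (fun d hd d' hd' e => (hmc d hd d' hd' e).symm) hd hdv).exists_dart hXc ⟨d, hd, rfl⟩
  · obtain ⟨d, hd, hdu⟩ := hor u
    exact (reach_of_biconnected hbi hXc huv.symm huV hvV hmc hd hdu).exists_dart hXc ⟨d, hd, rfl⟩

end Graphs

end SPOrtho

namespace SPOrtho

/-! ### Nodes of SPQ*-trees -/

namespace SPQTree

variable {V E : Type*} {G : Graph V E}

theorem mem_vertexSet_iff {ν : SPQTree G} {x : V} :
    x ∈ ν.vertexSet ↔ ∃ d ∈ ν.darts, d.fst = x := by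
  constructor
  · rintro ⟨e, he, y, hy⟩
    exact ⟨⟨e, x, y, hy⟩, he, rfl⟩
  · rintro ⟨d, hd, rfl⟩
    exact ⟨d.edge, hd, d.snd, d.isLink⟩

theorem rev_mem_darts (ν : SPQTree G) : ∀ d ∈ ν.darts, d.rev ∈ ν.darts := fun _ hd => hd

theorem mem_darts_chain {s t : V} {p : List (Dart G)} {d : Dart G} :
    d ∈ (chain s t p).darts ↔ d ∈ p ∨ d.rev ∈ p := by
  constructor
  · rintro ⟨d', hd', e⟩
    rcases Dart.eq_or_eq_rev e with rfl | rfl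
    · exact Or.inl hd'
    · exact Or.inr hd'
  · rintro (h | h)
    · exact ⟨d, h, rfl⟩
    · exact ⟨d.rev, h, rfl⟩

theorem mem_darts_series {s t : V} {k : ℕ} {c : Fin k → SPQTree G} {d : Dart G} :
    d ∈ (series s t k c).darts ↔ ∃ i, d ∈ (c i).darts := Set.mem_iUnion

theorem mem_darts_parallel {s t : V} {k : ℕ} {c : Fin k → SPQTree G} {d : Dart G} :
    d ∈ (parallel s t k c).darts ↔ ∃ i, d ∈ (c i).darts := Set.mem_iUnion

theorem source_sink_of_isReduced {ν : SPQTree G} (h : ν.IsReduced) :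
    ν.source ≠ ν.sink ∧ ν.source ∈ ν.vertexSet ∧ ν.sink ∈ ν.vertexSet := by
  induction ν with
  | chain s t p =>
    obtain ⟨hp, hw⟩ := h
    obtain ⟨d, q, rfl⟩ := List.exists_cons_of_ne_nil hp
    have ht : t ∈ (d :: q).map Dart.snd := hw.1.2.target_mem
    have hst : s ≠ t := by
      rintro rfl
      exact (List.nodup_cons.1 hw.2).1 ht
    refine ⟨hst, ?_, ?_⟩
    · exact mem_vertexSet_iff.2 ⟨d, mem_darts_chain.2 (Or.inl (by simp)), hw.1.1⟩
    · obtain ⟨d', hd', e⟩ := List.mem_map.1 ht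
      exact mem_vertexSet_iff.2 ⟨d'.rev, mem_darts_chain.2 (Or.inr hd'), e⟩
  | series s t k c ih =>
    obtain ⟨⟨hk, h0, h1, h2, -, h3, h4⟩, hc, -⟩ := h
    have a0 := ih ⟨0, by omega⟩ (hc _)
    have a1 := ih ⟨k - 1, by omega⟩ (hc _)
    rw [h0 _ rfl] at a0
    rw [h1 _ (by simp; omega)] at a1
    have sub : ∀ i x, x ∈ (c i).vertexSet → x ∈ (series s t k c).vertexSet := by
      intro i x hx
      obtain ⟨d, hd, e⟩ := mem_vertexSet_iff.1 hx
      exact mem_vertexSet_iff.2 ⟨d, mem_darts_series.2 ⟨i, hd⟩, e⟩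
    refine ⟨?_, sub _ _ a0.2.1, sub _ _ a1.2.2⟩
    rintro (rfl : s = t)
    -- If the poles coincided, the first and last child would share this vertex. With three or more
    -- children they are disjoint. With two they share only the junction, so the first child would
    -- have equal source and sink.
    rcases Nat.lt_or_ge 2 k with hk2 | hk2
    · exact Set.disjoint_left.1 (h4 ⟨0, by omega⟩ ⟨k - 1, by omega⟩ (by simp; omega))
        a0.2.1 a1.2.2
    · have := h3 ⟨0, by omega⟩ ⟨k - 1, by omega⟩ (by simp; omega)
      have h5 := this.le ⟨a0.2.1, a1.2.2⟩
      exact a0.1 h5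
  | parallel s t k c ih =>
    obtain ⟨⟨hk, h0, -⟩, hc, -⟩ := h
    have a0 := ih ⟨0, by omega⟩ (hc _)
    rw [(h0 _).1, (h0 _).2] at a0
    have sub : ∀ i x, x ∈ (c i).vertexSet → x ∈ (parallel s t k c).vertexSet := by
      intro i x hx
      obtain ⟨d, hd, e⟩ := mem_vertexSet_iff.1 hx
      exact mem_vertexSet_iff.2 ⟨d, mem_darts_parallel.2 ⟨i, hd⟩, e⟩
    exact ⟨a0.1, sub _ _ a0.2.1, sub _ _ a0.2.2⟩

theorem IsReduced.source_ne_sink {ν : SPQTree G} (h : ν.IsReduced) : ν.source ≠ ν.sink :=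
  (source_sink_of_isReduced h).1

theorem IsReduced.source_mem {ν : SPQTree G} (h : ν.IsReduced) : ν.source ∈ ν.vertexSet :=
  (source_sink_of_isReduced h).2.1

theorem IsReduced.sink_mem {ν : SPQTree G} (h : ν.IsReduced) : ν.sink ∈ ν.vertexSet :=
  (source_sink_of_isReduced h).2.2

theorem IsReduced.fst_ne_snd {ν : SPQTree G} (h : ν.IsReduced) {d : Dart G} (hd : d ∈ ν.darts) :
    d.fst ≠ d.snd := by
  induction ν with
  | chain s t p =>
    rcases mem_darts_chain.1 hd with hd | hd
    · exact h.2.fst_ne_snd hd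
    · exact (h.2.fst_ne_snd hd).symm
  | series s t k c ih =>
    obtain ⟨i, hi⟩ := mem_darts_series.1 hd
    exact ih i (h.2.1 i) hi
  | parallel s t k c ih =>
    obtain ⟨i, hi⟩ := mem_darts_parallel.1 hd
    exact ih i (h.2.1 i) hi

theorem finite_darts (ν : SPQTree G) : ν.darts.Finite := by
  induction ν with
  | chain s t p =>
    refine (p.finite_toSet.union (p.finite_toSet.image Dart.rev)).subset ?_
    intro d hd
    rcases mem_darts_chain.1 hd with h | h
    · exact Or.inl h
    · exact Or.inr ⟨d.rev, h, rfl⟩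
  | series s t k c ih =>
    refine (Set.finite_iUnion ih).subset ?_
    intro d hd
    exact Set.mem_iUnion.2 (mem_darts_series.1 hd)
  | parallel s t k c ih =>
    refine (Set.finite_iUnion ih).subset ?_
    intro d hd
    exact Set.mem_iUnion.2 (mem_darts_parallel.1 hd)

/-- The pertinent graph of `ν` is attached to the rest of the graph at its poles only. -/
def Attached (ν : SPQTree G) : Prop :=
  ∀ d ∈ ν.darts, ∀ d' ∉ ν.darts, d.fst = d'.fst → d.fst = ν.source ∨ d.fst = ν.sink

theorem disjoint_darts {ν μ : SPQTree G} (h : Disjoint ν.edgeSet μ.edgeSet) {d : Dart G}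
    (h1 : d ∈ ν.darts) (h2 : d ∈ μ.darts) : False := Set.disjoint_left.1 h h1 h2

/-! ### Children of a series composition -/

section Series

variable {s t : V} {k : ℕ} {c : Fin k → SPQTree G} (hS : SeriesComposition s t c)
  (hc : ∀ i, (c i).IsReduced) (hμ : (series s t k c).Attached)
include hS

theorem SeriesComposition.mem_inter {i l : Fin k} (hil : i ≠ l) {x : V}
    (h1 : x ∈ (c i).vertexSet) (h2 : x ∈ (c l).vertexSet) :
    (x = (c i).sink ∧ x = (c l).source ∧ (i : ℕ) + 1 = l) ∨
      (x = (c i).source ∧ x = (c l).sink ∧ (l : ℕ) + 1 = i) := by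
  obtain ⟨hk, h0, ht, hj, -, h3, h4⟩ := hS
  rcases Nat.lt_trichotomy i l with h | h | h
  · rcases Nat.lt_or_ge (i + 1) l with h' | h'
    · exact absurd h2 (Set.disjoint_left.1 (h4 i l h') h1)
    · have e : (i : ℕ) + 1 = l := by omega
      have : x = (c i).sink := (h3 i l e).le ⟨h1, h2⟩
      exact Or.inl ⟨this, this.trans (hj i l e), e⟩
  · exact absurd (Fin.ext h) hil
  · rcases Nat.lt_or_ge (l + 1) i with h' | h'
    · exact absurd h1 (Set.disjoint_left.1 (h4 l i h') h2)
    · have e : (l : ℕ) + 1 = i := by omega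
      have : x = (c l).sink := (h3 l i e).le ⟨h2, h1⟩
      exact Or.inr ⟨this.trans (hj l i e), this, e⟩

include hc

theorem SeriesComposition.source_mem_iff {i : Fin k} (h : s ∈ (c i).vertexSet) :
    (i : ℕ) = 0 := by
  have hk := hS.1
  by_contra hi
  have h0 := hS.2.1 ⟨0, by omega⟩ rfl
  have hm := (hc ⟨0, by omega⟩).source_mem
  have hne := (hc ⟨0, by omega⟩).source_ne_sink
  rw [h0] at hm hne
  rcases hS.mem_inter (i := ⟨0, by omega⟩) (l := i) (fun e => hi (by rw [← e])) hm h with e | e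
  · exact hne e.1
  · simp at e

theorem SeriesComposition.sink_mem_iff {i : Fin k} (h : t ∈ (c i).vertexSet) :
    (i : ℕ) + 1 = k := by
  have hk := hS.1
  by_contra hi
  have h0 := hS.2.2.1 ⟨k - 1, by omega⟩ (by simp; omega)
  have hm := (hc ⟨k - 1, by omega⟩).sink_mem
  have hne := (hc ⟨k - 1, by omega⟩).source_ne_sink
  rw [h0] at hm hne
  rcases hS.mem_inter (i := ⟨k - 1, by omega⟩) (l := i)
    (fun e => hi (by rw [← e]; simp; omega)) hm h with e | e
  · have := e.2.2; simp at this; omega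
  · exact hne e.1.symm

include hμ

theorem SeriesComposition.attached (i : Fin k) : (c i).Attached := by
  intro d hd d' hd' e
  have hx : d.fst ∈ (c i).vertexSet := mem_vertexSet_iff.2 ⟨d, hd, rfl⟩
  by_cases h : d' ∈ (series s t k c).darts
  · obtain ⟨l, hl⟩ := mem_darts_series.1 h
    have hil : i ≠ l := fun e => hd' (e ▸ hl)
    rcases hS.mem_inter hil hx (mem_vertexSet_iff.2 ⟨d', hl, e.symm⟩) with h | h
    · exact Or.inr h.1
    · exact Or.inl h.1
  · rcases hμ d (mem_darts_series.2 ⟨i, hd⟩) d' h e with (h | h)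
    · have h : d.fst = s := h
      rw [h] at hx ⊢
      exact Or.inl (hS.2.1 i (hS.source_mem_iff hc hx)).symm
    · have h : d.fst = t := h
      rw [h] at hx ⊢
      exact Or.inr (hS.2.2.1 i (hS.sink_mem_iff hc hx)).symm

/-- An inner junction carries no further edges: a third child does not contain it, and an edge
outside the whole series could only be attached at `s` or `t`, which are not junctions. -/
theorem SeriesComposition.junction {i j : Fin k} (hij : (i : ℕ) + 1 = j) {d : Dart G}
    (hd : d.fst = (c i).sink) : d ∈ (c i).darts ∨ d ∈ (c j).darts := by
  have hxi := (hc i).sink_mem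
  have hxj := (hc j).source_mem
  rw [← hS.2.2.2.1 i j hij] at hxj
  have hne : i ≠ j := fun e => by rw [e] at hij; omega
  by_contra hcon
  push Not at hcon
  by_cases h : d ∈ (series s t k c).darts
  · obtain ⟨l, hl⟩ := mem_darts_series.1 h
    have hil : i ≠ l := fun e => hcon.1 (e ▸ hl)
    have hjl : j ≠ l := fun e => hcon.2 (e ▸ hl)
    have hxl : (c i).sink ∈ (c l).vertexSet := mem_vertexSet_iff.2 ⟨d, hl, hd⟩
    rcases hS.mem_inter hil hxi hxl with h | h
    · exact hjl (Fin.ext (by omega))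
    · exact (hc i).source_ne_sink h.1.symm
  · obtain ⟨d₀, h₀, e₀⟩ := mem_vertexSet_iff.1 hxi
    rcases hμ d₀ (mem_darts_series.2 ⟨i, h₀⟩) d h (e₀.trans hd.symm) with h | h
    · have h : d₀.fst = s := h
      rw [← e₀, h] at hxj
      have := hS.source_mem_iff hc hxj
      omega
    · have h : d₀.fst = t := h
      rw [← e₀, h] at hxi
      have := hS.sink_mem_iff hc hxi
      have := j.2
      omega

end Series

/-- The complement of a child is itself a series composition: an adjacent sibling `j`, followed at
its far pole `w` by everything else. The near pole `x` of the sibling touches only these two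
children, so `w` links the complement and the poles `x` and `a` of child `i` are its outer poles. -/
theorem connAvoid_series_child (hbi : Biconnected G) (hl : ∀ d : Dart G, d.fst ≠ d.snd)
    {s t : V} {k : ℕ} {c : Fin k → SPQTree G}
    (hS : SeriesComposition s t c) (hc : ∀ i, (c i).IsReduced)
    (hμ : (series s t k c).Attached) (i : Fin k) :
    ConnAvoid (c i).dartsᶜ {(c i).source, (c i).sink} := by
  have key : ∀ (j : Fin k) (x a w : V), i ≠ j →
      (∀ d : Dart G, d.fst = x → d ∈ (c i).darts ∨ d ∈ (c j).darts) →
      (∀ d ∈ (c i).darts, ∀ d' ∉ (c i).darts, d.fst = d'.fst → d.fst = x ∨ d.fst = a) →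
      (∀ d ∈ (c j).darts, ∀ d' ∉ (c j).darts, d.fst = d'.fst → d.fst = x ∨ d.fst = w) →
      a ∉ (c j).vertexSet → x ∈ (c j).vertexSet → a ∈ (c i).vertexSet → w ∈ (c j).vertexSet →
      w ≠ x → ConnAvoid (c i).dartsᶜ {x, a} := by
    intro j x a w hij hx hsi hsj haj hxj hai hwj hwx
    have hdis : ∀ d, d ∈ (c i).darts → d ∈ (c j).darts → False := fun d h1 h2 =>
      disjoint_darts (hS.2.2.2.2.1 i j hij) h1 h2
    have hU : (c i).dartsᶜ = (c j).darts ∪ ((c i).darts ∪ (c j).darts)ᶜ := by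
      ext d
      simp only [Set.mem_compl_iff, Set.mem_union]
      have := hdis d
      tauto
    have hV : ∀ {ν : SPQTree G} {y : V}, y ∈ ν.vertexSet → y ∈ G.vertexSet := by
      intro ν y hy
      obtain ⟨d, -, rfl⟩ := mem_vertexSet_iff.1 hy
      exact d.fst_mem
    rw [hU]
    refine connAvoid_of_series hbi hl (w := w) (fun d hd => hd) (fun d hd => hd) hwx
      (fun e => haj (e ▸ hwj)) (hV hwj) (hV hxj) (hV hai) hsj ?_ ?_ ?_
    · intro d hd d' hd' e
      have hd1 : d ∉ (c i).darts := fun h => hd (Or.inl h)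
      have hd2 : d ∉ (c j).darts := fun h => hd (Or.inr h)
      have hdx : d.fst ≠ x := fun h => by
        rcases hx d h with h | h
        · exact hd1 h
        · exact hd2 h
      rcases not_not.1 hd' with h | h
      · rcases hsi d' h d hd1 e.symm with h | h
        · exact absurd (e.trans h) hdx
        · exact Or.inl (e.trans h)
      · rcases hsj d' h d hd2 e.symm with h | h
        · exact absurd (e.trans h) hdx
        · exact Or.inr (e.trans h)
    · intro d hd e
      exact haj (mem_vertexSet_iff.2 ⟨d, hd, e⟩)
    · intro d hd e
      exact hd (hx d e)
  have hk := hS.1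
  have hne := (hc i).source_ne_sink
  -- The first child uses its successor as the adjacent sibling, every other child its predecessor.
  by_cases hi : (i : ℕ) = 0
  · have hj : (i : ℕ) + 1 = (⟨i + 1, by omega⟩ : Fin k) := rfl
    set j : Fin k := ⟨i + 1, by omega⟩ with hjd
    have hij : i ≠ j := fun e => by rw [← e] at hj; omega
    have hjs := hS.2.2.2.1 i j hj
    rw [Set.pair_comm]
    refine key j (c i).sink (c i).source (c j).sink hij (fun d hd => hS.junction hc hμ hj hd)
      (fun d hd d' hd' e => (hS.attached hc hμ i d hd d' hd' e).symm) ?_ ?_ ?_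
      (hc i).source_mem (hc j).sink_mem ?_
    · rw [hjs]; exact hS.attached hc hμ j
    · intro h
      rcases hS.mem_inter hij (hc i).source_mem h with h | h
      · exact hne h.1
      · omega
    · rw [hjs]; exact (hc j).source_mem
    · rw [hjs]; exact (hc j).source_ne_sink.symm
  · have hj : ((⟨i - 1, by omega⟩ : Fin k) : ℕ) + 1 = i := by simp; omega
    set j : Fin k := ⟨i - 1, by omega⟩ with hjd
    have hij : i ≠ j := fun e => by rw [← e] at hj; omega
    have hjs := hS.2.2.2.1 j i hj
    refine key j (c i).source (c i).sink (c j).source hij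
      (fun d hd => (hS.junction hc hμ hj (hd.trans hjs.symm)).symm) (hS.attached hc hμ i)
      ?_ ?_ ?_ (hc i).sink_mem (hc j).source_mem ?_
    · rw [← hjs]; exact fun d hd d' hd' e => (hS.attached hc hμ j d hd d' hd' e).symm
    · intro h
      rcases hS.mem_inter hij (hc i).sink_mem h with h | h
      · omega
      · exact hne h.1.symm
    · rw [← hjs]; exact (hc j).sink_mem
    · rw [← hjs]; exact (hc j).source_ne_sink

/-- A chain of at least two edges, or an S-node, splits into its first part and the remainder,
composed in series, so the vertex between them links all darts without the poles. A single edge is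
linked by its own reversal. -/
theorem connAvoid_of_not_parallel (hbi : Biconnected G) (hl : ∀ d : Dart G, d.fst ≠ d.snd)
    {ν : SPQTree G} (hν : ν.IsReduced) (hp : ¬ ν.IsParallelNode) (hA : ν.Attached) :
    ConnAvoid ν.darts {ν.source, ν.sink} := by
  have hV : ∀ {ν : SPQTree G} {y : V}, y ∈ ν.vertexSet → y ∈ G.vertexSet := by
    intro ν y hy
    obtain ⟨d, -, rfl⟩ := mem_vertexSet_iff.1 hy
    exact d.fst_mem
  have hst := hν.source_ne_sink
  have hsV := hV hν.source_mem
  have htV := hV hν.sink_mem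
  cases ν with
  | parallel s t k c => exact absurd trivial hp
  | chain s t p =>
    obtain ⟨hp0, hw⟩ := hν
    obtain ⟨d, q, rfl⟩ := List.exists_cons_of_ne_nil hp0
    rcases q with _ | ⟨d₂, q⟩
    · refine connAvoid_pair d _ fun x => ?_
      rw [mem_darts_chain]
      simp only [List.mem_singleton]
      constructor
      · rintro (h | h)
        · exact Or.inl h
        · exact Or.inr (by rw [← h]; rfl)
      · rintro (h | h)
        · exact Or.inl h
        · exact Or.inr (by rw [h]; rfl)
    · have hd1 : d.fst = s := hw.1.1
      have ht : t ∈ (d₂ :: q).map Dart.snd := hw.1.2.2.target_mem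
      have hdt : d.snd ≠ t := by
        intro e
        exact (List.nodup_cons.1 hw.tail.2).1 (e ▸ ht)
      have hds : d.snd ≠ s := fun e => hw.fst_ne_snd (d := d) (by simp) (hd1.trans e.symm)
      have htail : ∀ x ∈ (chain s t (d :: d₂ :: q)).darts, x ∉ ({d, d.rev} : Set (Dart G)) →
          x.fst ≠ s := by
        intro x hx hx'
        simp only [Set.mem_insert_iff, Set.mem_singleton_iff, not_or] at hx'
        rcases mem_darts_chain.1 hx with h | h
        · rcases List.mem_cons.1 h with rfl | h
          · exact absurd rfl hx'.1
          · exact (hw.source_ne_of_mem_tail h).1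
        · rcases List.mem_cons.1 h with h | h
          · exact absurd (by rw [← h]; rfl) hx'.2
          · exact (hw.source_ne_of_mem_tail h).2
      have hsub : ∀ x ∈ ({d, d.rev} : Set (Dart G)), x ∈ (chain s t (d :: d₂ :: q)).darts := by
        rintro x (rfl | rfl)
        · exact mem_darts_chain.2 (Or.inl (by simp))
        · exact mem_darts_chain.2 (Or.inr (by simp))
      have hr : ∀ x ∈ ({d, d.rev} : Set (Dart G)), x.rev ∈ ({d, d.rev} : Set (Dart G)) := by
        rintro x (rfl | rfl) <;> simp
      have hend : ∀ x ∈ ({d, d.rev} : Set (Dart G)), x.fst = s ∨ x.fst = d.snd := by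
        rintro x (rfl | rfl)
        · exact Or.inl hd1
        · exact Or.inr rfl
      have hU : (chain s t (d :: d₂ :: q)).darts =
          {d, d.rev} ∪ ((chain s t (d :: d₂ :: q)).darts \ {d, d.rev}) :=
        (Set.union_sdiff_cancel hsub).symm
      rw [hU]
      refine connAvoid_of_series hbi hl (w := d.snd) hr ?_ hds hdt d.rev.fst_mem hsV htV
        (fun x hx _ _ _ => hend x hx) ?_ ?_ (fun x hx => htail x hx.1 hx.2)
      · rintro x ⟨h1, h2⟩
        exact ⟨h1, fun h => h2 (hr x.rev h)⟩
      · rintro x ⟨h1, h2⟩ x' hx' e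
        by_cases h : x' ∈ ({d, d.rev} : Set (Dart G))
        · rcases hend x' h with h | h
          · exact absurd (e.trans h) (htail x h1 h2)
          · exact Or.inr (e.trans h)
        · have h3 : x' ∉ (chain s t (d :: d₂ :: q)).darts := fun h' => hx' ⟨h', h⟩
          rcases hA x h1 x' h3 e with h | h
          · exact absurd h (htail x h1 h2)
          · exact Or.inl h
      · rintro x (rfl | rfl)
        · rw [hd1]; exact hst
        · exact hdt
  | series s t k c =>
    obtain ⟨hS, hc, -⟩ := hν
    have hk := hS.1
    set i : Fin k := ⟨0, by omega⟩ with hi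
    have hi0 : (i : ℕ) = 0 := rfl
    have hs0 : (c i).source = s := hS.2.1 i rfl
    have hat := hS.attached hc hA i
    have hne := (hc i).source_ne_sink
    have hti : t ∉ (c i).vertexSet := fun h => by
      have := hS.sink_mem_iff hc h
      omega
    have htail : ∀ x ∈ (series s t k c).darts, x ∉ (c i).darts → x.fst ≠ s := by
      intro x hx hx' e
      obtain ⟨l, hl⟩ := mem_darts_series.1 hx
      have := hS.source_mem_iff hc (mem_vertexSet_iff.2 ⟨x, hl, e⟩)
      exact hx' ((Fin.ext this : l = i) ▸ hl)
    have hU : (series s t k c).darts = (c i).darts ∪ ((series s t k c).darts \ (c i).darts) :=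
      (Set.union_sdiff_cancel fun x hx => mem_darts_series.2 ⟨i, hx⟩).symm
    rw [hU]
    refine connAvoid_of_series hbi hl (w := (c i).sink) (fun d hd => hd) (fun d hd => hd)
      (fun e => hne (hs0.trans e.symm)) (fun (e : (c i).sink = t) => hti (e ▸ (hc i).sink_mem)) (hV (hc i).sink_mem)
      hsV htV ?_ ?_ ?_ (fun x hx => htail x hx.1 hx.2)
    · intro d hd d' hd' e
      have := hat d hd d' hd' e
      rwa [hs0] at this
    · rintro x ⟨h1, h2⟩ x' hx' e
      by_cases h : x' ∈ (c i).darts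
      · rcases hat x' h x h2 e.symm with h | h
        · exact absurd (e.trans (h.trans hs0)) (htail x h1 h2)
        · exact Or.inr (e.trans h)
      · rcases hA x h1 x' (fun h' => hx' ⟨h', h⟩) e with h | h
        · exact absurd h (htail x h1 h2)
        · exact Or.inl h
    · intro d hd e
      exact hti (mem_vertexSet_iff.2 ⟨d, hd, e⟩)

/-! ### Children of a parallel composition, and all non-root nodes -/

theorem ParallelComposition.attached {s t : V} {k : ℕ} {c : Fin k → SPQTree G}
    (hP : ParallelComposition s t c)
    (hμ : ∀ d ∈ (parallel s t k c).darts, ∀ d' ∉ (parallel s t k c).darts,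
      d.fst = d'.fst → d.fst = s ∨ d.fst = t) (i : Fin k) : (c i).Attached := by
  intro d hd d' hd' e
  rw [(hP.2.1 i).1, (hP.2.1 i).2]
  by_cases h : d' ∈ (parallel s t k c).darts
  · obtain ⟨l, hl⟩ := mem_darts_parallel.1 h
    have hil : i ≠ l := fun e => hd' (e ▸ hl)
    exact (hP.2.2.2 i l hil).le
      ⟨mem_vertexSet_iff.2 ⟨d, hd, rfl⟩, mem_vertexSet_iff.2 ⟨d', hl, e.symm⟩⟩
  · exact hμ d (mem_darts_parallel.2 ⟨i, hd⟩) d' h e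

theorem exists_not_mem_darts {k : ℕ} {c : Fin k → SPQTree G} (hk : 2 ≤ k)
    (hc : ∀ i, (c i).IsReduced)
    (hdis : ∀ i j : Fin k, i ≠ j → Disjoint (c i).edgeSet (c j).edgeSet) (i : Fin k) :
    ∃ d, d ∉ (c i).darts := by
  obtain ⟨j, hj⟩ : ∃ j, j ≠ i := by
    by_cases h : (i : ℕ) = 0
    · exact ⟨⟨1, by omega⟩, fun e => by rw [← e] at h; simp at h⟩
    · exact ⟨⟨0, by omega⟩, fun e => by rw [← e] at h; simp at h⟩
  obtain ⟨d, hd, -⟩ := mem_vertexSet_iff.1 (hc j).source_mem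
  exact ⟨d, fun h => disjoint_darts (hdis j i hj) hd h⟩

theorem IsSPQTree.mem_darts {e : E} {T : SPQTree G} (hT : IsSPQTree G e T) (d : Dart G) :
    d ∈ T.darts := by
  change d.edge ∈ T.edgeSet
  rw [hT.1]
  exact d.isLink.edge_mem

theorem IsSPQTree.finite {e : E} {T : SPQTree G} (hT : IsSPQTree G e T) : Finite (Dart G) :=
  Set.finite_univ_iff.1 (T.finite_darts.subset fun d _ => hT.mem_darts d)

theorem IsSPQTree.fst_ne_snd {e : E} {T : SPQTree G} (hT : IsSPQTree G e T) (d : Dart G) :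
    d.fst ≠ d.snd := by
  have hd := hT.mem_darts d
  obtain ⟨-, -, s, t, c, rfl, -, hc, -⟩ := hT
  obtain ⟨i, hi⟩ := mem_darts_parallel.1 hd
  exact (hc i).fst_ne_snd hi

/-- The properties of the nodes of an SPQ*-tree other than the root. -/
theorem IsSPQTree.node {e : E} {T : SPQTree G} (hT : IsSPQTree G e T) (hbi : Biconnected G)
    {ν : SPQTree G} (hν : T.IsNode ν) : ν = T ∨ (ν.IsReduced ∧ ν.Attached ∧ (∃ d, d ∉ ν.darts) ∧
      (ConnAvoid ν.darts {ν.source, ν.sink} ∨ ConnAvoid ν.dartsᶜ {ν.source, ν.sink}) ∧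
      (e ∉ ν.edgeSet ∨ ∀ d ∈ ν.darts, d.edge = e)) := by
  have hl := hT.fst_ne_snd
  induction hν with
  | root => exact Or.inl rfl
  | @series s t k c i hμ ih =>
    right
    rcases ih with rfl | ⟨h1, h2, h3, h4, h5⟩
    · obtain ⟨-, -, s', t', c', h, -⟩ := hT
      simp at h
    · refine ⟨h1.2.1 i, h1.1.attached h1.2.1 h2 i,
        exists_not_mem_darts h1.1.1 h1.2.1 h1.1.2.2.2.2.1 i,
        Or.inr (connAvoid_series_child hbi hl h1.1 h1.2.1 h2 i), ?_⟩
      rcases h5 with h5 | h5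
      · exact Or.inl fun h => h5 (Set.mem_iUnion.2 ⟨i, h⟩)
      · exact Or.inr fun d hd => h5 d (mem_darts_series.2 ⟨i, hd⟩)
  | @parallel s t k c i hμ ih =>
    right
    rcases ih with rfl | ⟨h1, h2, h3, h4, h5⟩
    · have hall := hT.mem_darts
      obtain ⟨-, -, s', t', c', h, hP, hc, j, d, hd, hj⟩ := hT
      injection h with e1 e2 e3 e4
      subst e1 e2 e3
      obtain rfl := eq_of_heq e4
      have hA := hP.attached (fun d _ d' hd' => absurd (hall d') hd') i
      have hpair : ∀ x, x ∈ (c j).darts ↔ x = d ∨ x = d.rev := by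
        intro x
        rw [hj, mem_darts_chain, List.mem_singleton, List.mem_singleton]
        exact or_congr_right ⟨fun h => by rw [← h]; rfl, fun h => by rw [h]; rfl⟩
      refine ⟨hc i, hA, exists_not_mem_darts hP.1 hc hP.2.2.1 i, ?_⟩
      -- Of the two children of the root, the edge `e` is linked by itself, and for its sibling this
      -- same edge is the whole complement. This covers a sibling that is a P-node.
      by_cases hij : i = j
      · subst hij
        refine ⟨Or.inl (connAvoid_pair d _ hpair), Or.inr fun x hx => ?_⟩
        rcases (hpair x).1 hx with rfl | rfl
        · exact hd
        · exact hd
      · refine ⟨Or.inr (connAvoid_pair d _ fun x => ?_), Or.inl fun h => ?_⟩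
        · rw [← hpair]
          constructor
          · intro hx
            obtain ⟨l, hl⟩ := mem_darts_parallel.1 (hall x)
            have hli : l ≠ i := fun e => hx (e ▸ hl)
            have : l = j := by omega
            exact this ▸ hl
          · exact fun hx hx' => disjoint_darts (hP.2.2.1 i j hij) hx' hx
        · refine Set.disjoint_left.1 (hP.2.2.1 i j hij) h ?_
          have : d ∈ (c j).darts := (hpair d).2 (Or.inl rfl)
          rw [← hd]
          exact this
    -- Here reducedness is used: a child of a non-root P-node is not a P-node, so it is linked
    -- inside without its poles.
    · have hA := h1.1.attached h2 i
      refine ⟨h1.2.1 i, hA, exists_not_mem_darts h1.1.1 h1.2.1 h1.1.2.2.1 i,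
        Or.inl (connAvoid_of_not_parallel hbi hl (h1.2.1 i) (h1.2.2 i) hA), ?_⟩
      rcases h5 with h5 | h5
      · exact Or.inl fun h => h5 (Set.mem_iUnion.2 ⟨i, h⟩)
      · exact Or.inr fun d hd => h5 d (mem_darts_parallel.2 ⟨i, hd⟩)

theorem IsSPQTree.sep {e : E} {T : SPQTree G} (hT : IsSPQTree G e T) (hbi : Biconnected G)
    {ν : SPQTree G} (hν : T.IsNode ν) (hroot : ν ≠ T) : Sep ν.darts ν.source ν.sink := by
  obtain ⟨h1, h2, h3, h4, -⟩ := (hT.node hbi hν).resolve_left hroot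
  exact sep_of_mixed hbi hT.fst_ne_snd ν.rev_mem_darts h1.source_ne_sink h2
    (mem_vertexSet_iff.1 h1.source_mem) (mem_vertexSet_iff.1 h1.sink_mem) h3 h4

end SPQTree

end SPOrtho

namespace SPOrtho

/-! ### The permutations of an embedded graph -/

section Maps

open Equiv Equiv.Perm

variable {V E : Type*} {G : Graph V E}

/-- The clockwise order permutes the darts at each vertex cyclically. -/
structure LabeledMap.IsRotation (M : LabeledMap G) : Prop where
  fst : ∀ d, (M.cw d).fst = d.fst
  trans : ∀ d d' : Dart G, d.fst = d'.fst → ∃ n : ℕ, M.cw^[n] d = d'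

theorem LabeledMap.IsRotation.iterate_fst {M : LabeledMap G} (h : M.IsRotation) (n : ℕ)
    (d : Dart G) : (M.cw^[n] d).fst = d.fst := by
  induction n with
  | zero => rfl
  | succ n ih => rw [Function.iterate_succ_apply', h.fst, ih]

theorem LabeledMap.IsRotation.bijective [Finite (Dart G)] {M : LabeledMap G} (h : M.IsRotation) :
    Function.Bijective M.cw := by
  refine Function.Surjective.bijective_of_finite fun d => ?_
  obtain ⟨n, hn⟩ := h.trans (M.cw d) d (h.fst d)
  refine ⟨M.cw^[n] d, ?_⟩
  rw [← Function.iterate_succ_apply' M.cw, Function.iterate_succ_apply, hn]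

/-- The clockwise order as a permutation. -/
noncomputable def LabeledMap.IsRotation.perm [Finite (Dart G)] {M : LabeledMap G}
    (h : M.IsRotation) : Perm (Dart G) := Equiv.ofBijective M.cw h.bijective

/-- The reversal of darts as a permutation. -/
def revPerm : Perm (Dart G) := ⟨Dart.rev, Dart.rev, Dart.rev_rev, Dart.rev_rev⟩

@[simp] theorem revPerm_apply (d : Dart G) : revPerm d = d.rev := rfl

/-- The permutation whose cycles are the faces. -/
noncomputable def LabeledMap.IsRotation.facePerm [Finite (Dart G)] {M : LabeledMap G}
    (h : M.IsRotation) : Perm (Dart G) := h.perm * revPerm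

open Classical in
/-- The reversal of the darts of a list and their opposites; other darts are fixed. -/
noncomputable def revOn (p : List (Dart G)) : Perm (Dart G) :=
  Function.Involutive.toPerm (fun d => if d ∈ p ∨ d.rev ∈ p then d.rev else d) (by
    intro d
    by_cases h : d ∈ p ∨ d.rev ∈ p
    · simp [h, h.symm]
    · simp [h])

theorem revOn_of_mem {p : List (Dart G)} {d : Dart G} (h : d ∈ p ∨ d.rev ∈ p) :
    revOn p d = d.rev := if_pos h

theorem revOn_of_not {p : List (Dart G)} {d : Dart G} (h : ¬ (d ∈ p ∨ d.rev ∈ p)) :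
    revOn p d = d := if_neg h

theorem revOn_revOn (p : List (Dart G)) (d : Dart G) : revOn p (revOn p d) = d := by
  by_cases h : d ∈ p ∨ d.rev ∈ p
  · rw [revOn_of_mem h, revOn_of_mem (by simpa using h.symm), Dart.rev_rev]
  · rw [revOn_of_not h, revOn_of_not h]

theorem revOn_nil : revOn ([] : List (Dart G)) = 1 := by
  ext1 d
  exact revOn_of_not (by simp)

theorem revOn_rev (p : List (Dart G)) (d : Dart G) : revOn p d.rev = (revOn p d).rev := by
  by_cases h : d ∈ p ∨ d.rev ∈ p
  · rw [revOn_of_mem h, revOn_of_mem (by simpa using h.symm)]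
  · rw [revOn_of_not h, revOn_of_not (by simpa [or_comm] using h)]

/-- The reversal of the darts off a list. -/
noncomputable def revOff (p : List (Dart G)) : Perm (Dart G) := revPerm * revOn p

theorem revOff_of_mem {p : List (Dart G)} {d : Dart G} (h : d ∈ p ∨ d.rev ∈ p) :
    revOff p d = d := by
  rw [revOff, Perm.mul_apply, revOn_of_mem h]; rfl

theorem revOff_of_not {p : List (Dart G)} {d : Dart G} (h : ¬ (d ∈ p ∨ d.rev ∈ p)) :
    revOff p d = d.rev := by
  rw [revOff, Perm.mul_apply, revOn_of_not h]; rfl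

theorem revOff_revOff (p : List (Dart G)) (d : Dart G) : revOff p (revOff p d) = d := by
  by_cases h : d ∈ p ∨ d.rev ∈ p
  · rw [revOff_of_mem h, revOff_of_mem h]
  · rw [revOff_of_not h, revOff_of_not (by simpa [or_comm] using h), Dart.rev_rev]

/-- `b * revOn p` is the vertex permutation after contraction of `p`, and `revOff p` is the
remaining edge involution, with the darts of `p` as fixed points. Their product is unchanged:
contraction preserves faces. -/
theorem mul_revOn_mul_revOff (b : Perm (Dart G)) (p : List (Dart G)) :
    b * revOn p * revOff p = b * revPerm := by
  ext1 d
  simp only [Perm.mul_apply, revOff, revPerm_apply]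
  rw [revOn_rev, revOn_revOn]

section

variable [DecidableEq (Dart G)]

theorem revOn_cons {p : List (Dart G)} {d : Dart G} (h : d ∉ p) (h' : d.rev ∉ p) :
    revOn (d :: p) = revOn p * swap d d.rev := by
  ext1 x
  rw [Perm.mul_apply]
  rcases eq_or_ne x d with rfl | h1
  · rw [swap_apply_left, revOn_of_mem (by simp), revOn_of_not]
    simpa using ⟨h', h⟩
  rcases eq_or_ne x d.rev with rfl | h2
  · rw [swap_apply_right, revOn_of_mem (by simp), revOn_of_not (by simpa using ⟨h, h'⟩)]
    rfl
  have h3 : x.rev ≠ d := fun e => h2 (by rw [← e]; rfl)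
  rw [swap_apply_of_ne_of_ne h1 h2]
  by_cases hx : x ∈ p ∨ x.rev ∈ p
  · rw [revOn_of_mem hx, revOn_of_mem (hx.imp (List.mem_cons_of_mem _) (List.mem_cons_of_mem _))]
  · rw [revOn_of_not hx, revOn_of_not (by simpa [h1, h3] using hx)]

theorem revOff_cons {p : List (Dart G)} {d : Dart G} (h : d ∉ p) (h' : d.rev ∉ p) :
    revOff (d :: p) = revOff p * swap d d.rev := by
  rw [revOff, revOn_cons h h', ← mul_assoc]
  rfl

end

theorem card_support_revOff [Fintype (Dart G)] [DecidableEq (Dart G)]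
    (hl : ∀ d : Dart G, d.fst ≠ d.snd) {p : List (Dart G)} (hp : p.Nodup)
    (hp' : ∀ d ∈ p, d.rev ∉ p) :
    (revOff p).support.card + 2 * p.length = Nat.card (Dart G) := by
  have h1 : (revOff p).supportᶜ = p.toFinset ∪ p.toFinset.image Dart.rev := by
    ext d
    simp only [Finset.mem_compl, mem_support, not_not, Finset.mem_union, List.mem_toFinset,
      Finset.mem_image]
    have h2 : (∃ a ∈ p, a.rev = d) ↔ d.rev ∈ p :=
      ⟨by rintro ⟨a, ha, rfl⟩; exact ha, fun h => ⟨d.rev, h, rfl⟩⟩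
    rw [h2]
    by_cases h : d ∈ p ∨ d.rev ∈ p
    · simp [revOff_of_mem h, h]
    · simp only [revOff_of_not h, h, iff_false]
      intro e
      exact hl d (by conv_lhs => rw [← e, Dart.rev_fst])
  have h2 : (revOff p).supportᶜ.card = 2 * p.length := by
    rw [h1, Finset.card_union_of_disjoint, Finset.card_image_of_injective,
      List.toFinset_card_of_nodup hp]
    · ring
    · intro a b h; rw [← Dart.rev_rev a, h, Dart.rev_rev]
    · rw [Finset.disjoint_left]
      intro d hd hd'
      obtain ⟨a, ha, rfl⟩ := Finset.mem_image.1 hd'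
      exact hp' a (by simpa using ha) (by simpa using hd)
  have := Finset.card_compl_add_card (revOff p).support
  rw [Nat.card_eq_fintype_card]
  omega

theorem IsPath.nodup {u v : V} {p : List (Dart G)} (h : IsPath u p v) : p.Nodup :=
  List.Nodup.of_map _ (List.nodup_cons.1 h.2).2

theorem IsPath.rev_notMem {u v : V} {p : List (Dart G)} (h : IsPath u p v) :
    ∀ d ∈ p, d.rev ∉ p := by
  induction p generalizing u with
  | nil => simp
  | cons a p ih =>
    intro d hd hd'
    have hau : a.fst = u := h.1.1
    rcases List.mem_cons.1 hd with rfl | hd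
    · rcases List.mem_cons.1 hd' with e | hd'
      · exact h.fst_ne_snd (d := d) (by simp) (congrArg Dart.snd e)
      · exact (h.source_ne_of_mem_tail hd').2 hau
    · rcases List.mem_cons.1 hd' with e | hd'
      · exact (h.source_ne_of_mem_tail hd).2 (by rw [← hau, ← e]; rfl)
      · exact ih h.tail d hd hd'

namespace LabeledMap.IsRotation

variable [Finite (Dart G)] {M : LabeledMap G} (h : M.IsRotation)

theorem sameCycle_perm_iff (d d' : Dart G) : SameCycle h.perm d d' ↔ d.fst = d'.fst := by
  rw [sameCycle_iff_iterate]
  constructor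
  · rintro ⟨n, rfl⟩
    exact (h.iterate_fst n d).symm
  · exact h.trans d d'

include h in
/-- A permutation that agrees with the clockwise order at a vertex permutes its darts cyclically. -/
theorem sameCycle_of_eq_at {a : Perm (Dart G)} {x : V} (ha : ∀ d : Dart G, d.fst = x → a d = M.cw d)
    {d d' : Dart G} (hd : d.fst = x) (hd' : d'.fst = x) : SameCycle a d d' := by
  obtain ⟨n, rfl⟩ := h.trans d d' (hd.trans hd'.symm)
  rw [sameCycle_iff_iterate]
  refine ⟨n, ?_⟩
  clear hd'
  induction n with
  | zero => rfl
  | succ n ih =>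
    rw [Function.iterate_succ_apply', Function.iterate_succ_apply', ih, ha]
    rw [h.iterate_fst, hd]

theorem sup_eq_top (hbi : Biconnected G) :
    SameCycle.setoid h.perm ⊔ SameCycle.setoid revPerm = ⊤ := by
  set s := SameCycle.setoid h.perm ⊔ SameCycle.setoid revPerm with hs
  have hsv : ∀ d d' : Dart G, d.fst = d'.fst → s d d' := fun d d' e =>
    (le_sup_left : _ ≤ s) ((h.sameCycle_perm_iff d d').2 e)
  have hsr : ∀ d : Dart G, s d d.rev := fun d =>
    (le_sup_right : SameCycle.setoid revPerm ≤ s) (setoid_apply_self revPerm d)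
  rw [eq_top_iff]
  rintro d d' -
  obtain ⟨p, hp⟩ := hbi.1 d.fst d.fst_mem d'.fst d'.fst_mem
  have key : ∀ (p : List (Dart G)) (x : Dart G), IsWalk x.fst p d'.fst → s x d' := by
    intro p
    induction p with
    | nil => exact fun x e => hsv _ _ e
    | cons a p ih =>
      rintro x ⟨h1, h2⟩
      exact s.trans' (hsv x a h1.symm) (s.trans' (hsr a) (ih a.rev h2))
  exact key p d hp

variable [DecidableEq (Dart G)]

/-- Contraction of a simple path. -/
theorem contract {u v : V} {p : List (Dart G)} (hp : IsPath u p v) :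
    (∀ x y, SameCycle (h.perm * revOn p) x y ↔
      (x.fst = y.fst ∨ (x.fst ∈ u :: p.map Dart.snd ∧ y.fst ∈ u :: p.map Dart.snd))) ∧
    numClasses (SameCycle.setoid (h.perm * revOn p)) + p.length =
      numClasses (SameCycle.setoid h.perm) ∧
    SameCycle.setoid h.perm ⊔ SameCycle.setoid revPerm ≤
      SameCycle.setoid (h.perm * revOn p) ⊔ SameCycle.setoid (revOff p) := by
  induction p generalizing u with
  | nil =>
    rw [revOff, revOn_nil, mul_one, mul_one]
    refine ⟨fun x y => ?_, rfl, le_rfl⟩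
    rw [h.sameCycle_perm_iff]
    simp only [List.map_nil, List.mem_singleton]
    exact ⟨Or.inl, fun h => h.elim id fun h => h.1.trans h.2.symm⟩
  | cons d p ih =>
    obtain ⟨h1, h2, h3⟩ := ih hp.tail
    have hdu : d.fst = u := hp.1.1
    have hu : u ∉ d.snd :: p.map Dart.snd := (List.nodup_cons.1 hp.2).1
    have hd : d ∉ p := (List.nodup_cons.1 hp.nodup).1
    have hd' : d.rev ∉ p := fun hm => hp.rev_notMem d (by simp) (List.mem_cons_of_mem _ hm)
    -- The vertex `u` is not on the rest of the path, so the two ends of `d` still lie on different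
    -- cycles and the transposition merges them.
    have hnot : ¬ SameCycle (h.perm * revOn p) d d.rev := by
      rw [h1, hdu]
      rintro (e | e)
      · exact hp.fst_ne_snd (d := d) (by simp) (hdu.trans e)
      · exact hu e.1
    have ha : h.perm * revOn (d :: p) = h.perm * revOn p * swap d d.rev := by
      rw [revOn_cons hd hd', mul_assoc]
    have hr : revOff (d :: p) = revOff p * swap d d.rev := revOff_cons hd hd'
    have hsup : SameCycle.setoid (h.perm * revOn (d :: p)) =
        SameCycle.setoid (h.perm * revOn p) ⊔ SameCycle.setoid (swap d d.rev) := by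
      rw [ha, ← setoid_mul_swap_sup, sup_swap_of_rel (s := SameCycle.setoid _)]
      exact sameCycle_mul_swap_of_not hnot
    refine ⟨fun x y => ?_, ?_, ?_⟩
    · change SameCycle.setoid (h.perm * revOn (d :: p)) x y ↔ _
      rw [hsup, sup_swap_iff]
      change SameCycle _ x y ∨ (SameCycle _ x d ∧ SameCycle _ d.rev y) ∨
        (SameCycle _ x d.rev ∧ SameCycle _ d y) ↔ _
      simp only [h1, hdu, Dart.rev_fst, List.map_cons, List.mem_cons (a := x.fst) (b := u),
        List.mem_cons (a := y.fst) (b := u), hu, and_false, false_and, or_false]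
      have m1 : ∀ z : V, z = d.snd → z ∈ d.snd :: p.map Dart.snd := by rintro _ rfl; simp
      have m2 : d.snd ∈ d.snd :: p.map Dart.snd := by simp
      constructor
      · rintro ((h | h) | ⟨h, h' | h'⟩ | ⟨h | h, h'⟩)
        · exact Or.inl h
        · exact Or.inr ⟨Or.inr h.1, Or.inr h.2⟩
        · exact Or.inr ⟨Or.inl h, Or.inr (m1 _ h'.symm)⟩
        · exact Or.inr ⟨Or.inl h, Or.inr h'.2⟩
        · exact Or.inr ⟨Or.inr (m1 _ h), Or.inl h'.symm⟩
        · exact Or.inr ⟨Or.inr h.1, Or.inl h'.symm⟩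
      · rintro (h | ⟨h | h, h' | h'⟩)
        · exact Or.inl (Or.inl h)
        · exact Or.inl (Or.inl (h.trans h'.symm))
        · exact Or.inr (Or.inl ⟨h, Or.inr ⟨m2, h'⟩⟩)
        · exact Or.inr (Or.inr ⟨Or.inr ⟨h, m2⟩, h'.symm⟩)
        · exact Or.inl (Or.inr ⟨h, h'⟩)
    · have := numClasses_mul_swap_of_not hnot
      rw [ha, List.length_cons]
      omega
    · refine h3.trans (sup_le ?_ ?_)
      · refine le_trans ?_ le_sup_left
        rw [hsup]
        exact le_sup_left
      · calc SameCycle.setoid (revOff p)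
            ≤ SameCycle.setoid (revOff p) ⊔ SameCycle.setoid (swap d d.rev) := le_sup_left
          _ = SameCycle.setoid (revOff (d :: p)) ⊔ SameCycle.setoid (swap d d.rev) := by
            rw [hr, setoid_mul_swap_sup]
          _ ≤ _ := by
            refine sup_le le_sup_right (le_trans ?_ le_sup_left)
            rw [hsup]
            exact le_sup_right

end LabeledMap.IsRotation

theorem one_le_of_top {α : Type*} {s : Setoid α} (h : s = ⊤) : numClasses s ≤ 1 := by
  subst h
  have : Subsingleton (Quotient (⊤ : Setoid α)) :=
    ⟨fun p q => Quotient.inductionOn₂ p q fun x y => Quotient.sound trivial⟩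
  exact Finite.card_le_one_iff_subsingleton.2 this

/-- A connected embedded graph that satisfies Euler's formula. -/
structure LabeledMap.IsPlanar [Finite (Dart G)] (M : LabeledMap G) : Prop
    extends M.IsRotation where
  euler : 2 * numClasses (SameCycle.setoid toIsRotation.perm) +
    2 * numClasses (SameCycle.setoid toIsRotation.facePerm) = Nat.card (Dart G) + 4

/-- The discrete Jordan curve theorem: the two sides of a simple closed curve, which consists of
the path `q` and the dart `x`, are not connected off the curve. -/
theorem LabeledMap.IsPlanar.jordan [Finite (Dart G)] [DecidableEq (Dart G)] {M : LabeledMap G}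
    (h : M.IsPlanar) (hbi : Biconnected G) (hl : ∀ d : Dart G, d.fst ≠ d.snd) {u z : V}
    {q : List (Dart G)} (hq : IsPath u q z) {x : Dart G} (hxz : x.fst = z) (hxu : x.snd = u)
    (hx : x ∉ q) (hx' : x.rev ∉ q) :
    ¬ (SameCycle.setoid (h.perm * revOn (x :: q)) ⊔ SameCycle.setoid (revOff (x :: q)))
      x x.rev := by
  have := Fintype.ofFinite (Dart G)
  -- Contracting `q` merges its vertices into one; closing the curve with `x` then splits that cycle
  -- in two, whose representatives `x` and `x.rev` stand for the two sides. Were the sides connected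
  -- off the curve, the map would have one component, and `euler_le` would contradict Euler's
  -- formula for `M`.
  intro hcon
  obtain ⟨h1, h2, h3⟩ := h.contract hq
  have ha : h.perm * revOn (x :: q) = h.perm * revOn q * swap x x.rev := by
    rw [revOn_cons hx hx', mul_assoc]
  have hsc : SameCycle (h.perm * revOn q) x x.rev := by
    rw [h1]
    refine Or.inr ⟨hxz ▸ hq.1.target_mem, ?_⟩
    rw [Dart.rev_fst, hxu]; simp
  have hne : x ≠ x.rev := fun e => hl x (congrArg Dart.fst e)
  have h4 := numClasses_mul_swap_of_sameCycle hne hsc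
  have h5 := card_support_revOff hl (p := x :: q) (List.nodup_cons.2 ⟨hx, hq.nodup⟩) (by
    intro d hd hd'
    rcases List.mem_cons.1 hd with rfl | hd
    · rcases List.mem_cons.1 hd' with e | hd'
      · exact hne e.symm
      · exact hx' hd'
    · rcases List.mem_cons.1 hd' with e | hd'
      · exact hx' (by rw [← e]; exact hd)
      · exact hq.rev_notMem d hd hd')
  have h6 := euler_le (h.perm * revOn (x :: q)) (revOff (x :: q)) (revOff_revOff _)
  rw [mul_revOn_mul_revOff, ha, h4, ← ha] at h6
  have h7 : SameCycle.setoid (h.perm * revOn (x :: q)) ⊔ SameCycle.setoid (revOff (x :: q)) = ⊤ := by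
    set s := SameCycle.setoid (h.perm * revOn (x :: q)) ⊔ SameCycle.setoid (revOff (x :: q)) with hs
    rw [eq_top_iff, ← h.sup_eq_top hbi, ← sup_swap_of_rel hcon]
    refine h3.trans (sup_le ?_ ?_)
    · calc SameCycle.setoid (h.perm * revOn q)
          ≤ SameCycle.setoid (h.perm * revOn q) ⊔ SameCycle.setoid (swap x x.rev) := le_sup_left
        _ = SameCycle.setoid (h.perm * revOn (x :: q)) ⊔ SameCycle.setoid (swap x x.rev) := by
          rw [ha, setoid_mul_swap_sup]
        _ ≤ _ := sup_le_sup_right le_sup_left _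
    · calc SameCycle.setoid (revOff q)
          ≤ SameCycle.setoid (revOff q) ⊔ SameCycle.setoid (swap x x.rev) := le_sup_left
        _ = SameCycle.setoid (revOff (x :: q)) ⊔ SameCycle.setoid (swap x x.rev) := by
          rw [revOff_cons hx hx', setoid_mul_swap_sup]
        _ ≤ _ := sup_le_sup_right le_sup_right _
  have h8 := one_le_of_top h7
  have h9 := h.euler
  rw [LabeledMap.IsRotation.facePerm] at h9
  rw [List.length_cons] at h5
  omega

end Maps

end SPOrtho

namespace SPOrtho

/-! ### Components of planar graphs -/

section Blocks

open Equiv Equiv.Perm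

variable {V E : Type*} {G : Graph V E}

/-- Around each vertex the darts of `X` are consecutive. -/
structure LabeledMap.IsBlock (M : LabeledMap G) (X : Set (Dart G)) : Prop where
  exit : ∀ d ∈ X, ∀ d' ∈ X, d.fst = d'.fst → M.cw d ∉ X → M.cw d' ∉ X → d = d'
  entry : ∀ d ∉ X, ∀ d' ∉ X, d.fst = d'.fst → M.cw d ∈ X → M.cw d' ∈ X → d = d'

theorem LabeledMap.IsBlock.compl {M : LabeledMap G} {X : Set (Dart G)} (h : M.IsBlock X) :
    M.IsBlock Xᶜ where
  exit d hd d' hd' e h1 h2 := h.entry d hd d' hd' e (not_not.1 h1) (not_not.1 h2)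
  entry d hd d' hd' e h1 h2 := h.exit d (not_not.1 hd) d' (not_not.1 hd') e h1 h2

theorem Sep.reach (hbi : Biconnected G) {X : Set (Dart G)} {u v : V} (hS : Sep X u v)
    {d : Dart G} (hd : d ∈ X) (hdu : d.fst ≠ u) : Reach X {u} d.fst v := by
  obtain ⟨a, -, ha⟩ := hS.left_in
  obtain ⟨b, -, hb⟩ := hS.right_in
  exact reach_of_biconnected hbi hS.rev_mem hS.ne.symm (ha ▸ a.fst_mem) (hb ▸ b.fst_mem)
    hS.mixed hd hdu

theorem ConnAvoid.rel {X : Set (Dart G)} {A : Set V} (hc : ConnAvoid X A) (s : Setoid (Dart G))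
    (hr : ∀ d ∈ X, s d d.rev) (hv : ∀ d ∈ X, ∀ d' ∈ X, d.fst = d'.fst → d.fst ∉ A → s d d')
    {d d' : Dart G} (hd : d ∈ X) (hd' : d' ∈ X) : s d d' := by
  have key := hc d hd d' hd'
  clear hd hd'
  induction key with
  | refl x => exact s.refl' x
  | symm x y _ ih => exact s.symm' ih
  | trans x y z _ _ ih₁ ih₂ => exact s.trans' ih₁ ih₂
  | rel x y hxy =>
    obtain ⟨hx, hy, rfl | ⟨exy, hxA⟩⟩ := hxy
    · exact hr x hx
    · exact hv x hx y hy exy hxA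

theorem LabeledMap.IsRotation.exists_first [Finite (Dart G)] {M : LabeledMap G}
    (h : M.IsRotation) {s t : Dart G} (hst : s.fst = t.fst) :
    ∃ k, 0 < k ∧ M.cw^[k] s = t ∧ ∀ i, 0 < i → i < k → M.cw^[i] s ≠ t := by
  classical
  have hex : ∃ k, 0 < k ∧ M.cw^[k] s = t := by
    obtain ⟨n, hn⟩ := h.trans (M.cw s) t ((h.fst s).trans hst)
    exact ⟨n + 1, n.succ_pos, hn⟩
  exact ⟨Nat.find hex, (Nat.find_spec hex).1, (Nat.find_spec hex).2,
    fun i h0 h1 h2 => Nat.find_min hex h1 ⟨h0, h2⟩⟩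

theorem iterate_ne_of_first {α : Type*} {f : α → α} {s t : α} {k : ℕ} (hk : f^[k] s = t)
    (hmin : ∀ i, 0 < i → i < k → f^[i] s ≠ t) {i : ℕ} (h0 : 0 < i) (h1 : i < k) :
    f^[i] s ≠ s := by
  intro e
  refine hmin (k - i) (by omega) (by omega) ?_
  rw [← hk]
  conv_rhs => rw [← Nat.sub_add_cancel h1.le, Function.iterate_add_apply, e]

/-- Suppose the clockwise order enters `X` at two places of `u`, along `t₁` and `t₂`. A path in `X`
that avoids `u` closes these darts to a simple curve. The preceding outside darts `s₁` and `s₂` lie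
on different sides of it, although the complement of `X` is connected away from the curve. -/
theorem LabeledMap.IsPlanar.entry_unique [Finite (Dart G)] {M : LabeledMap G}
    (h : M.IsPlanar) (hbi : Biconnected G) (hl : ∀ d : Dart G, d.fst ≠ d.snd) {X : Set (Dart G)}
    {u v : V} (hS : Sep X u v) (hc : ConnAvoid Xᶜ {u, v}) {s₁ s₂ : Dart G} (h₁ : s₁ ∉ X)
    (h₂ : s₂ ∉ X) (e : s₁.fst = s₂.fst) (c₁ : M.cw s₁ ∈ X) (c₂ : M.cw s₂ ∈ X) : s₁ = s₂ := by
  classical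
  wlog hu : s₁.fst = u generalizing u v
  · refine this hS.swap (by rwa [Set.pair_comm]) ?_
    have := hS.mixed _ c₁ _ h₁ (h.fst s₁)
    rw [h.fst] at this
    exact this.resolve_left hu
  by_contra hne
  set t₁ := M.cw s₁ with ht₁
  set t₂ := M.cw s₂ with ht₂
  have hne' : t₁ ≠ t₂ := fun e => hne (h.bijective.1 e)
  have hf₁ : t₁.fst = u := (h.fst s₁).trans hu
  have hf₂ : t₂.fst = u := (h.fst s₂).trans (e ▸ hu)
  have hg₁ : t₁.snd ≠ u := fun e => hl t₁ (hf₁.trans e.symm)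
  have hg₂ : t₂.snd ≠ u := fun e => hl t₂ (hf₂.trans e.symm)
  have hreach : Reach X {u} t₂.snd t₁.snd :=
    Relation.ReflTransGen.trans (hS.reach hbi (hS.rev_mem _ c₂) hg₂)
      (Reach.symm hS.rev_mem (hS.reach hbi (hS.rev_mem _ c₁) hg₁))
  obtain ⟨p, hp, hpX⟩ := hreach.exists_path
  have hpu : ∀ d ∈ p, d.fst ≠ u ∧ d.snd ≠ u := fun d hd => by
    have := hpX d hd
    exact ⟨fun e => this.2.1 e, fun e => this.2.2 e⟩
  have hq : IsPath u (t₂ :: p) t₁.snd := by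
    refine ⟨⟨hf₂, hp.1⟩, List.nodup_cons.2 ⟨?_, hp.2⟩⟩
    simp only [List.map_cons, List.mem_cons, not_or]
    refine ⟨hg₂.symm, fun hm => ?_⟩
    obtain ⟨d, hd, hd'⟩ := List.mem_map.1 hm
    exact (hpu d hd).2 hd'
  have hx : t₁.rev ∉ t₂ :: p := by
    intro hm
    rcases List.mem_cons.1 hm with e | hm
    · exact hg₁ ((congrArg Dart.fst e).trans hf₂)
    · exact (hpu _ hm).2 hf₁
  have hx' : t₁.rev.rev ∉ t₂ :: p := by
    intro hm
    rcases List.mem_cons.1 hm with e | hm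
    · exact hne' e
    · exact (hpu _ hm).1 hf₁
  have J := h.jordan hbi hl hq (x := t₁.rev) rfl hf₁ hx hx'
  set C := t₁.rev :: t₂ :: p with hC
  have hCX : ∀ d, d ∈ C ∨ d.rev ∈ C → d ∈ X := by
    have : ∀ d ∈ C, d ∈ X := by
      intro d hd
      rcases List.mem_cons.1 hd with rfl | hd
      · exact hS.rev_mem _ c₁
      rcases List.mem_cons.1 hd with rfl | hd
      · exact c₂
      · exact (hpX d hd).1
    rintro d (hd | hd)
    · exact this d hd
    · exact hS.rev_mem _ (this _ hd)
  have hCu : ∀ d : Dart G, d.fst = u → d ∈ C ∨ d.rev ∈ C → d = t₁ ∨ d = t₂ := by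
    intro d hdu hd
    rcases hd with hd | hd
    · rcases List.mem_cons.1 hd with rfl | hd
      · exact absurd hdu hg₁
      rcases List.mem_cons.1 hd with rfl | hd
      · exact Or.inr rfl
      · exact absurd hdu (hpu d hd).1
    · rcases List.mem_cons.1 hd with e | hd
      · exact Or.inl (by rw [← Dart.rev_rev d, e]; rfl)
      rcases List.mem_cons.1 hd with e | hd
      · exact absurd ((congrArg Dart.snd e).symm.trans hdu) hg₂
      · exact absurd hdu (hpu _ hd).2
  set a := h.perm * revOn C with ha
  set s := SameCycle.setoid a ⊔ SameCycle.setoid (revOff C) with hs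
  have hsa : ∀ d, s d (a d) := fun d => (le_sup_left : _ ≤ s) (setoid_apply_self a d)
  have hsr : ∀ d, s d (revOff C d) := fun d =>
    (le_sup_right : SameCycle.setoid (revOff C) ≤ s) (setoid_apply_self _ d)
  have han : ∀ d, ¬ (d ∈ C ∨ d.rev ∈ C) → a d = M.cw d := fun d hd => by
    rw [ha, Perm.mul_apply, revOn_of_not hd]; rfl
  -- An outside dart lies off the curve, hence on the same side as its clockwise successor.
  have k₁ : s s₁ t₁ := by
    have := hsa s₁
    rwa [han s₁ fun hm => h₁ (hCX _ hm)] at this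
  have k₂ : s s₂ t₂ := by
    have := hsa s₂
    rwa [han s₂ fun hm => h₂ (hCX _ hm)] at this
  -- On the contracted curve `t₁.rev` is followed by the successor of `t₁`, and the clockwise walk
  -- from there meets the curve only on reaching `t₂`.
  have k₃ : s t₁.rev t₂ := by
    obtain ⟨k, hk, hkt, hmin⟩ := h.exists_first (hf₁.trans hf₂.symm)
    have key : ∀ i, i + 1 ≤ k → s t₁.rev (M.cw^[i + 1] t₁) := by
      intro i
      induction i with
      | zero =>
        intro _
        have := hsa t₁.rev
        rwa [ha, Perm.mul_apply, revOn_of_mem (Or.inl (by simp [hC]))] at this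
      | succ i ih =>
        intro hi
        refine s.trans' (ih (by omega)) ?_
        have := hsa (M.cw^[i + 1] t₁)
        rw [han _ fun hm => ?_, ← Function.iterate_succ_apply' M.cw] at this
        · exact this
        rcases hCu _ ((h.iterate_fst _ _).trans hf₁) hm with e | e
        · exact iterate_ne_of_first hkt hmin (by omega) (by omega) e
        · exact hmin _ (by omega) (by omega) e
    have := key (k - 1) (by omega)
    rwa [Nat.sub_add_cancel hk, hkt] at this
  -- The curve touches no outside dart, and it shares with outside darts no vertex except possibly
  -- the poles, which the links in `hc` avoid.
  have k₄ : s s₁ s₂ := by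
    refine hc.rel s (fun x hx => ?_) (fun x hx y hy exy hxA => ?_) h₁ h₂
    · have := hsr x
      rwa [revOff_of_not fun hm => hx (hCX _ hm)] at this
    · refine (le_sup_left : _ ≤ s) (h.sameCycle_of_eq_at (x := x.fst) ?_ rfl exy.symm)
      intro d hd
      refine han d fun hm => hxA ?_
      have := hS.mixed d (hCX d hm) x hx hd
      rw [hd] at this
      simpa using this
  exact J (s.trans' k₃ (s.trans' (s.symm' k₂) (s.trans' (s.symm' k₄) k₁)))

/-- After leaving `X`, the clockwise order runs outside until its next entry. Two exits lead to the
same entry by `hent`. Running back from it, the shorter excursion would start inside the longer one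
unless both have the same length. -/
theorem LabeledMap.IsRotation.exit_unique [Finite (Dart G)] {M : LabeledMap G}
    (h : M.IsRotation) {X : Set (Dart G)}
    (hent : ∀ d ∉ X, ∀ d' ∉ X, d.fst = d'.fst → M.cw d ∈ X → M.cw d' ∈ X → d = d') :
    ∀ d ∈ X, ∀ d' ∈ X, d.fst = d'.fst → M.cw d ∉ X → M.cw d' ∉ X → d = d' := by
  classical
  have key : ∀ d ∈ X, M.cw d ∉ X → ∃ n, 0 < n ∧ M.cw^[n + 1] d ∈ X ∧
      ∀ i, 0 < i → i ≤ n → M.cw^[i] d ∉ X := by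
    intro d hd hd'
    have hex : ∃ n, M.cw^[n + 1] d ∈ X := by
      obtain ⟨k, hk, hkt, -⟩ := h.exists_first (rfl : d.fst = d.fst)
      exact ⟨k - 1, by rwa [Nat.sub_add_cancel hk, hkt]⟩
    refine ⟨Nat.find hex, ?_, Nat.find_spec hex, ?_⟩
    · rcases Nat.eq_zero_or_pos (Nat.find hex) with h0 | h0
      · have := Nat.find_spec hex
        rw [h0] at this
        exact absurd this hd'
      · exact h0
    · intro i h0 hi
      have := Nat.find_min hex (m := i - 1) (by omega)
      rwa [Nat.sub_add_cancel h0] at this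
  have main : ∀ d ∈ X, ∀ d' ∈ X, d.fst = d'.fst → ∀ n n', n ≤ n' →
      (0 < n ∧ M.cw^[n + 1] d ∈ X ∧ ∀ i, 0 < i → i ≤ n → M.cw^[i] d ∉ X) →
      (0 < n' ∧ M.cw^[n' + 1] d' ∈ X ∧ ∀ i, 0 < i → i ≤ n' → M.cw^[i] d' ∉ X) → d = d' := by
    rintro d hd d' hd' e n n' hn ⟨h0, h1, h2⟩ ⟨h0', h1', h2'⟩
    rw [Function.iterate_succ_apply'] at h1 h1'
    have := hent _ (h2 n h0 le_rfl) _ (h2' n' h0' le_rfl)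
      (by rw [h.iterate_fst, h.iterate_fst, e]) h1 h1'
    rw [← Nat.add_sub_cancel' hn, Function.iterate_add_apply] at this
    have h3 := h.bijective.1.iterate n this
    rcases Nat.eq_zero_or_pos (n' - n) with h4 | h4
    · rwa [h4] at h3
    · rw [h3] at hd
      exact absurd hd (h2' _ h4 (by omega))
  intro d hd d' hd' e h1 h2
  obtain ⟨n, hn⟩ := key d hd h1
  obtain ⟨n', hn'⟩ := key d' hd' h2
  rcases le_total n n' with hle | hle
  · exact main d hd d' hd' e n n' hle hn hn'
  · exact (main d' hd' d hd e.symm n' n hle hn' hn).symm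

/-- Being a block is symmetric in `X` and its complement, so it does not matter which of the two is
connected off the poles. -/
theorem LabeledMap.IsPlanar.isBlock [Finite (Dart G)] {M : LabeledMap G} (h : M.IsPlanar)
    (hbi : Biconnected G) (hl : ∀ d : Dart G, d.fst ≠ d.snd) {X : Set (Dart G)} {u v : V}
    (hS : Sep X u v) : M.IsBlock X := by
  have key : ∀ {X : Set (Dart G)}, Sep X u v → ConnAvoid Xᶜ {u, v} → M.IsBlock X := by
    intro X hS hc
    have hent : ∀ d ∉ X, ∀ d' ∉ X, d.fst = d'.fst → M.cw d ∈ X → M.cw d' ∈ X → d = d' :=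
      fun d hd d' hd' e h1 h2 => h.entry_unique hbi hl hS hc hd hd' e h1 h2
    exact ⟨h.exit_unique hent, hent⟩
  rcases hS.conn with hc | hc
  · have := (key hS.compl (by rwa [compl_compl])).compl
    rwa [compl_compl] at this
  · exact key hS hc

/-- The two corners between a component and the rest at a pole are in different faces. -/
theorem LabeledMap.IsPlanar.not_sameCycle_face [Finite (Dart G)] {M : LabeledMap G}
    (h : M.IsPlanar) (hbi : Biconnected G) (hl : ∀ d : Dart G, d.fst ≠ d.snd) {X : Set (Dart G)}
    {u v : V} (hS : Sep X u v) {c x : Dart G} (hc : c ∉ X) (hx : x ∈ X) (hcu : c.fst = u)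
    (hxu : x.fst = u) : ¬ SameCycle h.facePerm c.rev x.rev := by
  classical
  have := Fintype.ofFinite (Dart G)
  -- Multiplying by the transposition of `c` and `x` splits the pole `u` into two vertices. If both
  -- corners were in one face, that face would split as well. The map stays connected because
  -- deleting `u` does not disconnect the graph, so there are too many vertices and faces for
  -- Euler's inequality.
  intro hsc
  have hne : c ≠ x := fun e => hc (e ▸ hx)
  have hne' : c.rev ≠ x.rev := fun e => hne (by rw [← Dart.rev_rev c, e]; rfl)
  have hmul : h.perm * swap c x * revPerm = h.facePerm * swap c.rev x.rev := by
    ext1 d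
    simp only [Perm.mul_apply, revPerm_apply, LabeledMap.IsRotation.facePerm]
    congr 1
    rcases eq_or_ne d c.rev with rfl | h1
    · simp
    rcases eq_or_ne d x.rev with rfl | h2
    · simp
    rw [swap_apply_of_ne_of_ne h1 h2, swap_apply_of_ne_of_ne]
    · intro e; exact h1 (by rw [← e]; rfl)
    · intro e; exact h2 (by rw [← e]; rfl)
  have n₁ := numClasses_mul_swap_of_sameCycle hne
    ((h.sameCycle_perm_iff c x).2 (hcu.trans hxu.symm))
  have n₂ := numClasses_mul_swap_of_sameCycle hne' hsc
  have E := euler_le (h.perm * swap c x) revPerm (fun _ => rfl)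
  rw [hmul] at E
  have hsupp : (revPerm : Perm (Dart G)).support.card = Nat.card (Dart G) := by
    rw [Nat.card_eq_fintype_card, ← Finset.card_univ]
    congr 1
    ext d
    simp only [mem_support, revPerm_apply, Finset.mem_univ, iff_true]
    exact fun e => hl d (by conv_lhs => rw [← e, Dart.rev_fst])
  have htop : SameCycle.setoid (h.perm * swap c x) ⊔ SameCycle.setoid revPerm = ⊤ := by
    set s := SameCycle.setoid (h.perm * swap c x) ⊔ SameCycle.setoid revPerm with hs
    have hbv : v ∈ G.vertexSet := by obtain ⟨b, -, hb⟩ := hS.right_in; exact hb ▸ b.fst_mem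
    have huv : u ∈ G.vertexSet := hcu ▸ c.fst_mem
    have hcon : ConnAvoid (Set.univ : Set (Dart G)) {u} := by
      refine connAvoid_of_reach (w := v) (fun _ _ => Set.mem_univ _) (by simpa using hS.ne.symm) ?_
      have key : ∀ d : Dart G, d.fst ≠ u → d.fst ∉ ({u} : Set V) ∧
          Reach (Set.univ : Set (Dart G)) {u} d.fst v := fun d hd =>
        ⟨by simpa using hd, reach_of_biconnected hbi (fun _ _ => Set.mem_univ _) hS.ne.symm huv hbv
          (fun d _ d' hd' => absurd (Set.mem_univ _) hd') (Set.mem_univ _) hd⟩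
      intro d _
      by_cases hd : d.fst = u
      · exact ⟨d.snd, Or.inr rfl, key d.rev fun e => hl d (hd.trans e.symm)⟩
      · exact ⟨d.fst, Or.inl rfl, key d hd⟩
    rw [eq_top_iff]
    rintro x' y' -
    refine hcon.rel s (fun p _ => ?_) (fun p _ q _ e hA => ?_) trivial trivial
    · exact (le_sup_right : SameCycle.setoid revPerm ≤ s) (setoid_apply_self revPerm p)
    · refine (le_sup_left : _ ≤ s) (h.sameCycle_of_eq_at (x := p.fst) ?_ rfl e.symm)
      intro d hd
      rw [Perm.mul_apply, swap_apply_of_ne_of_ne]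
      · rfl
      · rintro rfl; exact hA (by rw [← hd, hcu]; rfl)
      · rintro rfl; exact hA (by rw [← hd, hxu]; rfl)
  have h8 := one_le_of_top htop
  have h9 := h.euler
  omega

end Blocks

end SPOrtho

namespace SPOrtho

/-! ### Walking along the left side of a path -/

section Trace

open Equiv Equiv.Perm

variable {V E : Type*} {G : Graph V E}

/-- The boundary of a component between its two poles. -/
theorem LabeledMap.IsPlanar.exists_boundary [Finite (Dart G)] {M : LabeledMap G}
    (h : M.IsPlanar) (hbi : Biconnected G) (hl : ∀ d : Dart G, d.fst ≠ d.snd) {X : Set (Dart G)}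
    {u v : V} (hS : Sep X u v) {c y : Dart G} (hc : c ∉ X) (hcu : c.fst = u) (hcX : M.cw c ∈ X)
    (hy : y ∈ X) (hyv : y.fst = v) (hyX : M.cw y ∉ X) :
    ∃ n, (∀ i ≤ n, M.faceNext^[i] (M.cw c) ∈ X) ∧ M.faceNext^[n] (M.cw c) = y.rev := by
  classical
  have hB := h.isBlock hbi hl hS
  have hcoe : ⇑h.facePerm = M.faceNext := rfl
  have hcr : c.rev ∉ X := fun hm => hc (hS.rev_mem _ hm)
  have hx : h.facePerm c.rev = M.cw c := rfl
  have hsc : ∀ n, SameCycle h.facePerm c.rev (M.faceNext^[n] (M.cw c)) := by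
    intro n
    rw [sameCycle_iff_iterate]
    exact ⟨n + 1, by rw [Function.iterate_succ_apply, hx, hcoe]⟩
  -- The face has to come back to `c.rev`, which is outside `X`, so it leaves `X` at some time.
  have hex : ∃ n, M.faceNext^[n + 1] (M.cw c) ∉ X := by
    obtain ⟨n, hn⟩ := (sameCycle_iff_iterate h.facePerm (M.cw c) c.rev).1 (hsc 0).symm
    rcases n with _ | n
    · exact absurd (hn ▸ hcX) hcr
    · exact ⟨n, by rw [← hcoe, hn]; exact hcr⟩
  refine ⟨Nat.find hex, ?_, ?_⟩
  · intro i hi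
    rcases i with _ | i
    · exact hcX
    · exact not_not.1 (Nat.find_min hex (m := i) (by omega))
  · have h1 := Nat.find_spec hex
    have h2 : M.faceNext^[Nat.find hex] (M.cw c) ∈ X := by
      rcases hn : Nat.find hex with _ | i
      · exact hcX
      · exact not_not.1 (Nat.find_min hex (m := i) (by omega))
    have h3 := hsc (Nat.find hex)
    rw [Function.iterate_succ_apply'] at h1
    set z := M.faceNext^[Nat.find hex] (M.cw c) with hz
    have h4 := hS.rev_mem z h2
    -- The face leaves `X` at a pole. It cannot be `u`, whose corners lie in different faces; at `v`
    -- the exit of the block is unique.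
    rcases hS.mixed z.rev h4 _ h1 (h.fst z.rev).symm with e | e
    · exact absurd h3 (h.not_sameCycle_face hbi hl hS hc h4 hcu e)
    · rw [← hB.exit z.rev h4 y hy (e.trans hyv.symm) h1 hyX]
      rfl

theorem IsPath.snd_inj {u v : V} {p : List (Dart G)} (h : IsPath u p v) {d d' : Dart G}
    (hd : d ∈ p) (hd' : d' ∈ p) (e : d.snd = d'.snd) : d = d' :=
  List.inj_on_of_nodup_map (List.nodup_cons.1 h.2).2 hd hd' e

theorem IsPath.fst_inj {u v : V} {p : List (Dart G)} (h : IsPath u p v) {d d' : Dart G}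
    (hd : d ∈ p) (hd' : d' ∈ p) (e : d.fst = d'.fst) : d = d' := by
  induction p generalizing u with
  | nil => simp at hd
  | cons a p ih =>
    rcases List.mem_cons.1 hd with h1 | h1 <;> rcases List.mem_cons.1 hd' with h2 | h2
    · rw [h1, h2]
    · rw [h1] at e
      exact absurd (e.symm.trans h.1.1) (h.source_ne_of_mem_tail h2).1
    · rw [h2] at e
      exact absurd (e.trans h.1.1) (h.source_ne_of_mem_tail h1).1
    · exact ih h.tail h1 h2

theorem IsPath.snd_ne_source {u v : V} {p : List (Dart G)} (h : IsPath u p v) {d : Dart G}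
    (hd : d ∈ p) : d.snd ≠ u := fun e =>
  (List.nodup_cons.1 h.2).1 (e ▸ List.mem_map_of_mem hd)

theorem IsPath.fst_ne_target {u v : V} {p : List (Dart G)} (h : IsPath u p v) {d : Dart G}
    (hd : d ∈ p) : d.fst ≠ v := by
  induction p generalizing u with
  | nil => simp at hd
  | cons a p ih =>
    rcases List.mem_cons.1 hd with rfl | hd
    · intro e
      have := (List.nodup_cons.1 h.2).1
      rw [← h.1.1, e] at this
      exact this h.1.2.target_mem
    · exact ih h.tail hd

theorem LabeledMap.sweep_eq {M : LabeledMap G} {s t : Dart G} {K : ℕ} (hK : 0 < K)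
    (hKt : M.cw^[K] s = t) (hmin : ∀ i, 0 < i → i < K → M.cw^[i] s ≠ t) :
    M.sweep s t = ∑ i ∈ Finset.range K, M.angle (M.cw^[i] s) := by
  have : sInf {k : ℕ | 0 < k ∧ M.cw^[k] s = t} = K := by
    refine le_antisymm (Nat.sInf_le ⟨hK, hKt⟩) ?_
    by_contra hlt
    push Not at hlt
    have := Nat.sInf_mem (⟨K, hK, hKt⟩ : {k : ℕ | 0 < k ∧ M.cw^[k] s = t}.Nonempty)
    exact hmin _ this.1 hlt this.2
  rw [sweep, this]

theorem LabeledMap.vertexTurns_cons_cons (M : LabeledMap G) (d d' : Dart G) (p : List (Dart G)) :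
    M.vertexTurns (d :: d' :: p) = M.turn d d' + M.vertexTurns (d' :: p) := rfl

section

variable [Finite (Dart G)] {M : LabeledMap G} (h : M.IsRotation)

/-- On the contracted path `P`, the cycle runs from `s` to `t` as it does around their vertex. -/
theorem LabeledMap.IsRotation.trace_segment {P : List (Dart G)} {s t : Dart G} {K : ℕ}
    (hK : 0 < K) (hKt : M.cw^[K] s = t) (hmin : ∀ i, 0 < i → i < K → M.cw^[i] s ≠ t)
    (hno : ∀ i, 0 < i → i < K → ¬ (M.cw^[i] s ∈ P ∨ (M.cw^[i] s).rev ∈ P)) :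
    (∀ i, 0 < i → i ≤ K → (h.perm * revOn P)^[i] (revOn P s) = M.cw^[i] s) ∧
    ∑ i ∈ Finset.range K, (M.angle (revOn P ((h.perm * revOn P)^[i] (revOn P s))) : ℤ) =
      M.sweep s t := by
  have h1 : ∀ i, 0 < i → i ≤ K → (h.perm * revOn P)^[i] (revOn P s) = M.cw^[i] s := by
    intro i h0 hi
    induction i with
    | zero => omega
    | succ i ih =>
      rw [Function.iterate_succ_apply', Function.iterate_succ_apply']
      rcases Nat.eq_zero_or_pos i with rfl | hi0
      · simp only [Function.iterate_zero, id, Perm.mul_apply, revOn_revOn]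
        rfl
      · rw [ih hi0 (by omega), Perm.mul_apply, revOn_of_not (hno i hi0 (by omega))]
        rfl
  refine ⟨h1, ?_⟩
  rw [LabeledMap.sweep_eq hK hKt hmin]
  rw [Nat.cast_sum]
  refine Finset.sum_congr rfl fun i hi => ?_
  rcases Nat.eq_zero_or_pos i with rfl | hi0
  · simp [revOn_revOn]
  · rw [h1 i hi0 (Finset.mem_range.1 hi).le, revOn_of_not (hno i hi0 (Finset.mem_range.1 hi))]

/-- The cycle of the contracted path `P` runs from `s` along the left side of `q` to `o`, where
`m` is the sum of the angles met. -/
structure LabeledMap.IsRotation.TraceTo (X : Set (Dart G)) (P : List (Dart G)) (s : Dart G)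
    (q : List (Dart G)) (o : Dart G) (m : ℤ) (N : ℕ) : Prop where
  pos : 0 < N
  last : (h.perm * revOn P)^[N] (revOn P s) = o
  inner : ∀ i, 0 < i → i < N → (h.perm * revOn P)^[i] (revOn P s) ∈ X ∧
    ((h.perm * revOn P)^[i] (revOn P s)).rev ∉ P
  mem : ∀ d ∈ q, ∃ i, 0 < i ∧ i < N ∧ (h.perm * revOn P)^[i] (revOn P s) = d
  sum : ∑ i ∈ Finset.range N, (M.angle (revOn P ((h.perm * revOn P)^[i] (revOn P s))) : ℤ) = m

/-- One vertex of the trace. The condition `hno` speaks only of times at which the rotation has met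
neither `o` nor again `s`, so that it can be checked without knowing the number of steps. -/
theorem LabeledMap.IsRotation.traceTo_nil {X : Set (Dart G)} {P : List (Dart G)} {s o : Dart G}
    (hso : s.fst = o.fst)
    (hno : ∀ i, 0 < i → (∀ j, 0 < j → j ≤ i → M.cw^[j] s ≠ o ∧ M.cw^[j] s ≠ s) →
      M.cw^[i] s ∈ X ∧ ¬ (M.cw^[i] s ∈ P ∨ (M.cw^[i] s).rev ∈ P)) :
    ∃ N, h.TraceTo X P s [] o (M.sweep s o) N := by
  obtain ⟨K, hK, hKt, hmin⟩ := h.exists_first hso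
  have hno' : ∀ i, 0 < i → i < K → M.cw^[i] s ∈ X ∧ ¬ (M.cw^[i] s ∈ P ∨ (M.cw^[i] s).rev ∈ P) :=
    fun i h0 hi => hno i h0 fun j h1 h2 =>
      ⟨hmin j h1 (by omega), iterate_ne_of_first hKt hmin h1 (by omega)⟩
  obtain ⟨h1, h2⟩ := h.trace_segment hK hKt hmin fun i h0 hi => (hno' i h0 hi).2
  refine ⟨K, hK, by rw [h1 K hK le_rfl, hKt], ?_, by simp, h2⟩
  intro i h0 hi
  rw [h1 i h0 hi.le]
  exact ⟨(hno' i h0 hi).1, fun hm => (hno' i h0 hi).2 (Or.inr hm)⟩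

theorem LabeledMap.IsRotation.TraceTo.cons {X : Set (Dart G)} {P : List (Dart G)} {s d o : Dart G}
    {q : List (Dart G)} {m m' : ℤ} {N N' : ℕ} (h₁ : h.TraceTo X P s [] d m N)
    (h₂ : h.TraceTo X P d.rev q o m' N') (hdP : d ∈ P) (hdP' : d.rev ∉ P) (hdX : d ∈ X) :
    h.TraceTo X P s (d :: q) o (m + m') (N + N') := by
  -- On the contracted path the cycle jumps from `d` to the successor of `d.rev`, which is where the
  -- trace at the next vertex begins.
  have hd : revOn P d.rev = d := by rw [revOn_of_mem (Or.inr hdP)]; rfl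
  have key : ∀ i, (h.perm * revOn P)^[N + i] (revOn P s) =
      (h.perm * revOn P)^[i] (revOn P d.rev) := by
    intro i
    rw [add_comm, Function.iterate_add_apply, h₁.last, hd]
  have hpos := h₂.pos
  have hpos' := h₁.pos
  refine ⟨by omega, by rw [key, h₂.last], ?_, ?_, ?_⟩
  · intro i h0 hi
    rcases lt_trichotomy i N with hlt | rfl | hgt
    · exact h₁.inner i h0 hlt
    · rw [h₁.last]; exact ⟨hdX, hdP'⟩
    · rw [show i = N + (i - N) by omega, key]
      exact h₂.inner _ (by omega) (by omega)
  · intro x hx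
    rcases List.mem_cons.1 hx with rfl | hx
    · exact ⟨N, h₁.pos, by omega, h₁.last⟩
    · obtain ⟨i, h3, h4, h5⟩ := h₂.mem x hx
      exact ⟨N + i, by omega, by omega, by rw [key, h5]⟩
  · rw [Finset.sum_range_add, h₁.sum]
    congr 1
    rw [← h₂.sum]
    exact Finset.sum_congr rfl fun i _ => by rw [key]

/-- Walking along the left side of a final segment of a path in a component. -/
theorem LabeledMap.IsRotation.exists_trace_suffix {X : Set (Dart G)} {u v : V} (hS : Sep X u v)
    (hB : M.IsBlock X) {P : List (Dart G)} (hP : IsPath u P v) (hPX : ∀ d ∈ P, d ∈ X) {y : Dart G}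
    (hy : y ∈ X) (hyv : y.fst = v) (hyX : M.cw y ∉ X) (q : List (Dart G)) (d : Dart G)
    (hd : d ∈ P) (hq : IsPath d.snd q v) (hqP : ∀ x ∈ q, x ∈ P) :
    ∃ N, h.TraceTo X P d.rev q (M.cw y)
      (M.vertexTurns (d :: q ++ [M.cw y]) + 2 * (q.length + 1)) N := by
  induction q generalizing d with
  | nil =>
    have hdv : d.snd = v := hq.1
    obtain ⟨N, hN⟩ := h.traceTo_nil (X := X) (P := P) (s := d.rev) (o := M.cw y)
      (by rw [h.fst, hyv]; exact hdv) (by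
        intro i h0 hi
        have hfst : (M.cw^[i] d.rev).fst = v := (h.iterate_fst _ _).trans hdv
        have hX : ∀ j ≤ i, M.cw^[j] d.rev ∈ X := by
          intro j
          induction j with
          | zero => exact fun _ => hS.rev_mem _ (hPX d hd)
          | succ j ih =>
            intro hj
            by_contra hcon
            have h1 := ih (by omega)
            rw [Function.iterate_succ_apply'] at hcon
            have h2 := hB.exit _ h1 y hy (by rw [h.iterate_fst, hyv]; exact hdv) hcon hyX
            exact (hi (j + 1) (by omega) hj).1 (by rw [Function.iterate_succ_apply', h2])
        refine ⟨hX i le_rfl, ?_⟩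
        rintro (hm | hm)
        · exact hP.fst_ne_target hm hfst
        · refine (hi i h0 le_rfl).2 ?_
          have e := hP.snd_inj hm hd (hfst.trans hdv.symm)
          rw [← Dart.rev_rev (M.cw^[i] d.rev), e])
    refine ⟨N, ?_⟩
    -- A sweep exceeds the corresponding turn by 2. Over the `q.length + 1` vertices visited, this
    -- gives the constant term.
    convert hN using 1
    simp only [List.singleton_append, LabeledMap.vertexTurns, LabeledMap.turn, List.length_nil]
    push_cast
    ring
  | cons x q ih =>
    have hxd : x.fst = d.snd := hq.1.1
    have hxP := hqP x (by simp)
    obtain ⟨N', hN'⟩ := ih x hxP hq.tail (fun z hz => hqP z (by simp [hz]))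
    have hdu : d.snd ≠ u := hP.snd_ne_source hd
    have hdv : d.snd ≠ v := by rw [← hxd]; exact hP.fst_ne_target hxP
    obtain ⟨N, hN⟩ := h.traceTo_nil (X := X) (P := P) (s := d.rev) (o := x) hxd.symm (by
        intro i h0 hi
        have hfst : (M.cw^[i] d.rev).fst = d.snd := h.iterate_fst _ _
        constructor
        · by_contra hcon
          rcases hS.mixed d.rev (hS.rev_mem _ (hPX d hd)) _ hcon hfst.symm with e | e
          · exact hdu e
          · exact hdv e
        · rintro (hm | hm)
          · exact (hi i h0 le_rfl).1 (hP.fst_inj hm hxP (hfst.trans hxd.symm))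
          · refine (hi i h0 le_rfl).2 ?_
            have e := hP.snd_inj hm hd hfst
            rw [← Dart.rev_rev (M.cw^[i] d.rev), e])
    refine ⟨N + N', ?_⟩
    convert hN.cons h hN' hxP (hP.rev_notMem x hxP) (hPX x hxP) using 1
    simp only [List.cons_append, LabeledMap.vertexTurns_cons_cons, LabeledMap.turn,
      List.length_cons]
    push_cast
    ring

/-- Walking along the left side of a path through a component. -/
theorem LabeledMap.IsRotation.exists_trace {X : Set (Dart G)} {u v : V} (hS : Sep X u v)
    (hB : M.IsBlock X) {P : List (Dart G)} (hP : IsPath u P v) (hPX : ∀ d ∈ P, d ∈ X)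
    {c y : Dart G} (hc : c ∉ X) (hcu : c.fst = u) (hcX : M.cw c ∈ X)
    (hy : y ∈ X) (hyv : y.fst = v) (hyX : M.cw y ∉ X) :
    ∃ N, h.TraceTo X P c P (M.cw y)
      (M.vertexTurns (c.rev :: P ++ [M.cw y]) + 2 * (P.length + 1)) N := by
  have key : ∀ q, IsPath u q v → q ≠ [] → (∀ x ∈ q, x ∈ P) → ∃ N, h.TraceTo X P c q (M.cw y)
      (M.vertexTurns (c.rev :: q ++ [M.cw y]) + 2 * (q.length + 1)) N := by
    intro q hq hq0 hqP
    obtain ⟨x, q, rfl⟩ := List.exists_cons_of_ne_nil hq0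
    have hxu : x.fst = u := hq.1.1
    have hxP := hqP x (by simp)
    obtain ⟨N', hN'⟩ := h.exists_trace_suffix hS hB hP hPX hy hyv hyX q x hxP hq.tail
      (fun z hz => hqP z (by simp [hz]))
    obtain ⟨N, hN⟩ := h.traceTo_nil (X := X) (P := P) (s := c) (o := x) (hcu.trans hxu.symm) (by
        intro i h0 hi
        have hfst : (M.cw^[i] c).fst = u := (h.iterate_fst _ _).trans hcu
        constructor
        -- If the rotation from `c` left `X` before reaching `x`, it would have to enter again,
        -- through the only entry `c`, and would have gone all the way round.
        · obtain ⟨K, hK, hKt, hmin⟩ := h.exists_first (hcu.trans hxu.symm)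
          have hiK : i < K := by
            by_contra hcon
            exact (hi K hK (by omega)).1 hKt
          by_contra hcon
          have hout : ∀ j, i + j < K → M.cw^[i + j] c ∉ X := by
            intro j
            induction j with
            | zero => exact fun _ => hcon
            | succ j ih =>
              intro hj hm
              have h1 := ih (by omega)
              rw [← add_assoc, Function.iterate_succ_apply'] at hm
              have h2 := hB.entry _ h1 c hc (h.iterate_fst _ _) hm hcX
              exact iterate_ne_of_first hKt hmin (by omega) (by omega) h2
          have h1 := hout (K - 1 - i) (by omega)
          rw [show i + (K - 1 - i) = K - 1 by omega] at h1
          have h2 : M.cw (M.cw^[K - 1] c) = x := by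
            rw [← Function.iterate_succ_apply' M.cw, Nat.succ_eq_add_one, Nat.sub_add_cancel hK,
              hKt]
          have h3 := hB.entry _ h1 c hc (h.iterate_fst _ _) (by rw [h2]; exact hPX x hxP) hcX
          exact iterate_ne_of_first hKt hmin (i := K - 1) (by omega) (by omega) h3
        · rintro (hm | hm)
          · exact (hi i h0 le_rfl).1 (hP.fst_inj hm hxP (hfst.trans hxu.symm))
          · exact hP.snd_ne_source hm hfst)
    refine ⟨N + N', ?_⟩
    convert hN.cons h hN' hxP (hP.rev_notMem x hxP) (hPX x hxP) using 1
    simp only [List.cons_append, LabeledMap.vertexTurns_cons_cons, LabeledMap.turn,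
      List.length_cons, Dart.rev_rev]
    push_cast
    ring
  refine key P hP ?_ fun _ hx => hx
  rintro rfl
  exact hS.ne hP.1

end

end Trace

end SPOrtho

namespace SPOrtho

/-! ### The turns along a path through a component -/

section Cut

open Equiv Equiv.Perm

open Classical in
/-- Multiplication with the transposition of `c` and `e` cuts off the part of a cycle after `c` up
to `e`. -/
theorem cut_cycle {α : Type*} [Fintype α] {a : Perm α} {c e : α} {X : Set α} {N : ℕ}
    (hN : a^[N + 1] c = e) (hX : ∀ i, 0 < i → i ≤ N + 1 → a^[i] c ∈ X) (hc : c ∉ X)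
    (he : a e ∉ X) :
    SameCycle a c e ∧ c ≠ e ∧ SameCycle (a * swap c e) (a c) e ∧
    (∀ z, SameCycle (a * swap c e) (a c) z → ∃ i, i ≤ N ∧ a^[i + 1] c = z) ∧
    (∀ i, i ≤ N → SameCycle (a * swap c e) (a c) (a^[i + 1] c)) ∧
    ∀ g : α → ℤ, ∑ y with SameCycle.setoid (a * swap c e) (a c) y, g y =
      ∑ i ∈ Finset.range (N + 1), g (a^[i + 1] c) := by
  have hce : c ≠ e := by
    rintro rfl
    exact hc (hN ▸ hX (N + 1) (by omega) le_rfl)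
  have hit : ∀ i, i ≤ N → (a * swap c e)^[i] (a c) = a^[i + 1] c := by
    intro i
    induction i with
    | zero => exact fun _ => rfl
    | succ i ih =>
      intro hi
      rw [Function.iterate_succ_apply', ih (by omega), Perm.mul_apply, swap_apply_of_ne_of_ne,
        Function.iterate_succ_apply' a (i + 1)]
      · exact fun h => hc (h ▸ hX (i + 1) (by omega) (by omega))
      · intro h
        refine he ?_
        rw [← h, ← Function.iterate_succ_apply' a]
        exact hX _ (by omega) (by omega)
  have hret : (a * swap c e)^[N + 1] (a c) = a c := by
    rw [Function.iterate_succ_apply', hit N le_rfl, hN, Perm.mul_apply, swap_apply_right]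
  have hne : ∀ i, 0 < i → i < N + 1 → (a * swap c e)^[i] (a c) ≠ a c := by
    intro i h0 hi h
    rw [hit i (by omega), Function.iterate_succ_apply'] at h
    exact hc (a.injective h ▸ hX i h0 (by omega))
  have hsc : ∀ i, i ≤ N → SameCycle (a * swap c e) (a c) (a^[i + 1] c) := fun i hi =>
    (sameCycle_iff_iterate _ _ _).2 ⟨i, hit i hi⟩
  refine ⟨(sameCycle_iff_iterate _ _ _).2 ⟨N + 1, hN⟩, hce, hN ▸ hsc N le_rfl, ?_, hsc, ?_⟩
  · intro z hz
    obtain ⟨i, hi, rfl⟩ : z ∈ (fun i => (a * swap c e)^[i] (a c)) '' (Finset.range (N + 1)) := by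
      rw [← (orbit_eq_image N.succ_pos hret hne).2]
      exact (sameCycle_iff_iterate _ _ _).1 hz
    have hi : i < N + 1 := by simpa using hi
    exact ⟨i, by omega, (hit i (by omega)).symm⟩
  · intro g
    rw [sum_sameCycle_eq N.succ_pos hret hne]
    exact Finset.sum_congr rfl fun i hi => by
      rw [hit i (by have := Finset.mem_range.1 hi; omega)]

variable {V E : Type*} {G : Graph V E}

/-- Right turns minus left turns at the bends of an edge. -/
def LabeledMap.bendTurn (M : LabeledMap G) (d : Dart G) : ℤ :=
  ((M.bends d).count 3 : ℤ) - (M.bends d).count 1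

/-- The contribution of a dart to the rotation of the face on its left. -/
def LabeledMap.weight (M : LabeledMap G) (d : Dart G) : ℤ :=
  (M.angle d.rev : ℤ) - 2 + M.bendTurn d

theorem revOn_revOff (p : List (Dart G)) (d : Dart G) : revOn p (revOff p d) = d.rev := by
  rw [revOff, Perm.mul_apply, revPerm_apply, revOn_rev, revOn_revOn]

theorem revOff_revOn (p : List (Dart G)) (d : Dart G) : revOff p (revOn p d) = d.rev := by
  rw [revOff, Perm.mul_apply, revOn_revOn, revPerm_apply]

theorem sum_eq_zero_of_antisymm {L : Finset (Dart G)} {f : Dart G → ℤ}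
    (hL : ∀ d ∈ L, d.rev ∈ L) (hf : ∀ d, f d.rev = - f d) : ∑ d ∈ L, f d = 0 := by
  have : ∑ d ∈ L, f d = ∑ d ∈ L, f d.rev :=
    Finset.sum_nbij' Dart.rev Dart.rev hL hL (fun d _ => d.rev_rev) (fun d _ => d.rev_rev)
      (fun d _ => by rw [Dart.rev_rev])
  simp only [hf, Finset.sum_neg_distrib] at this
  omega

/-- The sum of the weights of one side of a path. -/
theorem sum_weight_side [Fintype (Dart G)] [DecidableEq (Dart G)] (M : LabeledMap G)
    (hl : ∀ d : Dart G, d.fst ≠ d.snd)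
    (hb : ∀ d, M.bendTurn d.rev = - M.bendTurn d) {P : List (Dart G)} (hP : P.Nodup)
    {L : Finset (Dart G)} (hL : ∀ d ∈ L, revOff P d ∈ L) (hPL : ∀ d ∈ P, d ∈ L)
    (hPL' : ∀ d ∈ P, d.rev ∉ L) :
    ∑ d ∈ L, M.weight d = ∑ d ∈ L, (M.angle (revOn P d) : ℤ) + M.bendTurns P -
      2 * (({x | x ∈ L ∧ revOff P x ≠ x}.ncard : ℤ) + P.length) := by
  -- Weights read the angle at `d.rev`. Reindexing by `revOff P`, which preserves `L`, turns this
  -- into the angle that belongs to `d` on the contracted path.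
  have h1 : ∑ d ∈ L, (M.angle d.rev : ℤ) = ∑ d ∈ L, (M.angle (revOn P d) : ℤ) :=
    Finset.sum_nbij' (revOff P) (revOff P) hL hL (fun d _ => revOff_revOff P d)
      (fun d _ => revOff_revOff P d) (fun d _ => by rw [revOn_revOff])
  have hsub : P.toFinset ⊆ L := fun d hd => hPL d (List.mem_toFinset.1 hd)
  have hcl : ∀ d ∈ L \ P.toFinset, ¬ (d ∈ P ∨ d.rev ∈ P) := by
    intro d hd
    rw [Finset.mem_sdiff, List.mem_toFinset] at hd
    rintro (h | h)
    · exact hd.2 h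
    · exact hPL' _ h (by rw [Dart.rev_rev]; exact hd.1)
  -- Off the path both darts of an edge are in `L` and their bends cancel. On the path only the
  -- forward dart is in `L`.
  have h2 : ∑ d ∈ L, M.bendTurn d = M.bendTurns P := by
    rw [← Finset.sum_sdiff hsub, sum_eq_zero_of_antisymm _ hb, zero_add,
      List.sum_toFinset _ hP]
    · rfl
    · intro d hd
      have h := hcl d hd
      rw [Finset.mem_sdiff, List.mem_toFinset] at hd ⊢
      refine ⟨?_, fun h' => h (Or.inr h')⟩
      rw [← revOff_of_not h]
      exact hL d hd.1
  have h3 : {x | x ∈ L ∧ revOff P x ≠ x}.ncard + P.length = L.card := by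
    have : {x | x ∈ L ∧ revOff P x ≠ x} = ↑(L \ P.toFinset) := by
      ext d
      rw [Finset.mem_coe, Finset.mem_sdiff, List.mem_toFinset, Set.mem_ofPred_eq]
      refine and_congr_right fun hd => ?_
      constructor
      · exact fun h h' => h (revOff_of_mem (Or.inl h'))
      · intro h h'
        rw [revOff_of_not (hcl d (Finset.mem_sdiff.2 ⟨hd, by simpa using h⟩))] at h'
        exact hl d (congrArg Dart.snd h')
    rw [this, Set.ncard_coe_finset, ← List.toFinset_card_of_nodup hP,
      Finset.card_sdiff_add_card_eq_card hsub]
  rw [← Nat.cast_add, h3]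
  simp only [LabeledMap.weight, Finset.sum_add_distrib, Finset.sum_sub_distrib, h1, h2,
    Finset.sum_const]
  rw [nsmul_eq_mul]
  ring

/-- The turns along a path through a component, in terms of the boundary of the component on the
left of the path. -/
theorem LabeledMap.IsPlanar.spineTurns_eq [Finite (Dart G)] {M : LabeledMap G} (h : M.IsPlanar)
    (hbi : Biconnected G) (hl : ∀ d : Dart G, d.fst ≠ d.snd) {X : Set (Dart G)} {u v : V}
    (hS : Sep X u v) {P : List (Dart G)} (hP : IsPath u P v) (hPX : ∀ d ∈ P, d ∈ X)
    {c y : Dart G} (hc : c ∉ X) (hcu : c.fst = u) (hcX : M.cw c ∈ X)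
    (hy : y ∈ X) (hyv : y.fst = v) (hyX : M.cw y ∉ X)
    (hb : ∀ d, M.bendTurn d.rev = - M.bendTurn d)
    (hvs : ∀ d : Dart G, ∑ᶠ x ∈ {x : Dart G | d.fst = x.fst}, (M.angle x : ℤ) = 4)
    (hfs : ∀ d, (∀ n, M.faceNext^[n] d ∈ X) → ∑ᶠ x ∈ M.face d, M.weight x = -4)
    {n : ℕ} (hn : ∀ i ≤ n, M.faceNext^[i] (M.cw c) ∈ X) (hny : M.faceNext^[n] (M.cw c) = y.rev) :
    M.spineTurns (some c) P (some (M.cw y)) =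
      M.angle c - 2 + ∑ i ∈ Finset.range (n + 1), M.weight (M.faceNext^[i] (M.cw c)) := by
  classical
  have := Fintype.ofFinite (Dart G)
  set a := h.perm * revOn P with ha
  set r := revOff P with hr
  set e := revOn P y with he
  set x := M.cw c with hx
  have hrX : ∀ d, d ∈ X → r d ∈ X := by
    intro d hd
    by_cases hm : d ∈ P ∨ d.rev ∈ P
    · rwa [hr, revOff_of_mem hm]
    · rw [hr, revOff_of_not hm]; exact hS.rev_mem d hd
  have hcP : ¬ (c ∈ P ∨ c.rev ∈ P) := by
    rintro (hm | hm)
    · exact hc (hPX _ hm)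
    · exact hc (c.rev_rev ▸ hS.rev_mem _ (hPX _ hm))
  have hcc : revOn P c = c := revOn_of_not hcP
  have hac : a c = x := by rw [ha, Perm.mul_apply, hcc]; rfl
  have hae : a e = M.cw y := by rw [ha, Perm.mul_apply, he, revOn_revOn]; rfl
  have heX : e ∈ X := by
    by_cases hm : y ∈ P ∨ y.rev ∈ P
    · rw [he, revOn_of_mem hm]; exact hS.rev_mem y hy
    · rwa [he, revOn_of_not hm]
  have hrc : r c = c.rev := revOff_of_not hcP
  have hre : r e = y.rev := revOff_revOn P y
  -- the two cycles
  obtain ⟨N, hN⟩ := h.toIsRotation.exists_trace hS (h.isBlock hbi hl hS) hP hPX hc hcu hcX hy hyv hyX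
  obtain ⟨K, rfl⟩ : ∃ K, N = K + 2 := by
    rcases N with _ | _ | K
    · exact absurd hN.pos (lt_irrefl 0)
    · have := hN.last
      rw [hcc] at this
      have : c = e := a.injective (this.trans hae.symm)
      exact absurd (this ▸ heX) hc
    · exact ⟨K, rfl⟩
  have hNe : a^[K + 1] c = e := by
    have := hN.last
    rw [hcc, Function.iterate_succ_apply'] at this
    exact a.injective (this.trans hae.symm)
  have hNX : ∀ i, 0 < i → i ≤ K + 1 → a^[i] c ∈ X ∧ (a^[i] c).rev ∉ P := by
    intro i h0 hi
    have := hN.inner i h0 (by omega)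
    rwa [hcc] at this
  obtain ⟨sce, hce, sxe, hcyc, hmem, hsum⟩ := cut_cycle hNe (fun i h0 hi => (hNX i h0 hi).1) hc
    (by rw [hae]; exact hyX)
  rw [hac] at sxe hcyc hmem hsum
  have hcrX : c.rev ∉ X := fun hm => hc (hS.rev_mem _ hm)
  have hfit : ∀ i, h.facePerm^[i + 1] c.rev = M.faceNext^[i] x := fun i => by
    rw [Function.iterate_succ_apply]; rfl
  obtain ⟨fsce, -, fsxe, -, -, fsum⟩ := cut_cycle (a := h.facePerm) (c := c.rev)
    (e := y.rev) (X := X) (N := n) ((hfit n).trans hny)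
    (by
      intro i h0 hi
      obtain ⟨i, rfl⟩ : ∃ j, i = j + 1 := ⟨i - 1, by omega⟩
      rw [hfit]; exact hn i (by omega)) hcrX
    (by change M.cw y.rev.rev ∉ X; rwa [Dart.rev_rev])
  have hfx : h.facePerm c.rev = x := rfl
  rw [hfx] at fsxe fsum
  simp only [hfit] at fsum
  have hmul : a * swap c e * r = h.facePerm * swap c.rev y.rev := by
    rw [← hrc, ← hre, show h.facePerm = a * r from (mul_revOn_mul_revOff _ _).symm,
      mul_assoc a (swap c e), mul_assoc a r, mul_swap_eq_swap_mul r, hr, revOff_revOff, revOff_revOff]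
  -- One transposition makes two cuts. On vertices it separates the darts to the left of `P`, from
  -- `x` to `e`, from the rest of the contracted vertex; on faces, by `hmul`, it separates the
  -- boundary from `x` to `y.rev` from the rest of the left face.
  set a' := a * swap c e with ha'
  obtain ⟨hct, hcn, hcs⟩ := h.toIsRotation.contract hP
  rw [h.toIsRotation.sup_eq_top hbi, ← ha, ← hr] at hcs
  rw [← ha] at hcn
  set s := SameCycle.setoid a' ⊔ SameCycle.setoid r with hs
  have hsa : ∀ z w, SameCycle a' z w → s z w := fun z w hzw =>
    (le_sup_left : SameCycle.setoid a' ≤ s) hzw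
  have hsr : ∀ z, s z (r z) := fun z =>
    (le_sup_right : SameCycle.setoid r ≤ s) (setoid_apply_self r z)
  have hsf : ∀ z w, SameCycle (a' * r) z w → s z w := by
    have : SameCycle.setoid (a' * r) ≤ s :=
      (setoid_le_iff _ _).2 fun p => s.trans' (hsr p) (hsa _ _ ⟨1, by simp⟩)
    exact fun z w hzw => this hzw
  have hfull : ∀ z w, (s ⊔ SameCycle.setoid (swap c e)) z w := by
    have h1 : SameCycle.setoid a ⊔ SameCycle.setoid r ≤ s ⊔ SameCycle.setoid (swap c e) := by
      refine sup_le ?_ (le_sup_right.trans le_sup_left)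
      refine le_trans le_sup_left (b := SameCycle.setoid a ⊔ SameCycle.setoid (swap c e)) ?_
      rw [← setoid_mul_swap_sup]
      exact sup_le_sup_right le_sup_left _
    exact fun z w => h1 (hcs trivial)
  have hsize := card_support_revOff hl hP.nodup hP.rev_notMem
  rw [← hr] at hsize
  -- Contracting `P` lowers the number of vertices by its length and the support by twice that. The
  -- two cuts add one vertex and one face, which raises the 4 in Euler's formula to 8: room for
  -- exactly two components.
  have hE : r.support.card + 8 ≤
      2 * numClasses (SameCycle.setoid a') + 2 * numClasses (SameCycle.setoid (a' * r)) := by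
    rw [hmul, numClasses_mul_swap_of_sameCycle hce sce,
      numClasses_mul_swap_of_sameCycle (fun e' => hcrX (by rw [e']; exact hS.rev_mem y hy)) fsce]
    have := h.euler
    omega
  -- A single component would violate `euler_le`, so the cut really separates the two sides.
  have hsce : ¬ s c e := by
    intro hcon
    have h1 : s = ⊤ := by
      rw [← sup_swap_of_rel hcon, eq_top_iff]
      exact fun z w _ => hfull z w
    have := one_le_of_top h1
    have := euler_le a' r (revOff_revOff P)
    rw [← hs] at this
    omega
  have hdich : ∀ z, s x z ∨ s c z := by
    intro z
    have := hfull c z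
    rw [sup_swap_iff] at this
    rcases this with h1 | ⟨-, h1⟩ | ⟨h1, -⟩
    · exact Or.inr h1
    · exact Or.inl (s.trans' (hsa _ _ sxe) h1)
    · exact absurd h1 hsce
  have hsxc : ¬ s x c := fun hcon => hsce (s.trans' (s.symm' hcon) (hsa _ _ sxe))
  have hscx : ∀ z, s x z → ¬ s c z := fun z h1 h2 => hsxc (s.trans' h1 (s.symm' h2))
  -- darts on the contracted path that are not on the left side
  have hcyc' : ∀ z, SameCycle a z c → (SameCycle a' x z → False) → s c z := by
    intro z hz hz'
    have h1 : (SameCycle.setoid a' ⊔ SameCycle.setoid (swap c e)) z c := by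
      rw [setoid_mul_swap_sup]
      exact (le_sup_left : SameCycle.setoid a ≤ _) hz
    rcases (sup_swap_iff _ _ _ _ _).1 h1 with h1 | ⟨h1, -⟩ | ⟨h1, -⟩
    · exact s.symm' (hsa _ _ h1)
    · exact s.symm' (hsa _ _ h1)
    · exact absurd (sxe.trans (SameCycle.symm h1)) hz'
  have hend : ∀ z, SameCycle a z c ↔ z.fst ∈ u :: P.map Dart.snd := by
    intro z
    rw [hct, hcu]
    constructor
    · rintro (h1 | h1)
      · rw [h1]; simp
      · exact h1.1
    · exact fun h1 => Or.inr ⟨h1, by simp⟩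
  have huv : ∀ z ∉ X, (z.fst = u ∨ z.fst = v) → s c z := by
    intro z hz hzu
    refine hcyc' z ((hend z).2 ?_) ?_
    · rcases hzu with h1 | h1
      · rw [h1]; simp
      · rw [h1]; exact hP.1.target_mem
    · intro h1
      obtain ⟨i, hi, rfl⟩ := hcyc z h1
      exact hz (hNX _ (by omega) (by omega)).1
  -- Outside darts at the poles stay on the cycle of `c`. After deleting `u`, every other outside
  -- dart reaches `v` along outside darts, none of which is affected by the contraction or the cut.
  have hout : ∀ z ∉ X, s c z := by
    have hPat : ∀ d : Dart G, (d ∈ P ∨ d.rev ∈ P) → d ∈ X := by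
      rintro d (hm | hm)
      · exact hPX d hm
      · exact d.rev_rev ▸ hS.rev_mem _ (hPX _ hm)
    have hat : ∀ z ∉ X, ∀ w ∉ X, z.fst = w.fst → s c z → s c w := by
      intro z hz w hw hzw hcz
      by_cases hzu : z.fst = u ∨ z.fst = v
      · exact huv w hw (hzw ▸ hzu)
      refine s.trans' hcz (hsa _ _ (h.toIsRotation.sameCycle_of_eq_at (x := z.fst) ?_ rfl hzw.symm))
      intro d hd
      have hdX : d ∉ X := fun hm => hzu (hd ▸ hS.mixed d hm z hz hd)
      rw [ha', Perm.mul_apply, swap_apply_of_ne_of_ne, ha, Perm.mul_apply,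
        revOn_of_not fun hm => hdX (hPat d hm)]
      · rfl
      · rintro rfl; exact hzu (Or.inl (hd ▸ hcu))
      · rintro rfl; exact hdX heX
    have hrev : ∀ z ∉ X, s c z.rev → s c z := by
      intro z hz h1
      have := hsr z
      rw [hr, revOff_of_not fun hm => hz (hPat z hm)] at this
      exact s.trans' h1 (s.symm' this)
    have key : ∀ w, Reach Xᶜ {u} w v → ∀ z ∉ X, z.fst = w → s c z := by
      intro w hw
      induction hw using Relation.ReflTransGen.head_induction_on with
      | refl => exact fun z hz hzv => huv z hz (Or.inr hzv)
      | @head w w' h1 _ ih =>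
        obtain ⟨d, hd, hdw, hdw', -, -⟩ := h1
        intro z hz hzw
        have hdr : d.rev ∉ X := fun hm => hd (d.rev_rev ▸ hS.rev_mem _ hm)
        exact hat d hd z hz (hdw.trans hzw.symm) (hrev d hd (ih d.rev hdr hdw'))
    intro z hz
    by_cases hzu : z.fst = u
    · exact huv z hz (Or.inl hzu)
    · exact key _ (Sep.reach hbi hS.compl hz hzu) z hz rfl
  have hLX : ∀ z, s x z → z ∈ X := fun z hz => by
    by_contra hcon
    exact hscx z hz (hout z hcon)
  -- The region enclosed by `P` and the left boundary. By `hLX` it lies inside the component, so its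
  -- complete faces satisfy `hfs`.
  set L : Finset (Dart G) := Finset.univ.filter fun z => s x z with hL
  have hLm : ∀ z, z ∈ L ↔ s x z := fun z => by simp [hL]
  have hPL : ∀ d ∈ P, d ∈ L := by
    intro d hd
    obtain ⟨i, h0, hi, hid⟩ := hN.mem d hd
    rw [hcc] at hid
    obtain ⟨i, rfl⟩ : ∃ j, i = j + 1 := ⟨i - 1, by omega⟩
    rw [hLm, ← hid]
    exact hsa _ _ (hmem i (by omega))
  have hPL' : ∀ d ∈ P, d.rev ∉ L := by
    intro d hd hdL
    refine hscx _ ((hLm _).1 hdL) (hcyc' _ ((hend _).2 ?_) ?_)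
    · exact List.mem_cons_of_mem _ (List.mem_map_of_mem hd)
    · intro h1
      obtain ⟨i, hi, h2⟩ := hcyc _ h1
      refine (hNX (i + 1) (by omega) (by omega)).2 ?_
      rw [h2, Dart.rev_rev]
      exact hd
  have hside := sum_weight_side M hl hb hP.nodup (L := L)
    (fun d hd => (hLm _).2 (s.trans' ((hLm d).1 hd) (hsr d))) hPL hPL'
  have hain : ∀ z w, s z w → (z ∈ {z | s x z} ↔ w ∈ {z | s x z}) := fun z w hzw =>
    ⟨fun h1 => s.trans' h1 hzw, fun h1 => s.trans' h1 (s.symm' hzw)⟩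
  have hxx : x ∈ {z | s x z} := s.refl' x
  have heul := euler_eq_on a' r (revOff_revOff P) {z | s x z}
    (fun z => hain _ _ (hsa _ _ ⟨1, by simp⟩)) (fun z => hain _ _ (hsr z)) x c hxx hsxc
    (fun _ hz => hz) (fun z hz => (hdich z).resolve_left hz) hE
  -- Every vertex of the region is an ordinary one with angle sum 4, except the part of the
  -- contracted path that was cut off.
  have hsumv := sum_eq_of_classesIn (SameCycle.setoid a') {z | s x z}
    (fun z w hzw => hain z w (hsa _ _ hzw)) (fun z => (M.angle (revOn P z) : ℤ)) x hxx 4 _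
    (hsum _) (by
      intro z hz hxz
      have h1 : ¬ SameCycle a' z c := fun hm => hsxc (s.trans' hz (hsa _ _ hm))
      have h2 : ¬ SameCycle a' z e := fun hm => hxz (sxe.trans hm.symm)
      have h3 : z.fst ∉ u :: P.map Dart.snd := fun hm =>
        hscx z hz (hcyc' z ((hend z).2 hm) hxz)
      rw [← hvs z, ← finsum_mem_coe_finset]
      refine finsum_mem_congr ?_ ?_
      · ext w
        rw [Finset.mem_coe, Finset.mem_filter, Set.mem_ofPred_eq]
        refine (and_iff_right (Finset.mem_univ _)).trans ?_
        refine (sameCycle_mul_swap_iff h1 h2 w).trans ((hct z w).trans ?_)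
        exact ⟨fun h4 => h4.resolve_right fun h5 => h3 h5.1, Or.inl⟩
      · intro w hw
        rw [revOn_of_not]
        rw [show z.fst = w.fst from hw] at h3
        rintro (hm | hm)
        · exact h3 (hP.1.fst_mem hm)
        · exact h3 (List.mem_cons_of_mem _ (List.mem_map_of_mem hm)))
  -- Every face of the region is an ordinary one with weight -4, except the part of the left face
  -- that was cut off, which is the boundary.
  have hsumf := sum_eq_of_classesIn (SameCycle.setoid (a' * r)) {z | s x z}
    (fun z w hzw => hain z w (hsf _ _ hzw)) M.weight x hxx (-4)
    (∑ i ∈ Finset.range (n + 1), M.weight (M.faceNext^[i] x))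
    (by rw [hmul]; exact fsum _) (by
      intro z hz hxz
      have h1 : ¬ SameCycle (a' * r) z c.rev := fun hm =>
        hcrX (hLX _ (s.trans' hz (hsf _ _ hm)))
      have h2 : ¬ SameCycle (a' * r) z y.rev := fun hm =>
        hxz (by rw [hmul] at hm ⊢; exact fsxe.trans hm.symm)
      rw [hmul] at h1 h2
      have h3 : ∀ w, (SameCycle.setoid (a' * r)) z w ↔ ∃ n, M.faceNext^[n] z = w := by
        intro w
        rw [hmul]
        exact (sameCycle_mul_swap_iff h1 h2 w).trans (sameCycle_iff_iterate _ _ _)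
      rw [← hfs z fun i => hLX _ (s.trans' hz (hsf _ _ ((h3 _).2 ⟨i, rfl⟩))),
        ← finsum_mem_coe_finset]
      refine finsum_mem_congr ?_ fun _ _ => rfl
      ext w
      rw [Finset.mem_coe, Finset.mem_filter]
      exact (and_iff_right (Finset.mem_univ _)).trans (h3 w))
  have hMsum := hN.sum
  rw [Finset.sum_range_succ', hcc, ← ha, Function.iterate_zero, id, hcc] at hMsum
  rw [← hr] at hside
  have hsp : M.spineTurns (some c) P (some (M.cw y)) =
      M.vertexTurns (c.rev :: P ++ [M.cw y]) + M.bendTurns P := rfl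
  rw [hsp]
  have hLf : Finset.univ.filter (fun y => y ∈ {z | s x z}) = L := by
    ext z
    rw [hLm, Finset.mem_filter]
    exact and_iff_right (Finset.mem_univ z)
  have hLn : {z | z ∈ {z | s x z} ∧ r z ≠ z} = {z | z ∈ L ∧ r z ≠ z} := by
    ext z
    simp only [Set.mem_ofPred_eq, hLm]
  rw [hLf] at hsumv hsumf
  rw [hLn] at heul
  zify at heul
  -- The two total sums are related by `hside`, and Euler's formula `heul` for the region eliminates
  -- its numbers of vertices, faces and darts. The term `M.angle c - 2` comes from the first summand
  -- of the trace, which precedes the cut.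
  linarith

end Cut

end SPOrtho

namespace SPOrtho

/-! ### Sweeps -/

section Sweep

open Equiv Equiv.Perm

variable {V E : Type*} {G : Graph V E}

/-- A planar map whose angles are positive and sum up to 360 degrees at each vertex. -/
structure LabeledMap.IsDrawing [Finite (Dart G)] (M : LabeledMap G) : Prop
    extends M.IsPlanar where
  angle_pos : ∀ d, 1 ≤ M.angle d
  bendTurn_rev : ∀ d, M.bendTurn d.rev = - M.bendTurn d
  vertex : ∀ d : Dart G, ∑ᶠ x ∈ {x : Dart G | d.fst = x.fst}, (M.angle x : ℤ) = 4

variable {M : LabeledMap G}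

theorem LabeledMap.sweep_cw (M : LabeledMap G) (c : Dart G) : M.sweep c (M.cw c) = M.angle c := by
  rw [LabeledMap.sweep_eq one_pos (Function.iterate_one _ ▸ rfl) (by omega)]
  simp

theorem LabeledMap.IsRotation.sweep_cw_left [Finite (Dart G)] (h : M.IsRotation) {s t : Dart G}
    (hst : s.fst = t.fst) (hne : M.cw s ≠ t) :
    M.sweep s t = M.angle s + M.sweep (M.cw s) t := by
  obtain ⟨K, hK, hKt, hmin⟩ := h.exists_first ((h.fst s).trans hst)
  rw [LabeledMap.sweep_eq hK hKt hmin, LabeledMap.sweep_eq (K := K + 1) K.succ_pos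
    (by rw [Function.iterate_succ_apply]; exact hKt), Finset.sum_range_succ', add_comm]
  · rfl
  · intro i h0 hi
    obtain ⟨i, rfl⟩ : ∃ j, i = j + 1 := ⟨i - 1, by omega⟩
    rw [Function.iterate_succ_apply]
    rcases Nat.eq_zero_or_pos i with rfl | h1
    · exact hne
    · exact hmin i h1 (by omega)

theorem LabeledMap.IsRotation.sweep_cw_right [Finite (Dart G)] (h : M.IsRotation) {s t : Dart G}
    (hst : s.fst = t.fst) (hne : s ≠ t) :
    M.sweep s (M.cw t) = M.sweep s t + M.angle t := by
  obtain ⟨K, hK, hKt, hmin⟩ := h.exists_first hst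
  rw [LabeledMap.sweep_eq hK hKt hmin, LabeledMap.sweep_eq (K := K + 1) K.succ_pos
    (by rw [Function.iterate_succ_apply', hKt]), Finset.sum_range_succ, hKt]
  intro i h0 hi e
  obtain ⟨i, rfl⟩ : ∃ j, i = j + 1 := ⟨i - 1, by omega⟩
  rw [Function.iterate_succ_apply'] at e
  have e := h.bijective.injective e
  rcases Nat.eq_zero_or_pos i with rfl | h1
  · exact hne e
  · exact hmin i h1 (by omega) e

theorem LabeledMap.IsDrawing.sweep_add_sweep [Finite (Dart G)] (h : M.IsDrawing) {s t : Dart G}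
    (hst : s.fst = t.fst) (hne : s ≠ t) : (M.sweep s t : ℤ) + M.sweep t s = 4 := by
  obtain ⟨K, hK, hKt, hmin⟩ := h.exists_first hst
  obtain ⟨K', hK', hKt', hmin'⟩ := h.exists_first hst.symm
  have hadd : ∀ j, M.cw^[K + j] s = M.cw^[j] t := fun j => by
    rw [add_comm, Function.iterate_add_apply, hKt]
  have h1 : {x : Dart G | s.fst = x.fst} = {x | ∃ n : ℕ, M.cw^[n] s = x} := by
    ext x
    exact ⟨h.trans s x, by rintro ⟨n, rfl⟩; exact (h.iterate_fst n s).symm⟩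
  rw [LabeledMap.sweep_eq hK hKt hmin, LabeledMap.sweep_eq hK' hKt' hmin', ← h.vertex s, h1,
    finsum_orbit_eq (N := K + K') (by omega) (by rw [hadd, hKt']), Finset.sum_range_add]
  · simp only [hadd, Nat.cast_sum]
  · intro i h0 hi
    rcases lt_trichotomy i K with h1 | rfl | h1
    · exact iterate_ne_of_first hKt hmin h0 h1
    · rw [hKt]; exact hne.symm
    · rw [show i = K + (i - K) by omega, hadd]
      exact hmin' _ (by omega) (by omega)

/-- At least four positive integers with sum 4 are all 1. -/
theorem LabeledMap.IsDrawing.angle_eq_one [Finite (Dart G)] (h : M.IsDrawing) {d : Dart G}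
    (hd : 4 ≤ (dartsAt G d.fst).ncard) : M.angle d = 1 := by
  have hfin := Set.toFinite (dartsAt G d.fst)
  have h1 : ∑ x ∈ hfin.toFinset, (M.angle x : ℤ) = 4 := by
    rw [← h.vertex d, ← finsum_mem_coe_finset]
    refine finsum_mem_congr ?_ fun _ _ => rfl
    ext x
    simp [dartsAt, eq_comm]
  have h2 : ∑ x ∈ hfin.toFinset, ((M.angle x : ℤ) - 1) ≤ 0 := by
    rw [Finset.sum_sub_distrib, h1, Finset.sum_const, ← Set.ncard_eq_toFinset_card _ hfin]
    simp only [nsmul_eq_mul, mul_one]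
    omega
  have h3 : ∀ x ∈ hfin.toFinset, (0 : ℤ) ≤ (M.angle x : ℤ) - 1 := fun x _ => by
    have := h.angle_pos x
    omega
  have h4 := (Finset.sum_eq_zero_iff_of_nonneg h3).1 (le_antisymm h2 (Finset.sum_nonneg h3)) d
    (by simp [dartsAt])
  omega

/-! ### The turns along a spine -/

theorem LabeledMap.vertexTurns_concat (M : LabeledMap G) (l : List (Dart G)) (z o : Dart G) :
    M.vertexTurns (l ++ [z, o]) = M.vertexTurns (l ++ [z]) + M.turn z o := by
  induction l with
  | nil => simp [LabeledMap.vertexTurns]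
  | cons a l ih =>
    rcases l with _ | ⟨b, l⟩
    · simp [LabeledMap.vertexTurns]
    · simp only [List.cons_append, LabeledMap.vertexTurns_cons_cons] at ih ⊢
      rw [ih, add_assoc]

/-- The turn at a pole from the edge of an alias vertex, if it is not the pole, to `d`. -/
noncomputable def LabeledMap.startTurn (M : LabeledMap G) (a : Option (Dart G)) (d : Dart G) : ℤ :=
  a.elim 0 fun c => M.sweep c d - 2

/-- The turn at a pole from `d` to the edge of an alias vertex, if it is not the pole. -/
noncomputable def LabeledMap.endTurn (M : LabeledMap G) (d : Dart G) (b : Option (Dart G)) : ℤ :=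
  b.elim 0 fun o => M.sweep d o - 2

theorem LabeledMap.spineTurns_start (M : LabeledMap G) (a : Option (Dart G)) (d : Dart G)
    (p : List (Dart G)) (b : Option (Dart G)) :
    M.spineTurns a (d :: p) b = M.startTurn a d + M.spineTurns none (d :: p) b := by
  rcases a with _ | c
  · simp [LabeledMap.startTurn]
  · simp only [LabeledMap.spineTurns, LabeledMap.startTurn, Option.toList_some, List.map_cons,
      List.map_nil, List.cons_append, List.nil_append, LabeledMap.vertexTurns_cons_cons,
      LabeledMap.turn, Dart.rev_rev, Option.elim_some, Option.toList_none, add_assoc]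

theorem LabeledMap.spineTurns_end (M : LabeledMap G) (a : Option (Dart G)) (z : Dart G)
    (p : List (Dart G)) (b : Option (Dart G)) :
    M.spineTurns a (p ++ [z]) b = M.spineTurns a (p ++ [z]) none + M.endTurn z.rev b := by
  rcases b with _ | o
  · simp [LabeledMap.endTurn]
  · have := M.vertexTurns_concat (a.toList.map Dart.rev ++ p) z o
    simp only [LabeledMap.spineTurns, LabeledMap.endTurn, Option.toList_some, Option.elim_some,
      Option.toList_none, List.append_nil, List.append_assoc, List.singleton_append] at this ⊢
    rw [this, LabeledMap.turn]
    ring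

theorem LabeledMap.IsDrawing.endTurn_eq [Finite (Dart G)] (h : M.IsDrawing) {d : Dart G} {a : Option (Dart G)}
    (ha : ∀ c, a = some c → c ≠ d ∧ c.fst = d.fst) : M.endTurn d a = - M.startTurn a d := by
  rcases a with _ | c
  · rfl
  · obtain ⟨h1, h2⟩ := ha c rfl
    have := h.sweep_add_sweep h2 h1
    simp only [LabeledMap.startTurn, LabeledMap.endTurn, Option.elim_some]
    omega

/-- The opposite of a walk. -/
def revWalk (p : List (Dart G)) : List (Dart G) := (p.map Dart.rev).reverse

theorem revWalk_cons (d : Dart G) (p : List (Dart G)) : revWalk (d :: p) = revWalk p ++ [d.rev] := by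
  simp [revWalk]

theorem mem_revWalk {p : List (Dart G)} {d : Dart G} : d ∈ revWalk p ↔ d.rev ∈ p := by
  simp only [revWalk, List.mem_reverse, List.mem_map]
  exact ⟨by rintro ⟨a, ha, rfl⟩; exact ha, fun h => ⟨d.rev, h, rfl⟩⟩

theorem IsWalk.revWalk {u v : V} {p : List (Dart G)} (h : IsWalk u p v) :
    IsWalk v (revWalk p) u := by
  induction p generalizing u with
  | nil => exact Eq.symm h
  | cons a p ih =>
    rw [revWalk_cons]
    exact (ih h.2).append ⟨rfl, h.1⟩

theorem IsPath.revWalk {u v : V} {p : List (Dart G)} (h : IsPath u p v) :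
    IsPath v (revWalk p) u := by
  refine ⟨h.1.revWalk, ?_⟩
  have key : ∀ (u : V) (p : List (Dart G)), IsWalk u p v →
      v :: (SPOrtho.revWalk p).map Dart.snd = (u :: p.map Dart.snd).reverse := by
    intro u p hp
    induction p generalizing u with
    | nil => rw [show u = v from hp]; rfl
    | cons a p ih =>
      rw [revWalk_cons, List.map_append, ← List.cons_append, ih _ hp.2]
      simpa using hp.1
  rw [key u p h.1]
  exact List.nodup_reverse.2 h.2

theorem LabeledMap.IsDrawing.spineTurns_revWalk [Finite (Dart G)] (h : M.IsDrawing) {u v : V} {p : List (Dart G)}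
    (hp : IsPath u p v) : M.spineTurns none (revWalk p) none = - M.spineTurns none p none := by
  have key : M.vertexTurns (revWalk p) = - M.vertexTurns p ∧
      M.bendTurns (revWalk p) = - M.bendTurns p := by
    induction p generalizing u with
    | nil => exact ⟨rfl, rfl⟩
    | cons a p ih =>
      obtain ⟨h1, h2⟩ := ih hp.tail
      constructor
      · rcases p with _ | ⟨b, p⟩
        · rfl
        · rw [LabeledMap.vertexTurns_cons_cons, revWalk_cons, revWalk_cons, List.append_assoc,
            List.singleton_append, LabeledMap.vertexTurns_concat, ← revWalk_cons, h1]
          have h3 : b.fst = a.rev.fst := hp.1.2.1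
          have h4 : b ≠ a.rev := by
            rintro rfl
            exact hp.rev_notMem a (by simp) (by simp)
          have := h.sweep_add_sweep h3 h4
          simp only [LabeledMap.turn, Dart.rev_rev]
          omega
      · have h5 := h.bendTurn_rev a
        simp only [LabeledMap.bendTurns, revWalk_cons, List.map_append, List.sum_append,
          List.map_cons, List.sum_cons, List.map_nil, List.sum_nil, LabeledMap.bendTurn] at h2 h5 ⊢
        rw [h2]
        omega
  simp only [LabeledMap.spineTurns, Option.toList_none, List.map_nil, List.nil_append,
    List.append_nil, key.1, key.2]
  ring

end Sweep

end SPOrtho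

namespace SPOrtho

/-! ### Spirality and the boundary of a component -/

section Spirality

open LabeledMap

variable {V E : Type*} {G : Graph V E} {M : LabeledMap G} {ν : SPQTree G}

theorem pair_cases {α : Type*} {S : Set α} {x a b : α} (hx : x ∈ S) (h : S = {a, b}) :
    (S.ncard = 1 ∧ a = x ∧ b = x) ∨
      (S.ncard = 2 ∧ ∃ z ∈ S, z ≠ x ∧ S = {x, z} ∧ ((a = x ∧ b = z) ∨ (a = z ∧ b = x))) := by
  subst h
  rcases eq_or_ne a b with rfl | hab
  · refine Or.inl ⟨by simp, ?_⟩
    have : x = a := by simpa using hx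
    exact ⟨this.symm, this.symm⟩
  · refine Or.inr ⟨Set.ncard_pair hab, ?_⟩
    rcases hx with rfl | hx
    · exact ⟨b, by simp, hab.symm, rfl, Or.inl ⟨rfl, rfl⟩⟩
    · have hx : x = b := hx
      subst hx
      exact ⟨a, by simp, hab, Set.pair_comm a x, Or.inr ⟨rfl, rfl⟩⟩

theorem aliases_of_indeg_ne {w : V} (hw : ν.indeg w ≠ 1) :
    aliases ν w = some '' (dartsAt G w \ ν.darts) := if_neg hw

theorem aliases_of_indeg_eq {w : V} (hw : ν.indeg w = 1) : aliases ν w = {none} := if_pos hw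

theorem indeg_add_aliases [Finite (Dart G)] {w : V} (hw : ν.indeg w ≠ 1) :
    ν.indeg w + (aliases ν w).ncard = (dartsAt G w).ncard := by
  rw [aliases_of_indeg_ne hw, Set.ncard_image_of_injective _ (Option.some_injective _),
    SPQTree.indeg, Set.ncard_inter_add_ncard_sdiff_eq_ncard]

theorem indeg_pos [Finite (Dart G)] {d : Dart G} (hd : d ∈ ν.darts) : 0 < ν.indeg d.fst :=
  (Set.ncard_pos (Set.toFinite _)).2 ⟨d, rfl, hd⟩

theorem eq_of_indeg_eq_one {w : V} (hw : ν.indeg w = 1) {d d' : Dart G} (hd : d ∈ ν.darts)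
    (hd' : d' ∈ ν.darts) (e : d.fst = w) (e' : d'.fst = w) : d = d' := by
  obtain ⟨x, hx⟩ := Set.ncard_eq_one.1 hw
  have h1 : d ∈ ({x} : Set (Dart G)) := hx ▸ ⟨e, hd⟩
  have h2 : d' ∈ ({x} : Set (Dart G)) := hx ▸ ⟨e', hd'⟩
  rw [Set.mem_singleton_iff] at h1 h2
  rw [h1, h2]

/-- Four edges meet at a pole with two alias vertices. -/
theorem LabeledMap.IsDrawing.angle_eq_one_of_aliases [Finite (Dart G)] (h : M.IsDrawing) {w : V}
    (hw : ν.indeg w ≠ 1) (hw' : 0 < ν.indeg w) (h2 : (aliases ν w).ncard = 2) {x : Dart G}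
    (hx : x.fst = w) : M.angle x = 1 := by
  apply h.angle_eq_one
  rw [hx, ← indeg_add_aliases hw]
  omega

theorem LabeledMap.IsRotation.cw_ne_self (h : M.IsRotation) {d d' : Dart G}
    (e : d.fst = d'.fst) (hne : d ≠ d') : M.cw d ≠ d := by
  intro hd
  obtain ⟨n, hn⟩ := h.trans d d' e
  rw [Function.iterate_fixed hd] at hn
  exact hne hn

/-- Reduces the mean over the alias vertices to the one next to the left face. A second alias edge
immediately precedes `c`, since the entry `c` is unique. Together with at least two inner edges this
makes four edges at the pole, so all angles are 90 degrees and the second turn is larger by exactly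
1. -/
theorem LabeledMap.IsDrawing.startTurn_aliases [Finite (Dart G)] (h : M.IsDrawing)
    (hB : M.IsBlock ν.darts) {c d : Dart G} (hc : c ∉ ν.darts) (hcX : M.cw c ∈ ν.darts)
    (hd : d ∈ ν.darts) {w : V} (hcw : c.fst = w) (hdw : d.fst = w) {a a' : Option (Dart G)}
    (ha : aliases ν w = {a, a'}) :
    M.startTurn a d + M.startTurn a' d =
      2 * (if ν.indeg w = 1 then 0 else (M.sweep c d : ℤ) - 2) + ((aliases ν w).ncard - 1) := by
  by_cases hw : ν.indeg w = 1
  · rw [if_pos hw, aliases_of_indeg_eq hw]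
    rw [aliases_of_indeg_eq hw] at ha
    have h1 : a ∈ ({none} : Set (Option (Dart G))) := by rw [ha]; simp
    have h2 : a' ∈ ({none} : Set (Option (Dart G))) := by rw [ha]; simp
    rw [Set.mem_singleton_iff] at h1 h2
    simp [h1, h2, startTurn]
  rw [if_neg hw]
  have hcm : some c ∈ aliases ν w := by
    rw [aliases_of_indeg_ne hw]; exact ⟨c, ⟨hcw, hc⟩, rfl⟩
  have key : ∀ z ∈ aliases ν w, z ≠ some c → aliases ν w = {some c, z} →
      (aliases ν w).ncard = 2 → M.startTurn z d = (M.sweep c d : ℤ) - 2 + 1 := by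
    intro z hz hzc hpair hcard
    rw [aliases_of_indeg_ne hw] at hz
    obtain ⟨c₂, ⟨hc₂, hc₂X⟩, rfl⟩ := hz
    have hc₂ : c₂.fst = w := hc₂
    have hne : c₂ ≠ c := fun e => hzc (by rw [e])
    have hfst := hc₂.trans hcw.symm
    have h1 : M.cw c₂ ∉ ν.darts := fun hm => hne (hB.entry _ hc₂X _ hc hfst hm hcX)
    have h2 : some (M.cw c₂) ∈ aliases ν w := by
      rw [aliases_of_indeg_ne hw]; exact ⟨_, ⟨(h.fst _).trans hc₂, h1⟩, rfl⟩
    have h3 : M.cw c₂ = c := by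
      rw [hpair] at h2
      rcases h2 with h2 | h2
      · exact Option.some_injective _ h2
      · exact absurd (Option.some_injective _ h2) (h.cw_ne_self hfst hne)
    have h4 := h.sweep_cw_left (hc₂.trans hdw.symm) (fun e => hc (by rw [← h3, e]; exact hd))
    have h5 := h.angle_eq_one_of_aliases hw (hdw ▸ indeg_pos hd) hcard hc₂
    rw [h3, h5] at h4
    simp only [startTurn, Option.elim_some, h4]
    push_cast
    ring
  have hs : M.startTurn (some c) d = (M.sweep c d : ℤ) - 2 := rfl
  rcases pair_cases hcm ha with ⟨h1, rfl, rfl⟩ | ⟨h1, z, hz, hzc, hpair, ⟨rfl, rfl⟩ | ⟨rfl, rfl⟩⟩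
  · rw [h1, hs]; push_cast; ring
  · rw [key _ hz hzc hpair h1, h1, hs]; push_cast; ring
  · rw [key _ hz hzc hpair h1, h1, hs]; push_cast; ring

theorem LabeledMap.IsDrawing.endTurn_aliases [Finite (Dart G)] (h : M.IsDrawing)
    (hB : M.IsBlock ν.darts) {y d : Dart G} (hy : y ∈ ν.darts) (hyX : M.cw y ∉ ν.darts)
    (hd : d ∈ ν.darts) {w : V} (hyw : y.fst = w) (hdw : d.fst = w) {b b' : Option (Dart G)}
    (hb : aliases ν w = {b, b'}) :
    M.endTurn d b + M.endTurn d b' =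
      2 * (if ν.indeg w = 1 then 0 else (M.sweep d (M.cw y) : ℤ) - 2) +
        ((aliases ν w).ncard - 1) := by
  by_cases hw : ν.indeg w = 1
  · rw [if_pos hw, aliases_of_indeg_eq hw]
    rw [aliases_of_indeg_eq hw] at hb
    have h1 : b ∈ ({none} : Set (Option (Dart G))) := by rw [hb]; simp
    have h2 : b' ∈ ({none} : Set (Option (Dart G))) := by rw [hb]; simp
    rw [Set.mem_singleton_iff] at h1 h2
    simp [h1, h2, endTurn]
  rw [if_neg hw]
  have hof : (M.cw y).fst = w := (h.fst y).trans hyw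
  have hom : some (M.cw y) ∈ aliases ν w := by
    rw [aliases_of_indeg_ne hw]; exact ⟨_, ⟨hof, hyX⟩, rfl⟩
  have key : ∀ z ∈ aliases ν w, z ≠ some (M.cw y) → aliases ν w = {some (M.cw y), z} →
      (aliases ν w).ncard = 2 → M.endTurn d z = (M.sweep d (M.cw y) : ℤ) - 2 + 1 := by
    intro z hz hzc hpair hcard
    rw [aliases_of_indeg_ne hw] at hz
    obtain ⟨o₂, ⟨ho₂, ho₂X⟩, rfl⟩ := hz
    have ho₂ : o₂.fst = w := ho₂
    have hne : o₂ ≠ M.cw y := fun e => hzc (by rw [e])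
    obtain ⟨x, hx⟩ := h.bijective.surjective o₂
    have hxw : x.fst = w := by rw [← h.fst x, hx, ho₂]
    have h1 : x ∉ ν.darts := fun hm => hne (by
      rw [← hx, hB.exit x hm y hy (hxw.trans hyw.symm) (by rwa [hx]) hyX])
    have h2 : some x ∈ aliases ν w := by
      rw [aliases_of_indeg_ne hw]; exact ⟨_, ⟨hxw, h1⟩, rfl⟩
    have h3 : x = M.cw y := by
      rw [hpair] at h2
      rcases h2 with h2 | h2
      · exact Option.some_injective _ h2
      · have h2 : x = o₂ := Option.some_injective _ h2
        subst h2
        exact absurd hx (h.cw_ne_self (hxw.trans hof.symm) hne)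
    have h4 := h.sweep_cw_right (s := d) (t := M.cw y) (hdw.trans hof.symm)
      (fun e => hyX (e ▸ hd))
    have h5 := h.angle_eq_one_of_aliases hw (hdw ▸ indeg_pos hd) hcard hof
    rw [← h3, hx, h3, h5] at h4
    simp only [endTurn, Option.elim_some, h4]
    push_cast
    ring
  have hs : M.endTurn d (some (M.cw y)) = (M.sweep d (M.cw y) : ℤ) - 2 := rfl
  rcases pair_cases hom hb with ⟨h1, rfl, rfl⟩ | ⟨h1, z, hz, hzc, hpair, ⟨rfl, rfl⟩ | ⟨rfl, rfl⟩⟩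
  · rw [h1, hs]; push_cast; ring
  · rw [key _ hz hzc hpair h1, h1, hs]; push_cast; ring
  · rw [key _ hz hzc hpair h1, h1, hs]; push_cast; ring

/-- Twice the spirality, regardless of how alias vertices of the two poles are paired. -/
def LabeledMap.HasTurning (M : LabeledMap G) (ν : SPQTree G) (u v : V) (τ : ℤ) : Prop :=
  ∃ p : List (Dart G), IsPath u p v ∧ (∀ d ∈ p, d ∈ ν.darts) ∧
  ∃ a a' b b' : Option (Dart G), aliases ν u = {a, a'} ∧ aliases ν v = {b, b'} ∧
    τ = M.spineTurns a p b + M.spineTurns a' p b'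

theorem LabeledMap.HasSpirality.hasTurning {σ : ℚ} (h : M.HasSpirality ν σ) :
    ∃ τ : ℤ, (τ : ℚ) = 2 * σ ∧ M.HasTurning ν ν.source ν.sink τ := by
  obtain ⟨p, hp, hpX, a, a', b, b', ha, hb, -, hσ⟩ := h
  refine ⟨_, ?_, p, hp, hpX, a, a', b, b', ha, hb, rfl⟩
  rw [hσ]
  push_cast
  ring

theorem IsPath.ends {u v : V} {p : List (Dart G)} (hp : IsPath u p v) (huv : u ≠ v) :
    ∃ d z, (∃ q, p = d :: q) ∧ (∃ q, p = q ++ [z]) ∧ d ∈ p ∧ z ∈ p ∧ d.fst = u ∧ z.snd = v := by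
  have key : ∀ {u v : V} {p : List (Dart G)}, IsPath u p v → u ≠ v →
      ∃ d q, p = d :: q ∧ d.fst = u := by
    intro u v p hp huv
    rcases p with _ | ⟨d, q⟩
    · exact absurd hp.1 huv
    · exact ⟨d, q, rfl, hp.1.1⟩
  obtain ⟨d, q, rfl, hd⟩ := key hp huv
  obtain ⟨z, q', hz, hzv⟩ := key hp.revWalk huv.symm
  have h1 : d :: q = SPOrtho.revWalk q' ++ [z.rev] := by
    rw [← revWalk_cons, ← hz, SPOrtho.revWalk, SPOrtho.revWalk, List.map_reverse, List.reverse_reverse,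
      List.map_map]
    simp [Function.comp_def]
  refine ⟨d, z.rev, ⟨q, rfl⟩, ⟨_, h1⟩, by simp, by rw [h1]; simp, hd, hzv⟩

theorem LabeledMap.spineTurns_eq_add (M : LabeledMap G) (a b : Option (Dart G))
    {p : List (Dart G)} {d z : Dart G} (hd : ∃ q, p = d :: q) (hz : ∃ q, p = q ++ [z]) :
    M.spineTurns a p b = M.startTurn a d + M.spineTurns none p none + M.endTurn z.rev b := by
  obtain ⟨q, hq⟩ := hz
  rw [hq, spineTurns_end, ← hq]
  obtain ⟨q, hq⟩ := hd
  rw [hq, spineTurns_start]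

theorem aliases_ne {u : V} {a : Option (Dart G)} (ha : a ∈ aliases ν u) {d : Dart G}
    (hd : d ∈ ν.darts) (hdu : d.fst = u) : ∀ c, a = some c → c ≠ d ∧ c.fst = d.fst := by
  rintro c rfl
  by_cases hu : ν.indeg u = 1
  · rw [aliases_of_indeg_eq hu] at ha
    exact absurd ha (by simp)
  · rw [aliases_of_indeg_ne hu] at ha
    obtain ⟨c', ⟨h1, h2⟩, e⟩ := ha
    obtain rfl := Option.some_injective _ e
    exact ⟨fun e => h2 (e ▸ hd), Eq.trans h1 hdu.symm⟩

/-- Reversing a spine turns every right turn into a left turn. The two spines may be paired in any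
way because the sum separates into terms for the two poles. This makes the right side of a component
a left side. -/
theorem LabeledMap.HasTurning.swap [Finite (Dart G)] (h : M.IsDrawing) {u v : V} (huv : u ≠ v)
    (hX : ∀ d ∈ ν.darts, d.rev ∈ ν.darts) {τ : ℤ} (ht : M.HasTurning ν u v τ) :
    M.HasTurning ν v u (-τ) := by
  obtain ⟨p, hp, hpX, a, a', b, b', ha, hb, rfl⟩ := ht
  refine ⟨revWalk p, hp.revWalk, fun d hd => ?_, b, b', a, a', hb, ha, ?_⟩
  · exact d.rev_rev ▸ hX _ (hpX _ (mem_revWalk.1 hd))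
  obtain ⟨d, z, hd, hz, hdp, hzp, hdu, hzv⟩ := hp.ends huv
  have hd' : ∃ q, revWalk p = q ++ [d.rev] := by
    obtain ⟨q, rfl⟩ := hd
    exact ⟨_, revWalk_cons d q⟩
  have hz' : ∃ q, revWalk p = z.rev :: q := by
    obtain ⟨q, rfl⟩ := hz
    exact ⟨revWalk q, by simp [revWalk]⟩
  have hdX := hpX d hdp
  have hzX := hX z (hpX z hzp)
  rw [M.spineTurns_eq_add a b hd hz, M.spineTurns_eq_add a' b' hd hz,
    M.spineTurns_eq_add b a hz' hd', M.spineTurns_eq_add b' a' hz' hd', Dart.rev_rev,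
    h.spineTurns_revWalk hp, h.endTurn_eq (aliases_ne (ha ▸ by simp : a ∈ _) hdX hdu),
    h.endTurn_eq (aliases_ne (ha ▸ by simp : a' ∈ _) hdX hdu),
    h.endTurn_eq (aliases_ne (hb ▸ by simp : b ∈ _) hzX hzv),
    h.endTurn_eq (aliases_ne (hb ▸ by simp : b' ∈ _) hzX hzv)]
  ring

/-- The turns along the boundary of a component on the left of its spines, with those angles at the
poles that are kept with the component, in terms of the spirality. -/
theorem LabeledMap.IsDrawing.boundary_eq [Finite (Dart G)] (h : M.IsDrawing)
    (hbi : Biconnected G) (hl : ∀ d : Dart G, d.fst ≠ d.snd) {u v : V} (hS : Sep ν.darts u v)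
    (hfs : ∀ d, (∀ n, M.faceNext^[n] d ∈ ν.darts) → ∑ᶠ x ∈ M.face d, M.weight x = -4)
    {τ : ℤ} (ht : M.HasTurning ν u v τ)
    {c y : Dart G} (hc : c ∉ ν.darts) (hcu : c.fst = u) (hcX : M.cw c ∈ ν.darts)
    (hy : y ∈ ν.darts) (hyv : y.fst = v) (hyX : M.cw y ∉ ν.darts) {n : ℕ}
    (hn : ∀ i ≤ n, M.faceNext^[i] (M.cw c) ∈ ν.darts) (hny : M.faceNext^[n] (M.cw c) = y.rev) :
    2 * (∑ i ∈ Finset.range (n + 1), M.weight (M.faceNext^[i] (M.cw c)) +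
      (if ν.indeg u = 1 then 0 else (M.angle c : ℤ)) -
      (if ν.indeg v = 1 then (M.angle y : ℤ) else 0)) =
    τ + (if ν.indeg u = 1 then 0 else 4) - (if ν.indeg v = 1 then 4 else 0) -
      ((aliases ν u).ncard - 1) - ((aliases ν v).ncard - 1) := by
  have hB := h.isBlock hbi hl hS
  obtain ⟨p, hp, hpX, a, a', b, b', ha, hb, rfl⟩ := ht
  obtain ⟨d, z, hd, hz, hdp, hzp, hdu, hzv⟩ := hp.ends hS.ne
  have hzX := hS.rev_mem z (hpX z hzp)
  have hmain := h.toIsPlanar.spineTurns_eq hbi hl hS hp hpX hc hcu hcX hy hyv hyX h.bendTurn_rev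
    h.vertex hfs hn hny
  have h1 := h.startTurn_aliases hB hc hcX (hpX d hdp) hcu hdu ha
  have h2 := h.endTurn_aliases hB hy hyX hzX hyv hzv hb
  rw [M.spineTurns_eq_add _ _ hd hz] at hmain ⊢
  rw [M.spineTurns_eq_add a' _ hd hz]
  have h3 : M.startTurn (some c) d = (M.sweep c d : ℤ) - 2 := rfl
  have h4 : M.endTurn z.rev (some (M.cw y)) = (M.sweep z.rev (M.cw y) : ℤ) - 2 := rfl
  -- With one inner edge the pole is its own alias vertex and contributes no turn to the spine,
  -- while the turn at `u` in `hmain` comes from the sweep of the single corner.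
  have h5 : ν.indeg u = 1 → (M.sweep c d : ℤ) = M.angle c := fun hu => by
    rw [eq_of_indeg_eq_one hu (hpX d hdp) hcX hdu ((h.fst c).trans hcu), M.sweep_cw]
  have h6 : ν.indeg v = 1 → (M.sweep z.rev (M.cw y) : ℤ) = M.angle y := fun hv => by
    rw [eq_of_indeg_eq_one hv hzX hy hzv hyv, M.sweep_cw]
  by_cases hu : ν.indeg u = 1 <;> by_cases hv : ν.indeg v = 1 <;>
    simp only [hu, hv, if_true, if_false, forall_const, false_implies]
      at h1 h2 h5 h6 ⊢ <;> linarith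

end Spirality

end SPOrtho

namespace SPOrtho

/-! ### Orthogonal representations as drawings -/

section Representation

open Equiv Equiv.Perm LabeledMap

variable {V E : Type*} {G : Graph V E} {M : LabeledMap G}

theorem card_dart [Finite (Dart G)] (hl : ∀ d : Dart G, d.fst ≠ d.snd) :
    Nat.card (Dart G) = 2 * G.edgeSet.ncard := by
  classical
  have := Fintype.ofFinite (Dart G)
  have h1 : G.edgeSet = ↑(Finset.univ.image (Dart.edge (G := G))) := by
    ext e
    simp only [Finset.coe_image, Finset.coe_univ, Set.image_univ, Set.mem_range]
    constructor
    · intro he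
      obtain ⟨x, y, h⟩ := Graph.exists_isLink_of_mem_edgeSet he
      exact ⟨⟨e, x, y, h⟩, rfl⟩
    · rintro ⟨d, rfl⟩
      exact d.isLink.edge_mem
  rw [h1, Set.ncard_coe_finset, Nat.card_eq_fintype_card, ← Finset.card_univ,
    Finset.card_eq_sum_card_image (Dart.edge (G := G)) Finset.univ, Finset.sum_congr rfl
      (g := fun _ => 2), Finset.sum_const, smul_eq_mul, mul_comm]
  intro e he
  obtain ⟨d, -, rfl⟩ := Finset.mem_image.1 he
  have : Finset.univ.filter (fun x : Dart G => x.edge = d.edge) = {d, d.rev} := by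
    ext x
    simp only [Finset.mem_filter, Finset.mem_univ, true_and, Finset.mem_insert,
      Finset.mem_singleton]
    exact ⟨Dart.eq_or_eq_rev, by rintro (rfl | rfl) <;> rfl⟩
  rw [this, Finset.card_pair]
  exact fun e => hl d (congrArg Dart.fst e)

theorem numClasses_perm [Finite (Dart G)] (h : M.IsRotation)
    (hV : ∀ x ∈ G.vertexSet, ∃ d : Dart G, d.fst = x) :
    numClasses (SameCycle.setoid h.perm) = G.vertexSet.ncard := by
  have h1 : SameCycle.setoid h.perm = Setoid.ker Dart.fst := by
    ext d d'
    exact h.sameCycle_perm_iff d d'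
  rw [h1, numClasses_ker]
  congr 1
  ext x
  exact ⟨by rintro ⟨d, rfl⟩; exact d.fst_mem, hV x⟩

theorem LabeledMap.IsRotation.mem_face [Finite (Dart G)] (h : M.IsRotation) (d x : Dart G) :
    x ∈ M.face d ↔ SameCycle h.facePerm d x :=
  (sameCycle_iff_iterate h.facePerm d x).symm

theorem LabeledMap.IsRotation.mem_face_comm [Finite (Dart G)] (h : M.IsRotation) (d x : Dart G) :
    x ∈ M.face d ↔ d ∈ M.face x := by
  rw [h.mem_face, h.mem_face, sameCycle_comm]

theorem LabeledMap.IsRotation.face_eq [Finite (Dart G)] (h : M.IsRotation) {d x : Dart G}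
    (hx : x ∈ M.face d) : M.face x = M.face d := by
  ext z
  rw [h.mem_face] at hx
  rw [h.mem_face, h.mem_face]
  exact ⟨hx.trans, hx.symm.trans⟩

theorem numClasses_facePerm [Finite (Dart G)] (h : M.IsRotation) :
    numClasses (SameCycle.setoid h.facePerm) = (Set.range M.face).ncard := by
  have h1 : SameCycle.setoid h.facePerm = Setoid.ker M.face := by
    ext d d'
    refine (h.mem_face d d').symm.trans ⟨fun hm => (h.face_eq hm).symm, fun e => ?_⟩
    rw [show M.face d = M.face d' from e]
    exact ⟨0, rfl⟩
  rw [h1, numClasses_ker]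

theorem bendTurn_rev_of (h₁ : ∀ d, ∀ a ∈ M.bends d, a = 1 ∨ a = 3)
    (h₂ : ∀ d, M.bends d.rev = ((M.bends d).map (4 - ·)).reverse) (d : Dart G) :
    M.bendTurn d.rev = - M.bendTurn d := by
  have key : ∀ l : List ℕ, (∀ a ∈ l, a = 1 ∨ a = 3) →
      (l.map (4 - ·)).count 3 = l.count 1 ∧ (l.map (4 - ·)).count 1 = l.count 3 := by
    intro l hl
    induction l with
    | nil => simp
    | cons a l ih =>
      obtain ⟨h3, h4⟩ := ih fun x hx => hl x (by simp [hx])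
      rcases hl a (by simp) with rfl | rfl <;> simp [h3, h4]
  obtain ⟨h3, h4⟩ := key _ (h₁ d)
  rw [bendTurn, bendTurn, h₂, List.count_reverse, List.count_reverse, h3, h4]
  ring

/-- The condition on the angles in a face, in terms of the weights of its darts. -/
theorem faceAngles_eq [Finite (Dart G)] (ha : ∀ d, M.angle d ∈ ({1, 2, 3, 4} : Set ℕ))
    (hb : ∀ d, ∀ a ∈ M.bends d, a = 1 ∨ a = 3) (d : Dart G) :
    (M.faceAngles d 1 : ℤ) - M.faceAngles d 3 - 2 * M.faceAngles d 4 =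
      - ∑ᶠ x ∈ M.face d, M.weight x := by
  classical
  have hfin := Set.toFinite (M.face d)
  have h1 : ∀ a, M.faceAngles d a = ∑ x ∈ hfin.toFinset,
      ((if M.angle x.rev = a then 1 else 0) + (M.bends x).count a) := fun a => by
    rw [faceAngles, finsum_mem_eq_finite_toFinset_sum _ hfin]
  rw [finsum_mem_eq_finite_toFinset_sum _ hfin, h1, h1, h1]
  push_cast
  rw [Finset.mul_sum, ← Finset.sum_sub_distrib, ← Finset.sum_sub_distrib, ← Finset.sum_neg_distrib]
  refine Finset.sum_congr rfl fun x _ => ?_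
  have h4 : (M.bends x).count 4 = 0 := List.count_eq_zero.2 fun hm => by
    rcases hb x 4 hm with h | h <;> omega
  rw [weight, bendTurn, h4]
  have hx := ha x.rev
  simp only [Set.mem_insert_iff, Set.mem_singleton_iff] at hx
  rcases hx with h | h | h | h <;> rw [h] <;> norm_num <;> ring

theorem LabeledMap.IsOrthogonalRep.isRotation {o : Dart G} (h : M.IsOrthogonalRep o) : M.IsRotation :=
  ⟨h.cw_fst, h.cw_trans⟩

theorem cast_sum_dartsAt [Finite (Dart G)] (M : LabeledMap G) (d : Dart G) :
    ∑ᶠ x ∈ {x : Dart G | d.fst = x.fst}, (M.angle x : ℤ) =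
      ((∑ᶠ x ∈ dartsAt G d.fst, M.angle x : ℕ) : ℤ) := by
  have h1 : {x : Dart G | d.fst = x.fst} = dartsAt G d.fst := by
    ext x
    exact eq_comm
  rw [h1, finsum_mem_eq_finite_toFinset_sum _ (Set.toFinite _),
    finsum_mem_eq_finite_toFinset_sum _ (Set.toFinite _), Nat.cast_sum]

theorem LabeledMap.IsOrthogonalRep.isDrawing [Finite (Dart G)] {o : Dart G} (h : M.IsOrthogonalRep o)
    (hl : ∀ d : Dart G, d.fst ≠ d.snd) (hV : ∀ x ∈ G.vertexSet, ∃ d : Dart G, d.fst = x) :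
    M.IsDrawing where
  toIsRotation := h.isRotation
  euler := by
    have := h.planar
    rw [numClasses_perm _ hV, numClasses_facePerm, card_dart hl]
    omega
  angle_pos d := by
    have hd := h.angle_mem d
    simp only [Set.mem_insert_iff, Set.mem_singleton_iff] at hd
    omega
  bendTurn_rev := bendTurn_rev_of h.bends_mem h.bends_rev
  vertex d := by
    rw [cast_sum_dartsAt, h.vertex_sum _ d.fst_mem]
    rfl

theorem LabeledMap.IsOrthogonalRep.sum_weight [Finite (Dart G)] {o : Dart G} (h : M.IsOrthogonalRep o)
    (d : Dart G) [Decidable (d ∈ M.face o)] :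
    ∑ᶠ x ∈ M.face d, M.weight x = if d ∈ M.face o then 4 else -4 := by
  have h1 := h.face_sum d
  rw [faceAngles_eq h.angle_mem h.bends_mem] at h1
  split_ifs at h1 ⊢ <;> omega

/-- The Euler formula follows from the sums of the angles. -/
theorem isOrthogonalRep_of_sums [Finite (Dart G)] {o : Dart G} (h : M.IsRotation)
    (hl : ∀ d : Dart G, d.fst ≠ d.snd) (hV : ∀ x ∈ G.vertexSet, ∃ d : Dart G, d.fst = x)
    (ha : ∀ d, M.angle d ∈ ({1, 2, 3, 4} : Set ℕ)) (hb : ∀ d, ∀ a ∈ M.bends d, a = 1 ∨ a = 3)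
    (hb' : ∀ d, M.bends d.rev = ((M.bends d).map (4 - ·)).reverse)
    (hv : ∀ d : Dart G, ∑ᶠ x ∈ {x : Dart G | d.fst = x.fst}, (M.angle x : ℤ) = 4)
    (ho : ∑ᶠ x ∈ M.face o, M.weight x = 4)
    (hf : ∀ d, d ∉ M.face o → ∑ᶠ x ∈ M.face d, M.weight x = -4) : M.IsOrthogonalRep o where
  cw_fst := h.fst
  cw_trans := h.trans
  planar := by
    classical
    have := Fintype.ofFinite (Dart G)
    have hconv : ∀ (s : Setoid (Dart G)) (g : Dart G → ℤ) (d : Dart G),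
        ∑ y with s d y, g y = ∑ᶠ y ∈ {y | s d y}, g y := by
      intro s g d
      rw [← finsum_mem_coe_finset]
      exact finsum_mem_congr (by ext y; simp) fun _ _ => rfl
    have hface : ∀ d, {y | SameCycle.setoid h.facePerm d y} = M.face d := fun d => by
      ext y
      exact (h.mem_face d y).symm
    have hvert : ∀ d, {y | SameCycle.setoid h.perm d y} = {y : Dart G | d.fst = y.fst} :=
      fun d => by
        ext y
        exact h.sameCycle_perm_iff d y
    -- All weights add up to `8 - 4F`, all angles to `4V`, and the two totals differ by 2 per dart,
    -- that is, by `4E`. This is Euler's formula.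
    have h1 := sum_eq_of_classes (SameCycle.setoid h.facePerm) M.weight o (-4) 4
      (by rw [hconv, hface, ho]) (fun x hx => by
        rw [hconv, hface, hf]
        exact fun hm => hx ((h.mem_face o x).1 hm))
    have h2 := sum_eq_of_classes (SameCycle.setoid h.perm) (fun d => (M.angle d : ℤ)) o 4 4
      (by rw [hconv, hvert, hv]) (fun x _ => by rw [hconv, hvert, hv])
    have h3 : ∑ d, M.weight d = ∑ d, (M.angle d : ℤ) - 2 * Nat.card (Dart G) := by
      have h4 : ∑ d : Dart G, (M.angle d.rev : ℤ) = ∑ d, (M.angle d : ℤ) :=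
        Finset.sum_nbij' Dart.rev Dart.rev (by simp) (by simp) (by simp) (by simp) (by simp)
      have h5 : ∑ d, M.bendTurn d = 0 :=
        sum_eq_zero_of_antisymm (by simp) (bendTurn_rev_of hb hb')
      simp only [weight, Finset.sum_add_distrib, Finset.sum_sub_distrib, h4, h5, Finset.sum_const,
        nsmul_eq_mul, Finset.card_univ, Nat.card_eq_fintype_card]
      ring
    rw [numClasses_perm h hV] at h2
    rw [numClasses_facePerm] at h1
    rw [card_dart hl] at h3
    push_cast at h3
    zify
    linarith
  angle_mem := ha
  bends_mem := hb
  bends_rev := hb'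
  vertex_sum x hx := by
    obtain ⟨d, rfl⟩ := hV x hx
    have := hv d
    rw [cast_sum_dartsAt] at this
    exact_mod_cast this
  face_sum d := by
    rw [faceAngles_eq ha hb]
    split_ifs with hd
    · rw [h.face_eq hd, ho]
    · rw [hf d hd]; rfl

end Representation

end SPOrtho

namespace SPOrtho

/-! ### Gluing two rotation systems along a component -/

section Glue

open LabeledMap

variable {V E : Type*} {G : Graph V E}

/-- The clockwise order of `S` is the one of `M'` on `X` and the one of `M` off `X`, and the blocks
of `X` at the poles replace each other. -/
structure LabeledMap.IsGlued (S M M' : LabeledMap G) (X : Set (Dart G)) : Prop where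
  inside : ∀ d ∈ X, M'.cw d ∈ X → S.cw d = M'.cw d
  exit : ∀ d ∈ X, M'.cw d ∉ X → ∀ x ∈ X, x.fst = d.fst → M.cw x ∉ X → S.cw d = M.cw x
  outside : ∀ d ∉ X, M.cw d ∉ X → S.cw d = M.cw d
  entry : ∀ d ∉ X, M.cw d ∈ X → ∀ x ∉ X, x.fst = d.fst → M'.cw x ∈ X → S.cw d = M'.cw x

variable {S M M' : LabeledMap G} {X : Set (Dart G)}

/-- Gluing treats inside and outside alike, so each statement about the inside also yields its
counterpart about the outside. -/
theorem LabeledMap.IsGlued.symm (h : S.IsGlued M M' X) : S.IsGlued M' M Xᶜ where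
  inside d hd hd' := h.outside d hd hd'
  exit d hd hd' x hx e hx' := h.entry d hd (not_not.1 hd') x hx e (not_not.1 hx')
  outside d hd hd' := h.inside d (not_not.1 hd) (not_not.1 hd')
  entry d hd hd' x hx e hx' := h.exit d (not_not.1 hd) hd' x (not_not.1 hx) e hx'

theorem exists_last_mem {α : Type*} {f : α → α} {Y : Set α} {x : α} (hx : x ∈ Y) {n : ℕ}
    (hn : f^[n] x ∉ Y) : ∃ k, (∀ i ≤ k, f^[i] x ∈ Y) ∧ f (f^[k] x) ∉ Y := by
  classical
  have hex : ∃ n, f^[n + 1] x ∉ Y := by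
    rcases n with _ | n
    · exact absurd hx hn
    · exact ⟨n, hn⟩
  refine ⟨Nat.find hex, fun i hi => ?_, ?_⟩
  · rcases i with _ | i
    · exact hx
    · exact not_not.1 (Nat.find_min hex (m := i) (by omega))
  · rw [← Function.iterate_succ_apply' f]
    exact Nat.find_spec hex

theorem LabeledMap.IsRotation.exists_exit (h : M.IsRotation) {d d' : Dart G} (hd : d ∈ X)
    (hd' : d' ∉ X) (e : d.fst = d'.fst) :
    ∃ n, (∀ i ≤ n, M.cw^[i] d ∈ X) ∧ M.cw (M.cw^[n] d) ∉ X := by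
  obtain ⟨n, hn⟩ := h.trans d d' e
  exact exists_last_mem hd (n := n) (by rwa [hn])

theorem LabeledMap.IsRotation.exists_entry (h : M.IsRotation) {d d' : Dart G} (hd : d ∉ X)
    (hd' : d' ∈ X) (e : d.fst = d'.fst) : ∃ c ∉ X, c.fst = d.fst ∧ M.cw c ∈ X := by
  obtain ⟨n, h1, h2⟩ := h.exists_exit (X := Xᶜ) hd (not_not.2 hd') e
  exact ⟨_, h1 n le_rfl, h.iterate_fst n d, not_not.1 h2⟩

/-- Within the block of `X` at a vertex, every dart comes after the first one. -/
theorem LabeledMap.IsRotation.exists_run [Finite (Dart G)] (h : M.IsRotation) (hB : M.IsBlock X)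
    {c d : Dart G} (hc : c ∉ X) (hcX : M.cw c ∈ X) (hd : d ∈ X) (e : c.fst = d.fst) :
    ∃ n, M.cw^[n] (M.cw c) = d ∧ ∀ i ≤ n, M.cw^[i] (M.cw c) ∈ X := by
  obtain ⟨K, hK, hKt, hmin⟩ := h.exists_first e
  refine ⟨K - 1, ?_, ?_⟩
  · rw [← Function.iterate_succ_apply, Nat.succ_eq_add_one, Nat.sub_add_cancel hK, hKt]
  · intro i hi
    by_contra hcon
    rw [← Function.iterate_succ_apply] at hcon
    obtain ⟨k, h1, h2⟩ := exists_last_mem (f := M.cw) (Y := Xᶜ) (x := M.cw^[i + 1] c)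
      hcon (n := K - (i + 1)) (by
        rw [← Function.iterate_add_apply, Nat.sub_add_cancel (by omega), hKt]
        exact not_not.2 hd)
    have hlt : k < K - (i + 1) := by
      by_contra hle
      have := h1 (K - (i + 1)) (by omega)
      rw [← Function.iterate_add_apply, Nat.sub_add_cancel (by omega), hKt] at this
      exact this hd
    have h3 := h1 k le_rfl
    rw [← Function.iterate_add_apply] at h2 h3
    have := hB.entry _ h3 c hc (h.iterate_fst _ _) (not_not.1 h2) hcX
    exact iterate_ne_of_first hKt hmin (i := k + (i + 1)) (by omega) (by omega) this

theorem LabeledMap.IsGlued.iterate (h : S.IsGlued M M' X) {d : Dart G} {n : ℕ}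
    (hn : ∀ i ≤ n, M'.cw^[i] d ∈ X) : ∀ i ≤ n, S.cw^[i] d = M'.cw^[i] d := by
  intro i
  induction i with
  | zero => exact fun _ => rfl
  | succ i ih =>
    intro hi
    rw [Function.iterate_succ_apply', Function.iterate_succ_apply', ih (by omega)]
    refine h.inside _ (hn i (by omega)) ?_
    rw [← Function.iterate_succ_apply' M'.cw]
    exact hn _ hi

theorem LabeledMap.IsGlued.iterate_face (h : S.IsGlued M M' X) (hX : ∀ d ∈ X, d.rev ∈ X)
    {d : Dart G} {n : ℕ} (hn : ∀ i ≤ n, M'.faceNext^[i] d ∈ X) :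
    ∀ i ≤ n, S.faceNext^[i] d = M'.faceNext^[i] d := by
  intro i
  induction i with
  | zero => exact fun _ => rfl
  | succ i ih =>
    intro hi
    rw [Function.iterate_succ_apply', Function.iterate_succ_apply', ih (by omega)]
    refine h.inside _ (hX _ (hn i (by omega))) ?_
    have := hn _ hi
    rwa [Function.iterate_succ_apply'] at this

/-- Follow `M'` to the end of the inner block, step to the first dart of the outer block of `M`, and
run through that block, which contains every outer dart at the vertex. -/
theorem LabeledMap.IsGlued.exists_iterate [Finite (Dart G)] (h : S.IsGlued M M' X)
    (hM : M.IsRotation) (hM' : M'.IsRotation) (hB : M.IsBlock X) {d d' : Dart G} (hd : d ∈ X)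
    (hd' : d' ∉ X) (e : d.fst = d'.fst) : ∃ n, S.cw^[n] d = d' := by
  obtain ⟨n, h1, h2⟩ := hM'.exists_exit hd hd' e
  obtain ⟨m, h3, h4⟩ := hM.exists_exit hd hd' e
  obtain ⟨k, h5, h6⟩ := hM.exists_run (X := Xᶜ) hB.compl (c := M.cw^[m] d)
    (not_not.2 (h3 m le_rfl)) h4 hd' ((hM.iterate_fst m d).trans e)
  refine ⟨k + (n + 1), ?_⟩
  rw [Function.iterate_add_apply, Function.iterate_succ_apply', h.iterate h1 n le_rfl,
    h.exit _ (h1 n le_rfl) h2 _ (h3 m le_rfl) ((hM.iterate_fst m d).trans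
      (hM'.iterate_fst n d).symm) h4, h.symm.iterate h6 k le_rfl, h5]

theorem LabeledMap.IsGlued.isRotation [Finite (Dart G)] (h : S.IsGlued M M' X)
    (hM : M.IsRotation) (hM' : M'.IsRotation) (hB : M.IsBlock X) (hB' : M'.IsBlock X) :
    S.IsRotation := by
  have hfst : ∀ {S M M' : LabeledMap G} {X : Set (Dart G)}, S.IsGlued M M' X → M.IsRotation →
      M'.IsRotation → ∀ d ∈ X, (S.cw d).fst = d.fst := by
    intro S M M' X h hM hM' d hd
    by_cases hd' : M'.cw d ∈ X
    · rw [h.inside d hd hd', hM'.fst]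
    · obtain ⟨n, h1, h2⟩ := hM.exists_exit hd hd' (hM'.fst d).symm
      rw [h.exit d hd hd' _ (h1 n le_rfl) (hM.iterate_fst n d) h2, hM.fst, hM.iterate_fst]
  have htr : ∀ {S M M' : LabeledMap G} {X : Set (Dart G)}, S.IsGlued M M' X → M.IsRotation →
      M'.IsRotation → M.IsBlock X → M'.IsBlock X → ∀ d ∈ X, ∀ d', d.fst = d'.fst →
      ∃ n, S.cw^[n] d = d' := by
    intro S M M' X h hM hM' hB hB' d hd d' e
    by_cases hd' : d' ∈ X
    · by_cases hex : ∃ w ∉ X, d.fst = w.fst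
      · obtain ⟨w, hw, ew⟩ := hex
        obtain ⟨n, hn⟩ := h.exists_iterate hM hM' hB hd hw ew
        obtain ⟨m, hm⟩ := h.symm.exists_iterate hM' hM hB'.compl (d := w) (d' := d') hw
          (not_not.2 hd') (ew.symm.trans e)
        exact ⟨m + n, by rw [Function.iterate_add_apply, hn, hm]⟩
      · obtain ⟨n, hn⟩ := hM'.trans d d' e
        refine ⟨n, ?_⟩
        rw [h.iterate (n := n) _ n le_rfl, hn]
        intro i _
        by_contra hcon
        exact hex ⟨_, hcon, (hM'.iterate_fst i d).symm⟩
    · exact h.exists_iterate hM hM' hB hd hd' e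
  refine ⟨fun d => ?_, fun d d' e => ?_⟩
  · by_cases hd : d ∈ X
    · exact hfst h hM hM' d hd
    · exact hfst h.symm hM' hM d hd
  · by_cases hd : d ∈ X
    · exact htr h hM hM' hB hB' d hd d' e
    · exact htr h.symm hM' hM hB'.compl hB.compl d hd d' e

/-! ### The substitution of a component -/

theorem lastBefore_spec {α : Type*} {f : α → α} {Y : Set α} {x : α} (hx : x ∉ Y)
    (hex : ∃ k, f^[k + 1] x ∈ Y) :
    lastBefore f Y x ∉ Y ∧ f (lastBefore f Y x) ∈ Y ∧ ∃ k, lastBefore f Y x = f^[k] x := by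
  have h1 : sInf {k : ℕ | f^[k + 1] x ∈ Y} ∈ {k : ℕ | f^[k + 1] x ∈ Y} := Nat.sInf_mem hex
  refine ⟨?_, ?_, _, rfl⟩
  · rw [lastBefore]
    rcases hk : sInf {k : ℕ | f^[k + 1] x ∈ Y} with _ | k
    · exact hx
    · exact fun hm => Nat.notMem_of_lt_sInf (by rw [hk]; exact k.lt_succ_self) hm
  · rw [lastBefore, ← Function.iterate_succ_apply' f]
    exact h1

theorem LabeledMap.IsRotation.lastBefore_eq (h : M.IsRotation) (hB : M.IsBlock X)
    {d x : Dart G} (hd : d ∈ X) (hx : x ∈ X) (e : x.fst = d.fst) (hxX : M.cw x ∉ X) :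
    lastBefore M.cw Xᶜ d = x := by
  obtain ⟨n, h1, h2⟩ := h.exists_exit hd hxX (e.symm.trans (h.fst x).symm)
  obtain ⟨h3, h4, k, h5⟩ := lastBefore_spec (f := M.cw) (Y := Xᶜ) (x := d) (not_not.2 hd)
    ⟨n, by rw [Function.iterate_succ_apply']; exact h2⟩
  exact hB.exit _ (not_not.1 h3) x hx (by rw [h5, h.iterate_fst, e]) h4 hxX

theorem LabeledMap.IsRotation.lastBefore_eq' (h : M.IsRotation) (hB : M.IsBlock X)
    {d x : Dart G} (hd : d ∉ X) (hx : x ∉ X) (e : x.fst = d.fst) (hxX : M.cw x ∈ X) :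
    lastBefore M.cw X d = x := by
  have := h.lastBefore_eq hB.compl hd hx e (not_not.2 hxX)
  rwa [compl_compl] at this

variable {ν : SPQTree G}

theorem isGlued_sub (hM : M.IsRotation) (hM' : M'.IsRotation) (hB : M.IsBlock ν.darts)
    (hB' : M'.IsBlock ν.darts) : (M.sub M' ν).IsGlued M M' ν.darts where
  inside d hd hd' := by simp only [sub, if_pos hd, if_pos hd']
  exit d hd hd' x hx e hx' := by
    simp only [sub, if_pos hd, if_neg hd', hM.lastBefore_eq hB hd hx e hx']
  outside d hd hd' := by simp only [sub, if_neg hd, if_neg hd']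
  entry d hd hd' x hx e hx' := by
    simp only [sub, if_neg hd, if_pos hd', hM'.lastBefore_eq' hB' hd hx e hx']

theorem sub_angle_inside {d : Dart G} (hd : d ∈ ν.darts) (hd' : M'.cw d ∈ ν.darts) :
    (M.sub M' ν).angle d = M'.angle d := by simp only [sub, if_pos hd, if_pos hd']

theorem sub_angle_outside {d : Dart G} (hd : d ∉ ν.darts) (hd' : M.cw d ∉ ν.darts) :
    (M.sub M' ν).angle d = M.angle d := by simp only [sub, if_neg hd, if_neg hd']

theorem sub_angle_exit (hM : M.IsRotation) (hB : M.IsBlock ν.darts) {d x : Dart G}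
    (hd : d ∈ ν.darts) (hd' : M'.cw d ∉ ν.darts) (hx : x ∈ ν.darts) (e : x.fst = d.fst)
    (hx' : M.cw x ∉ ν.darts) :
    (M.sub M' ν).angle d = if ν.indeg d.fst = 1 then M.angle x else M'.angle d := by
  simp only [sub, if_pos hd, if_neg hd', hM.lastBefore_eq hB hd hx e hx']

theorem sub_angle_entry (hM' : M'.IsRotation) (hB' : M'.IsBlock ν.darts) {d x : Dart G}
    (hd : d ∉ ν.darts) (hd' : M.cw d ∈ ν.darts) (hx : x ∉ ν.darts) (e : x.fst = d.fst)
    (hx' : M'.cw x ∈ ν.darts) :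
    (M.sub M' ν).angle d = if ν.indeg d.fst = 1 then M.angle d else M'.angle x := by
  simp only [sub, if_neg hd, if_pos hd', hM'.lastBefore_eq' hB' hd hx e hx']

theorem sub_bendTurn_inside {d : Dart G} (hd : d ∈ ν.darts) :
    (M.sub M' ν).bendTurn d = M'.bendTurn d := by simp only [bendTurn, sub, if_pos hd]

theorem sub_bendTurn_outside {d : Dart G} (hd : d ∉ ν.darts) :
    (M.sub M' ν).bendTurn d = M.bendTurn d := by simp only [bendTurn, sub, if_neg hd]

theorem sub_angle_or (d : Dart G) :
    (∃ x, (M.sub M' ν).angle d = M.angle x) ∨ ∃ x, (M.sub M' ν).angle d = M'.angle x := by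
  simp only [sub]
  split_ifs <;> first | exact Or.inl ⟨_, rfl⟩ | exact Or.inr ⟨_, rfl⟩

/-- The angles of the substitution at a vertex are all those of `M` or all those of `M'`. -/
theorem sub_angle_at [Finite (Dart G)] (hM : M.IsDrawing) (hM' : M'.IsDrawing)
    (hB : M.IsBlock ν.darts) (hB' : M'.IsBlock ν.darts) (w : V) :
    (∀ d : Dart G, d.fst = w → (M.sub M' ν).angle d = M.angle d) ∨
      ∀ d : Dart G, d.fst = w → (M.sub M' ν).angle d = M'.angle d := by
  by_cases hout : ∀ d : Dart G, d.fst = w → d ∈ ν.darts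
  · exact Or.inr fun d hd => sub_angle_inside (hout d hd) (hout _ ((hM'.fst d).trans hd))
  by_cases hin : ∀ d : Dart G, d.fst = w → d ∉ ν.darts
  · exact Or.inl fun d hd => sub_angle_outside (hin d hd) (hin _ ((hM.fst d).trans hd))
  push Not at hin hout
  obtain ⟨p, hpw, hp⟩ := hin
  obtain ⟨q, hqw, hq⟩ := hout
  have hpq := hpw.trans hqw.symm
  obtain ⟨n, hx, hxX⟩ := hM.exists_exit hp hq hpq
  have hx := hx n le_rfl
  have hxw := (hM.iterate_fst n p).trans hpw
  set x := M.cw^[n] p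
  obtain ⟨c, hc, hcw, hcX⟩ := hM'.exists_entry hq hp hpq.symm
  have hcw := hcw.trans hqw
  -- With one inner dart there is no angle inside the component, and both corners are those of `M`.
  by_cases hdeg : ν.indeg w = 1
  · left
    intro d hd
    by_cases hdX : d ∈ ν.darts
    · have hdx : d = x := eq_of_indeg_eq_one hdeg hdX hx hd hxw
      have h1 : M'.cw d ∉ ν.darts := fun hm => hM'.cw_ne_self (hd.trans hqw.symm)
        (fun e => hq (e ▸ hdX)) (eq_of_indeg_eq_one hdeg hm hdX ((hM'.fst d).trans hd) hd)
      rw [sub_angle_exit hM.toIsRotation hB hdX h1 hx (hxw.trans hd.symm) hxX,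
        if_pos (by rwa [hd]), hdx]
    · by_cases h1 : M.cw d ∈ ν.darts
      · rw [sub_angle_entry hM'.toIsRotation hB' hdX h1 hc (hcw.trans hd.symm) hcX,
          if_pos (by rwa [hd])]
      · exact sub_angle_outside hdX h1
  have hpos : 0 < ν.indeg w := hpw ▸ indeg_pos hp
  have hinX : ∀ d ∈ ν.darts, d.fst = w → (M.sub M' ν).angle d = M'.angle d := by
    intro d hdX hd
    by_cases h1 : M'.cw d ∈ ν.darts
    · exact sub_angle_inside hdX h1
    · rw [sub_angle_exit hM.toIsRotation hB hdX h1 hx (hxw.trans hd.symm) hxX,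
        if_neg (by rwa [hd])]
  -- With one outer dart there is no angle outside the component, and both corners are those of
  -- `M'`. With more outer dart the degree is at least four, so both drawings have only right angles
  -- there.
  by_cases hone : (aliases ν w).ncard ≤ 1
  · right
    intro d hd
    by_cases hdX : d ∈ ν.darts
    · exact hinX d hdX hd
    have hal : ∀ z ∉ ν.darts, z.fst = w → z = c := by
      intro z hz hzw
      rw [Set.ncard_le_one_iff (Set.toFinite _), aliases_of_indeg_ne hdeg] at hone
      exact Option.some_injective _ (hone ⟨z, ⟨hzw, hz⟩, rfl⟩ ⟨c, ⟨hcw, hc⟩, rfl⟩)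
    have h1 : M.cw d ∈ ν.darts := by
      by_contra hcon
      exact hM.cw_ne_self (hd.trans hpw.symm) (fun e => hdX (e ▸ hp))
        ((hal _ hcon ((hM.fst d).trans hd)).trans (hal d hdX hd).symm)
    rw [sub_angle_entry hM'.toIsRotation hB' hdX h1 hc (hcw.trans hd.symm) hcX,
      if_neg (by rwa [hd]), hal d hdX hd]
  · left
    have hcard := indeg_add_aliases hdeg
    have hM1 : ∀ z : Dart G, z.fst = w → M.angle z = 1 := fun z hz =>
      hM.angle_eq_one (by rw [hz]; omega)
    have hM1' : ∀ z : Dart G, z.fst = w → M'.angle z = 1 := fun z hz =>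
      hM'.angle_eq_one (by rw [hz]; omega)
    intro d hd
    rw [hM1 d hd]
    by_cases hdX : d ∈ ν.darts
    · rw [hinX d hdX hd, hM1' d hd]
    · by_cases h1 : M.cw d ∈ ν.darts
      · rw [sub_angle_entry hM'.toIsRotation hB' hdX h1 hc (hcw.trans hd.symm) hcX,
          if_neg (by rwa [hd]), hM1' c hcw]
      · rw [sub_angle_outside hdX h1, hM1 d hd]

end Glue

end SPOrtho

namespace SPOrtho

/-! ### The faces of the substitution -/

section Faces

open LabeledMap

variable {V E : Type*} {G : Graph V E} {M M' : LabeledMap G} {X : Set (Dart G)} {ν : SPQTree G}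

/-- An orbit that consists of a run inside `Y` and a run outside `Y`. -/
theorem orbit_two_runs {α : Type*} {f : α → α} (hf : Function.Injective f) {x z : α} {n m : ℕ}
    {Y : Set α} (h₁ : ∀ i ≤ n, f^[i] x ∈ Y) (hxz : f (f^[n] x) = z) (h₂ : ∀ j ≤ m, f^[j] z ∉ Y)
    (hzx : f (f^[m] z) = x) :
    (∀ g : α → ℤ, ∑ᶠ w ∈ {w | ∃ k : ℕ, f^[k] x = w}, g w =
      ∑ i ∈ Finset.range (n + 1), g (f^[i] x) + ∑ j ∈ Finset.range (m + 1), g (f^[j] z)) ∧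
    ∀ w, (∃ k : ℕ, f^[k] x = w) ↔ (∃ i ≤ n, f^[i] x = w) ∨ ∃ j ≤ m, f^[j] z = w := by
  have hadd : ∀ j, f^[n + 1 + j] x = f^[j] z := fun j => by
    rw [add_comm, Function.iterate_add_apply, Function.iterate_succ_apply', hxz]
  have hret : f^[n + 1 + (m + 1)] x = x := by
    rw [hadd, Function.iterate_succ_apply', hzx]
  have hne : ∀ i, 0 < i → i < n + 1 + (m + 1) → f^[i] x ≠ x := by
    intro i h0 hi e
    rcases Nat.lt_or_ge i (n + 1) with hlt | hge
    · obtain ⟨i, rfl⟩ : ∃ j, i = j + 1 := ⟨i - 1, by omega⟩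
      rw [Function.iterate_succ_apply', ← hzx] at e
      have := hf e
      exact h₂ m le_rfl ((hzx ▸ this) ▸ h₁ i (by omega))
    · rw [show i = n + 1 + (i - (n + 1)) by omega, hadd] at e
      exact h₂ _ (by omega) (e ▸ h₁ 0 (by omega))
  constructor
  · intro g
    rw [finsum_orbit_eq (by omega) hret hne, Finset.sum_range_add]
    simp only [hadd]
  · intro w
    constructor
    · intro hw
      have : w ∈ (fun i => f^[i] x) '' (Finset.range (n + 1 + (m + 1))) := by
        rw [← (orbit_eq_image (by omega) hret hne).2]; exact hw
      obtain ⟨i, hi, rfl⟩ := this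
      have hi : i < n + 1 + (m + 1) := by simpa using hi
      rcases Nat.lt_or_ge i (n + 1) with hlt | hge
      · exact Or.inl ⟨i, by omega, rfl⟩
      · exact Or.inr ⟨i - (n + 1), by omega, by rw [← hadd, Nat.add_sub_cancel' hge]⟩
    · rintro (⟨i, -, h⟩ | ⟨j, -, h⟩)
      · exact ⟨i, h⟩
      · exact ⟨n + 1 + j, by rw [hadd, h]⟩

/-- A component is the single edge of `o`, or it does not contain this edge. -/
def IsSingleOrAvoids (X : Set (Dart G)) (o : Dart G) : Prop := o ∉ X ∨ ∀ d ∈ X, d = o ∨ d = o.rev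

theorem eq_of_single {o : Dart G}
    (ho : ∀ d ∈ X, d = o ∨ d = o.rev) (hl : o.fst ≠ o.snd) {d d' : Dart G} (hd : d ∈ X)
    (hd' : d' ∈ X) (e : d.fst = d'.fst) : d = d' := by
  rcases ho d hd with rfl | rfl <;> rcases ho d' hd' with rfl | rfl
  · rfl
  · exact absurd e hl
  · exact absurd e.symm hl
  · rfl

/-- Both ends of the single edge are poles, and each carries another dart outside; the rotation
cannot return to the only inner dart at once. -/
theorem Sep.cw_notMem_of_single {u v : V} (hS : Sep X u v) (h : M.IsRotation) {o : Dart G}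
    (ho : ∀ d ∈ X, d = o ∨ d = o.rev) (hl : o.fst ≠ o.snd) {d : Dart G} (hd : d ∈ X) :
    M.cw d ∉ X := by
  obtain ⟨p, hp, hpu⟩ := hS.left_in
  obtain ⟨q, hq, hqv⟩ := hS.right_in
  have hpq : p ≠ q := fun e => hS.ne (by rw [← hpu, ← hqv, e])
  have hdpq : d = p ∨ d = q := by
    rcases ho p hp with h1 | h1 <;> rcases ho q hq with h2 | h2 <;> rcases ho d hd with h3 | h3 <;>
      simp_all
  have hex : ∃ w ∉ X, d.fst = w.fst := by
    rcases hdpq with rfl | rfl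
    · obtain ⟨w, hw, hwu⟩ := hS.left_out
      exact ⟨w, hw, hpu.trans hwu.symm⟩
    · obtain ⟨w, hw, hwv⟩ := hS.right_out
      exact ⟨w, hw, hqv.trans hwv.symm⟩
  obtain ⟨w, hw, e⟩ := hex
  intro hm
  exact h.cw_ne_self e (fun e' => hw (e' ▸ hd)) (eq_of_single ho hl hm hd (h.fst d))

/-- No face inside a component contains the reference edge. -/
theorem Sep.notMem_face {u v : V} (hS : Sep X u v) (h : M.IsRotation) {o : Dart G}
    (ho : IsSingleOrAvoids X o) (hl : o.fst ≠ o.snd) {d : Dart G}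
    (hd : ∀ n, M.faceNext^[n] d ∈ X) : o ∉ M.face d := by
  rcases ho with ho | ho
  · rintro ⟨n, hn⟩
    exact ho (hn ▸ hd n)
  · exact absurd (hd 1) (hS.cw_notMem_of_single h ho hl (hS.rev_mem _ (hd 0)))

/-- The condition on the angles in the face of `d`, when `o` is on the external face. -/
def LabeledMap.FaceSum (M : LabeledMap G) (o d : Dart G) : Prop :=
  (o ∈ M.face d → ∑ᶠ x ∈ M.face d, M.weight x = 4) ∧
  (o ∉ M.face d → ∑ᶠ x ∈ M.face d, M.weight x = -4)

theorem LabeledMap.FaceSum.of_eq {o d d' : Dart G} (h : M.FaceSum o d)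
    (e : M.face d' = M.face d) : M.FaceSum o d' := by
  unfold LabeledMap.FaceSum
  rwa [e]

theorem sub_weight_inside (hX : ∀ d ∈ ν.darts, d.rev ∈ ν.darts) {d : Dart G} (hd : d ∈ ν.darts)
    (hd' : M'.faceNext d ∈ ν.darts) : (M.sub M' ν).weight d = M'.weight d := by
  rw [weight, weight, sub_angle_inside (hX d hd) hd', sub_bendTurn_inside hd]

theorem sub_weight_outside (hX : ∀ d ∈ ν.dartsᶜ, d.rev ∈ ν.dartsᶜ) {d : Dart G}
    (hd : d ∉ ν.darts) (hd' : M.faceNext d ∉ ν.darts) : (M.sub M' ν).weight d = M.weight d := by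
  rw [weight, weight, sub_angle_outside (hX d hd) hd', sub_bendTurn_outside hd]

/-- The face of the substitution on the left of the component. -/
theorem sub_face_left [Finite (Dart G)] (hM : M.IsDrawing) (hM' : M'.IsDrawing)
    (hbi : Biconnected G) (hl : ∀ d : Dart G, d.fst ≠ d.snd) {u v : V} (hS : Sep ν.darts u v)
    {o : Dart G} (ho : IsSingleOrAvoids ν.darts o) (hMo : ∀ d, M.FaceSum o d)
    (hfs : ∀ d, (∀ n, M'.faceNext^[n] d ∈ ν.darts) → ∑ᶠ x ∈ M'.face d, M'.weight x = -4)
    {τ : ℤ} (ht : M.HasTurning ν u v τ) (ht' : M'.HasTurning ν u v τ)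
    {c' y' : Dart G} (hc' : c' ∉ ν.darts) (hcu' : c'.fst = u) (hcX' : M'.cw c' ∈ ν.darts)
    (hy' : y' ∈ ν.darts) (hyv' : y'.fst = v) (hyX' : M'.cw y' ∉ ν.darts) :
    (M.sub M' ν).FaceSum o (M'.cw c') ∧ y'.rev ∈ (M.sub M' ν).face (M'.cw c') := by
  have hB := hM.isBlock hbi hl hS
  have hB' := hM'.isBlock hbi hl hS
  have hG := isGlued_sub hM.toIsRotation hM'.toIsRotation hB hB'
  have hSr := hG.isRotation hM.toIsRotation hM'.toIsRotation hB hB'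
  have hXc := hS.compl.rev_mem
  obtain ⟨p, hp, hpu⟩ := hS.left_in
  obtain ⟨q, hq, hqv⟩ := hS.right_in
  obtain ⟨q', hq', hqv'⟩ := hS.right_out
  obtain ⟨c, hc, hcu, hcX⟩ := hM.exists_entry hc' hp (hcu'.trans hpu.symm)
  have hcu := hcu.trans hcu'
  obtain ⟨k, hy, hyX⟩ := hM.exists_exit hq hq' (hqv.trans hqv'.symm)
  have hy := hy k le_rfl
  have hyv := (hM.iterate_fst k q).trans hqv
  set y := M.cw^[k] q
  obtain ⟨n, hn, hny⟩ := hM.exists_boundary hbi hl hS hc hcu hcX hy hyv hyX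
  obtain ⟨n', hn', hny'⟩ := hM'.exists_boundary hbi hl hS hc' hcu' hcX' hy' hyv' hyX'
  -- The outer part of the left face, from `v` back to `u`, is the left boundary of the complement
  -- with its poles exchanged.
  obtain ⟨m, hm, hmc⟩ := hM.exists_boundary hbi hl hS.compl.swap (c := y) (y := c)
    (not_not.2 hy) hyv hyX hc hcu (not_not.2 hcX)
  have hit := hG.iterate_face hS.rev_mem hn'
  have hit' := hG.symm.iterate_face hXc hm
  have hSy : (M.sub M' ν).faceNext y'.rev = M.cw y :=
    (congrArg _ y'.rev_rev).trans (hG.exit y' hy' hyX' y hy (hyv.trans hyv'.symm) hyX)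
  have hSc : (M.sub M' ν).faceNext c.rev = M'.cw c' :=
    (congrArg _ c.rev_rev).trans (hG.entry c hc hcX c' hc' (hcu'.trans hcu.symm) hcX')
  have hMy : M.faceNext y.rev = M.cw y := congrArg _ y.rev_rev
  have hMc : M.faceNext c.rev = M.cw c := congrArg _ c.rev_rev
  obtain ⟨hsum, hmem⟩ := orbit_two_runs (f := M.faceNext) hM.facePerm.injective
    hn (by rw [hny, hMy]) hm (by rw [hmc, hMc])
  obtain ⟨hsum', hmem'⟩ := orbit_two_runs (f := (M.sub M' ν).faceNext) (x := M'.cw c') (n := n')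
    (z := M.cw y) (m := m) (Y := ν.darts) hSr.facePerm.injective
    (fun i hi => by rw [hit i hi]; exact hn' i hi) (by rw [hit n' le_rfl, hny', hSy])
    (fun i hi => by rw [hit' i hi]; exact hm i hi) (by rw [hit' m le_rfl, hmc, hSc])
  -- Apart from replacing the inner run, the substitution changes the weights only at the corners at
  -- `u` and `v`. These corrections are the pole terms on the left of `boundary_eq`, whose right
  -- side is the same for `M` and `M'`.
  have hval : ∑ᶠ x ∈ (M.sub M' ν).face (M'.cw c'), (M.sub M' ν).weight x =
      ∑ᶠ x ∈ M.face (M.cw c), M.weight x := by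
    rw [face, face, hsum, hsum']
    have h1 : ∑ i ∈ Finset.range (n' + 1), (M.sub M' ν).weight ((M.sub M' ν).faceNext^[i] (M'.cw c'))
        = ∑ i ∈ Finset.range (n' + 1), M'.weight (M'.faceNext^[i] (M'.cw c')) +
          (if ν.indeg v = 1 then (M.angle y : ℤ) - M'.angle y' else 0) := by
      have e : (M.sub M' ν).weight y'.rev = M'.weight y'.rev +
          (if ν.indeg v = 1 then (M.angle y : ℤ) - M'.angle y' else 0) := by
        rw [weight, weight, Dart.rev_rev, sub_bendTurn_inside (hS.rev_mem _ hy'),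
          sub_angle_exit hM.toIsRotation hB hy' hyX' hy (hyv.trans hyv'.symm) hyX, hyv']
        split_ifs <;> ring
      rw [Finset.sum_range_succ, Finset.sum_range_succ, hit n' le_rfl, hny', e, ← add_assoc]
      congr 2
      refine Finset.sum_congr rfl fun i hi => ?_
      have hi := Finset.mem_range.1 hi
      rw [hit i hi.le, sub_weight_inside hS.rev_mem (hn' i hi.le)]
      rw [← Function.iterate_succ_apply' M'.faceNext]
      exact hn' _ hi
    have h2 : ∑ j ∈ Finset.range (m + 1), (M.sub M' ν).weight ((M.sub M' ν).faceNext^[j] (M.cw y))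
        = ∑ j ∈ Finset.range (m + 1), M.weight (M.faceNext^[j] (M.cw y)) +
          (if ν.indeg u = 1 then 0 else (M'.angle c' : ℤ) - M.angle c) := by
      have e : (M.sub M' ν).weight c.rev = M.weight c.rev +
          (if ν.indeg u = 1 then 0 else (M'.angle c' : ℤ) - M.angle c) := by
        rw [weight, weight, Dart.rev_rev, sub_bendTurn_outside (hXc _ hc),
          sub_angle_entry hM'.toIsRotation hB' hc hcX hc' (hcu'.trans hcu.symm) hcX', hcu]
        split_ifs <;> ring
      rw [Finset.sum_range_succ, Finset.sum_range_succ, hit' m le_rfl, hmc, e, ← add_assoc]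
      congr 2
      refine Finset.sum_congr rfl fun i hi => ?_
      have hi := Finset.mem_range.1 hi
      rw [hit' i hi.le, sub_weight_outside hXc (hm i hi.le)]
      rw [← Function.iterate_succ_apply' M.faceNext]
      exact hm _ hi
    have h3 := hM.boundary_eq hbi hl hS
      (fun d hd => (hMo d).2 (hS.notMem_face hM.toIsRotation ho (hl o) hd)) ht
      hc hcu hcX hy hyv hyX hn hny
    have h4 := hM'.boundary_eq hbi hl hS hfs ht' hc' hcu' hcX' hy' hyv' hyX' hn' hny'
    rw [h1, h2]
    split_ifs at h3 h4 ⊢ <;> linarith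
  -- The inner run matters for the external face only if it contains `o`. Then the component is a
  -- single edge, and both inner runs consist of the same dart.
  have hoo : o ∈ (M.sub M' ν).face (M'.cw c') ↔ o ∈ M.face (M.cw c) := by
    refine (hmem' o).trans (Iff.trans ?_ (hmem o).symm)
    have hiff : (∃ i ≤ n', (M.sub M' ν).faceNext^[i] (M'.cw c') = o) ↔
        ∃ i ≤ n, M.faceNext^[i] (M.cw c) = o := by
      rcases ho with ho | ho
      · constructor
        · rintro ⟨i, hi, rfl⟩
          exact absurd (hn' i hi) (by rwa [← hit i hi])
        · rintro ⟨i, hi, rfl⟩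
          exact absurd (hn i hi) ho
      · have hz : n = 0 := by
          by_contra h0
          exact hS.cw_notMem_of_single hM.toIsRotation ho (hl o) (hS.rev_mem _ hcX)
            (hn 1 (by omega))
        have hz' : n' = 0 := by
          by_contra h0
          exact hS.cw_notMem_of_single hM'.toIsRotation ho (hl o) (hS.rev_mem _ hcX')
            (hn' 1 (by omega))
        have hcc : M'.cw c' = M.cw c := eq_of_single ho (hl o) hcX' hcX (by
          rw [hM.fst, hM'.fst, hcu, hcu'])
        subst hz hz'
        simp [hcc]
    rw [hiff]
    refine or_congr_right (exists_congr fun j => and_congr_right fun hj => ?_)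
    rw [hit' j hj]
  refine ⟨?_, n', by rw [hit n' le_rfl, hny']⟩
  have := hMo (M.cw c)
  unfold LabeledMap.FaceSum at this ⊢
  rwa [hval, hoo]

/-- A face of the substitution stays inside, stays outside, or crosses between the two at a pole. In
the last case it is the left face for the poles in one of their two orders. -/
theorem sub_faceSum [Finite (Dart G)] (hM : M.IsDrawing) (hM' : M'.IsDrawing)
    (hbi : Biconnected G) (hl : ∀ d : Dart G, d.fst ≠ d.snd) {u v : V} (hS : Sep ν.darts u v)
    {o o' : Dart G} (ho : IsSingleOrAvoids ν.darts o) (ho' : IsSingleOrAvoids ν.darts o')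
    (hMo : ∀ d, M.FaceSum o d) (hMo' : ∀ d, M'.FaceSum o' d)
    {τ : ℤ} (ht : M.HasTurning ν u v τ) (ht' : M'.HasTurning ν u v τ) (d : Dart G) :
    (M.sub M' ν).FaceSum o d := by
  have hB := hM.isBlock hbi hl hS
  have hB' := hM'.isBlock hbi hl hS
  have hG := isGlued_sub hM.toIsRotation hM'.toIsRotation hB hB'
  have hSr := hG.isRotation hM.toIsRotation hM'.toIsRotation hB hB'
  have hXc := hS.compl.rev_mem
  have hfs : ∀ d, (∀ n, M'.faceNext^[n] d ∈ ν.darts) → ∑ᶠ x ∈ M'.face d, M'.weight x = -4 :=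
    fun d hd => (hMo' d).2 (hS.notMem_face hM'.toIsRotation ho' (hl o') hd)
  -- the faces through the component
  have hleft : ∀ {u v : V} {τ : ℤ}, Sep ν.darts u v → M.HasTurning ν u v τ →
      M'.HasTurning ν u v τ → ∃ c', c' ∉ ν.darts ∧ c'.fst = u ∧ M'.cw c' ∈ ν.darts ∧
      (M.sub M' ν).FaceSum o (M'.cw c') ∧ ∀ z ∈ ν.darts, z.fst = v → M'.cw z ∉ ν.darts →
        z.rev ∈ (M.sub M' ν).face (M'.cw c') := by
    intro u v τ hS ht ht'
    obtain ⟨p, hp, hpu⟩ := hS.left_in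
    obtain ⟨p', hp', hpu'⟩ := hS.left_out
    obtain ⟨q, hq, hqv⟩ := hS.right_in
    obtain ⟨q', hq', hqv'⟩ := hS.right_out
    obtain ⟨c', hc', hcu', hcX'⟩ := hM'.exists_entry hp' hp (hpu'.trans hpu.symm)
    obtain ⟨k, hy', hyX'⟩ := hM'.exists_exit hq hq' (hqv.trans hqv'.symm)
    have hmain := fun z hz hzv hzX => sub_face_left hM hM' hbi hl hS ho hMo hfs ht ht' hc'
      (hcu'.trans hpu') hcX' (y' := z) hz hzv hzX
    exact ⟨c', hc', hcu'.trans hpu', hcX',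
      (hmain _ (hy' k le_rfl) ((hM'.iterate_fst k q).trans hqv) hyX').1,
      fun z hz hzv hzX => (hmain z hz hzv hzX).2⟩
  -- The face on the right is the left face after exchanging the poles, and both turnings change
  -- sign together.
  have ht₁ := ht.swap hM hS.ne hS.rev_mem
  have ht₁' := ht'.swap hM' hS.ne hS.rev_mem
  by_cases hd : d ∈ ν.darts
  · by_cases hall : ∀ n, M'.faceNext^[n] d ∈ ν.darts
    · have hf : (M.sub M' ν).face d = M'.face d := by
        ext x
        refine exists_congr fun n => ?_
        rw [hG.iterate_face hS.rev_mem (fun i _ => hall i) n le_rfl]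
      have hw : ∑ᶠ x ∈ M'.face d, (M.sub M' ν).weight x = -4 := by
        rw [← hfs d hall]
        refine finsum_mem_congr rfl ?_
        rintro x ⟨n, rfl⟩
        refine sub_weight_inside hS.rev_mem (hall n) ?_
        rw [← Function.iterate_succ_apply' M'.faceNext]
        exact hall _
      unfold LabeledMap.FaceSum
      rw [hf]
      exact ⟨fun h => absurd h (hS.notMem_face hM'.toIsRotation ho (hl o) hall), fun _ => hw⟩
    · push Not at hall
      obtain ⟨n, hn⟩ := hall
      obtain ⟨k, hk, hkX⟩ := exists_last_mem hd hn
      have hz := hS.rev_mem _ (hk k le_rfl)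
      have hzf : M'.faceNext^[k] d ∈ (M.sub M' ν).face d :=
        ⟨k, hG.iterate_face hS.rev_mem hk k le_rfl⟩
      set z := M'.faceNext^[k] d
      have key : ∀ c' : Dart G, (M.sub M' ν).FaceSum o (M'.cw c') →
          z.rev.rev ∈ (M.sub M' ν).face (M'.cw c') → (M.sub M' ν).FaceSum o d := by
        intro c' h1 h2
        exact h1.of_eq ((hSr.face_eq hzf).symm.trans (hSr.face_eq h2))
      rcases hS.mixed _ hz _ hkX (hM'.fst _).symm with e | e
      · obtain ⟨c', -, -, -, h1, h2⟩ := hleft hS.swap ht₁ ht₁'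
        exact key c' h1 (h2 _ hz e hkX)
      · obtain ⟨c', -, -, -, h1, h2⟩ := hleft hS ht ht'
        exact key c' h1 (h2 _ hz e hkX)
  · by_cases hall : ∀ n, M.faceNext^[n] d ∉ ν.darts
    · have hf : (M.sub M' ν).face d = M.face d := by
        ext x
        refine exists_congr fun n => ?_
        rw [hG.symm.iterate_face hXc (fun i _ => hall i) n le_rfl]
      have hw : ∑ᶠ x ∈ M.face d, (M.sub M' ν).weight x = ∑ᶠ x ∈ M.face d, M.weight x := by
        refine finsum_mem_congr rfl ?_
        rintro x ⟨n, rfl⟩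
        refine sub_weight_outside hXc (hall n) ?_
        rw [← Function.iterate_succ_apply' M.faceNext]
        exact hall _
      have := hMo d
      unfold LabeledMap.FaceSum at this ⊢
      rwa [hf, hw]
    · push Not at hall
      obtain ⟨n, hn⟩ := hall
      obtain ⟨k, hk, hkX⟩ := exists_last_mem (f := M.faceNext) (Y := ν.dartsᶜ) hd
        (not_not.2 hn)
      have hz := hXc _ (hk k le_rfl)
      have hzf := hG.symm.iterate_face hXc hk k le_rfl
      set z := M.faceNext^[k] d
      have hkX : M.cw z.rev ∈ ν.darts := not_not.1 hkX
      have key : ∀ c' ∉ ν.darts, c'.fst = z.rev.fst → M'.cw c' ∈ ν.darts →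
          (M.sub M' ν).FaceSum o (M'.cw c') → (M.sub M' ν).FaceSum o d := by
        intro c' hc' e hcX' h1
        refine h1.of_eq (hSr.face_eq ⟨k + 1, ?_⟩).symm
        rw [Function.iterate_succ_apply', hzf]
        exact hG.entry _ hz hkX c' hc' e hcX'
      have e := hS.mixed _ hkX _ hz (hM.fst _)
      rw [hM.fst] at e
      rcases e with e | e
      · obtain ⟨c', hc', hcu', hcX', h1, -⟩ := hleft hS ht ht'
        exact key c' hc' (hcu'.trans e.symm) hcX' h1
      · obtain ⟨c', hc', hcu', hcX', h1, -⟩ := hleft hS.swap ht₁ ht₁'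
        exact key c' hc' (hcu'.trans e.symm) hcX' h1

end Faces

end SPOrtho

/-! ### The substitution theorem -/

theorem mainTheorem4 {V E : Type*} (G : Graph V E)
    (hbi : SPOrtho.Biconnected G) (hdeg : SPOrtho.MaxDegreeFour G)
    (e : E) (T : SPOrtho.SPQTree G) (hT : SPOrtho.SPQTree.IsSPQTree G e T)
    (ν : SPOrtho.SPQTree G) (hν : T.IsNode ν) (hroot : ν ≠ T)
    (H H' : SPOrtho.LabeledMap G) (o o' : SPOrtho.Dart G) (ho : o.edge = e) (ho' : o'.edge = e)
    (hH : H.IsOrthogonalRep o) (hH' : H'.IsOrthogonalRep o')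
    (σ : ℚ) (hσ : H.HasSpirality ν σ) (hσ' : H'.HasSpirality ν σ) :
    (H.sub H' ν).IsOrthogonalRep o := by
  classical
  have := hT.finite
  have hl := hT.fst_ne_snd
  have hS := hT.sep hbi hν hroot
  have hV : ∀ x ∈ G.vertexSet, ∃ d : SPOrtho.Dart G, d.fst = x := by
    intro x hx
    rw [← hT.2.1] at hx
    obtain ⟨f, -, y, hy⟩ := hx
    exact ⟨⟨f, x, y, hy⟩, rfl⟩
  have hsingle : ∀ o : SPOrtho.Dart G, o.edge = e → SPOrtho.IsSingleOrAvoids ν.darts o := by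
    rintro o rfl
    obtain ⟨-, -, -, -, h | h⟩ := (hT.node hbi hν).resolve_left hroot
    · exact Or.inl h
    · exact Or.inr fun d hd => SPOrtho.Dart.eq_or_eq_rev (h d hd)
  have hM := hH.isDrawing hl hV
  have hM' := hH'.isDrawing hl hV
  have hfs : ∀ (M : SPOrtho.LabeledMap G) (o : SPOrtho.Dart G), M.IsOrthogonalRep o →
      ∀ d, M.FaceSum o d := by
    intro M o h d
    have h1 := h.sum_weight d
    rw [h.isRotation.mem_face_comm] at h1
    exact ⟨fun h2 => by rw [h1, if_pos h2], fun h2 => by rw [h1, if_neg h2]⟩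
  have hB := hM.isBlock hbi hl hS
  have hB' := hM'.isBlock hbi hl hS
  have hr := (SPOrtho.isGlued_sub hM.toIsRotation hM'.toIsRotation hB hB').isRotation
    hM.toIsRotation hM'.toIsRotation hB hB'
  obtain ⟨τ, hτ, ht⟩ := hσ.hasTurning
  obtain ⟨τ', hτ', ht'⟩ := hσ'.hasTurning
  -- Both integers are twice the common spirality. From here on the pairing of the alias vertices
  -- plays no role.
  obtain rfl : τ' = τ := by exact_mod_cast hτ'.trans hτ.symm
  have hface := SPOrtho.sub_faceSum hM hM' hbi hl hS (hsingle o ho) (hsingle o' ho')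
    (hfs H o hH) (hfs H' o' hH') ht ht'
  refine SPOrtho.isOrthogonalRep_of_sums hr hl hV ?_ ?_ ?_ ?_ ((hface o).1 ⟨0, rfl⟩)
    fun d hd => (hface d).2 fun h => hd ((hr.mem_face_comm d o).1 h)
  · intro d
    rcases SPOrtho.sub_angle_or (M := H) (M' := H') (ν := ν) d with ⟨x, hx⟩ | ⟨x, hx⟩
    · rw [hx]; exact hH.angle_mem x
    · rw [hx]; exact hH'.angle_mem x
  · intro d
    by_cases hd : d ∈ ν.darts
    · simpa only [SPOrtho.LabeledMap.sub, if_pos hd] using hH'.bends_mem d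
    · simpa only [SPOrtho.LabeledMap.sub, if_neg hd] using hH.bends_mem d
  · intro d
    by_cases hd : d ∈ ν.darts
    · simpa only [SPOrtho.LabeledMap.sub, if_pos hd, if_pos (hS.rev_mem d hd)] using
        hH'.bends_rev d
    · simpa only [SPOrtho.LabeledMap.sub, if_neg hd,
        if_neg (fun h => hd ((hS.rev_mem_iff d).1 h))] using hH.bends_rev d
  · intro d
    rcases SPOrtho.sub_angle_at hM hM' hB hB' d.fst with h | h
    · rw [← hM.vertex d]
      exact finsum_mem_congr rfl fun x hx => by rw [h x (Eq.symm hx)]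
    · rw [← hM'.vertex d]
      exact finsum_mem_congr rfl fun x hx => by rw [h x (Eq.symm hx)]
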